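/- **Conventions.** Graphs are simple; test graphs $F$ are finite. A graphon $\mathcal W=(W,\mathscr S)$ consists of a $\sigma$-finite measure space $\mathscr S=(S,\mathcal S,\mu)$ with $\mu(S)>0$ and a symmetric, $\mathcal S\times\mathcal S$-measurable function $W\in L^1(S\times S)$. For a $[0,1]$-valued graphon with $\|W\|_1>0$, sample a Poisson random measure on $\mathbb R_+\times S$ with intensity $\lambda\times\mu$ ($\lambda$ Lebesgue measure) and join any two distinct points $(t_1,x_1),(t_2,x_2)$ by an edge with probability $W(x_1,x_2)$, conditionally independently for all pairs given the points. Let $\widetilde G_t(\mathcal W)$ be the subgraph induced by the points $(t',x)$ with $t'\le t$, and $G_t(\mathcal W)$ the graph obtained from it by deleting its isolated vertices. All graphs of a process have vertices labeled by distinct natural numbers; a graph process is a stochastic process $(G_t)_{t\ge0}$ of such graphs with finitely many edges that is càdlàg for pointwise convergence of the vertex and edge indicators. A graph process is called a graphon process with (resp. without) isolated vertices generated by $\mathcal W$ if it can be coupled with $(\widetilde G_t(\mathcal W))_t$ (resp. $(G_t(\mathcal W))_t$) so that almost surely one bijection of the vertices carries one family to the other at all times; a random family of graphs is called a graphon process generated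 by $\mathcal W$ if, after removal of all isolated vertices from each $G_t$, it is a graphon process without isolated vertices generated by $\mathcal W$. For a graph $G$ with finitely many, but at least one, edges, let $\hom(F,G)$ and $\operatorname{inj}(F,G)$ be the numbers of homomorphisms and of injective homomorphisms $F\to G$, and put $$h(F,G)=\frac{\hom(F,G)}{(2|E(G)|)^{|V(F)|/2}},\qquad h_{\rm inj}(F,G)=\frac{\operatorname{inj}(F,G)}{(2|E(G)|)^{|V(F)|/2}},$$ $$h(F,\mathcal W)=\|W\|_1^{-|V(F)|/2}\int_{S^{V(F)}}\prod_{ij\in E(F)}W(x_i,x_j)\prod_{i\in V(F)}d\mu(x_i)\in[0,\infty].$$ A family of finite graphs (indexed by $n\in\mathbb N$ or by $t\ge0$), eventually with at least one edge, is left convergent if its edge density $2|E|/|V|^2$ converges and, for every connected $F$ with at least two vertices, $h(F,\cdot)$ has a finite limit. For integrable $W$ over a measure space with measure $\mu$ put $\|W\|_{\square,\mu}=\sup_{U,V}\left|\int_{U\times V}W\,d\mu\,d\mu\right|$ over measurable $U,V$. For graphons over spaces of equal total measure, $\delta_\square(\mathcal W_1,\mathcal W_2)$ is the infimum of $\|W_1^{\pi_1}-W_2^{\pi_2}\|_{\square,\gamma}$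 over all couplings $\gamma$ of $\mu_1$ and $\mu_2$, where $W_i^{\pi_i}$ is the pullback of $W_i$ to $S_1\times S_2$; if the total measures differ, both graphons are first extended by $0$ to $\sigma$-finite spaces of equal total measure. The stretched cut metric $\delta^s_\square$ is $\delta_\square$ after replacing each $\mu_i$ by $\|W_i\|_1^{-1/2}\mu_i$ (by $\mu_i$ itself if $\|W_i\|_1=0$). A finite graph on $n$ vertices is identified with the graphon over $\mathbb R_+$ that is the indicator of the union of the products of the unit intervals of adjacent vertices, the $i$-th vertex corresponding to $[i-1,i)$. A sequence of graphs is convergent for $\delta_\square^s$ if it is a Cauchy sequence for $\delta_\square^s$. **Proposition.** (i) Let $\mathcal W=(W,\mathscr S)$ be a $[0,1]$-valued graphon with $\|W\|_1>0$ and $(G_t)$ a graphon process generated by $\mathcal W$. Then for every connected $F$ with at least two vertices, almost surely $\lim_{t\to\infty}h_{\rm inj}(F,G_t)=h(F,\mathcal W)\in[0,\infty]$. (ii) In the setting of (i), suppose that $D_W(x)=\int_S W(x,y)\,d\mu(y)$ is in $L^p(S,\mu)$ for all $p\in[1,\infty)$. Then for every connected $F$ with at least two vertices $h(F,\mathcal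 W)<\infty$ and, almost surely, $\lim_{t\to\infty}h(F,G_t)=\lim_{t\to\infty}h_{\rm inj}(F,G_t)=h(F,\mathcal W)$. Moreover, almost surely the process obtained from $(G_t)$ by deleting the isolated vertices of each $G_t$ is left convergent; if $\mu(S)<\infty$ and $(G_t)$ is a graphon process with isolated vertices, then $(G_t)$ itself is also almost surely left convergent. (iii) Let $(G_n)_{n\in\mathbb N}$ be a sequence of finite simple graphs whose degrees are bounded by a constant independent of $n$ and whose numbers of non-isolated vertices tend to infinity. Then $(G_n)$ is left convergent, and $\lim_{n\to\infty}h(F,G_n)=0$ for every connected $F$ with at least three vertices. (iv) Neither of left convergence and convergence for $\delta_\square^s$ implies the other. There is a sequence of finite simple graphs with $|E(G_n)|\to\infty$ that is left convergent but not convergent for $\delta_\square^s$; and there is a sequence of finite simple graphs with $|E(G_n)|\to\infty$ that is convergent for $\delta_\square^s$ but not left convergent, because for some connected $F$ with at least two vertices the sequence $h(F,G_n)$ has no finite limit. -/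

import Mathlib

open MeasureTheory ProbabilityTheory Filter Topology Set
open scoped NNReal ENNReal

universe u v w

noncomputable section

namespace GraphonLeft

/-- Lebesgue measure on `ℝ₊ = [0, ∞)`. -/
def lebesgue : Measure ℝ≥0 := (volume : Measure ℝ).comap ((↑) : ℝ≥0 → ℝ)

/-! ### Graphons over σ-finite measure spaces -/

section Graphons

variable {S : Type*} [MeasurableSpace S]

/-- `(W, (S, μ))` is a graphon: `μ` is σ-finite with `μ(S) > 0`, and `W` is symmetric, measurable
for the product σ-algebra and integrable for `μ × μ`. -/
structure IsGraphon (μ : Measure S) (W : S → S → ℝ) : Prop where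
  sigmaFinite : SigmaFinite μ
  pos : 0 < μ univ
  symm : ∀ x y, W x y = W y x
  measurable : Measurable (Function.uncurry W)
  integrable : Integrable (Function.uncurry W) (μ.prod μ)

/-- The norm `‖W‖₁` in `L¹(S × S)`. -/
def l1Norm (μ : Measure S) (W : S → S → ℝ) : ℝ≥0∞ :=
  ∫⁻ p, ‖W p.1 p.2‖ₑ ∂(μ.prod μ)

/-- The degree function `D_W(x) = ∫ W(x, y) dμ(y)`. -/
def degreeFun (μ : Measure S) (W : S → S → ℝ) (x : S) : ℝ :=
  ∫ y, W x y ∂μ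

/-- The rescaled homomorphism density
`h(F, W) = ‖W‖₁^{-k/2} ∫_{S^k} ∏_{ij ∈ E(F)} W(x_i, x_j) dx₁ ⋯ dx_k ∈ [0, ∞]` of a graph `F` on
`k` vertices in a non-negative graphon; each edge of `F` is listed once, as a pair `i < j`. -/
def graphonDensity {k : ℕ} (F : SimpleGraph (Fin k)) (μ : Measure S) (W : S → S → ℝ) : ℝ≥0∞ :=
  open Classical in
  (∫⁻ x : Fin k → S,
      ∏ p : Fin k × Fin k with p.1 < p.2 ∧ F.Adj p.1 p.2, ENNReal.ofReal (W (x p.1) (x p.2))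
    ∂(Measure.pi fun _ => μ)) / l1Norm μ W ^ ((k : ℝ) / 2)

end Graphons

/-! ### Homomorphism densities and left convergence of graphs -/

section Densities

variable {V : Type*} {k : ℕ}

/-- The rescaled homomorphism density `h(F, G) = hom(F, G) / (2|E(G)|)^{|V(F)|/2}`. -/
def homDensity (F : SimpleGraph (Fin k)) (G : SimpleGraph V) : ℝ≥0∞ :=
  ((ENat.card (F →g G) : ℕ∞) : ℝ≥0∞) / (2 * (G.edgeSet.encard : ℝ≥0∞)) ^ ((k : ℝ) / 2)

/-- The rescaled injective homomorphism density
`h_inj(F, G) = inj(F, G) / (2|E(G)|)^{|V(F)|/2}`. -/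
def injDensity (F : SimpleGraph (Fin k)) (G : SimpleGraph V) : ℝ≥0∞ :=
  ((ENat.card {f : F →g G // Function.Injective f} : ℕ∞) : ℝ≥0∞) /
    (2 * (G.edgeSet.encard : ℝ≥0∞)) ^ ((k : ℝ) / 2)

/-- The edge density `ρ(G) = 2|E(G)| / |V(G)|²`. -/
def edgeDensity (G : SimpleGraph V) : ℝ≥0∞ :=
  2 * (G.edgeSet.encard : ℝ≥0∞) / ((ENat.card V : ℕ∞) : ℝ≥0∞) ^ 2

/-- Left convergence of a family of graphs along a filter (`atTop` on `ℕ` for sequences, `atTop`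
on `ℝ≥0` for continuous-time families): the graphs eventually have an edge (so that the densities
are defined), the edge density converges, and `h(F, ·)` has a finite limit for every simple
connected graph `F` with at least two vertices. -/
structure LeftConvergent {ι : Type*} (l : Filter ι) {V : ι → Type*}
    (G : ∀ i, SimpleGraph (V i)) : Prop where
  edges_nonempty : ∀ᶠ i in l, (G i).edgeSet.Nonempty
  edgeDensity_tendsto : ∃ ρ : ℝ≥0, Tendsto (fun i => edgeDensity (G i)) l (𝓝 (ρ : ℝ≥0∞))
  homDensity_tendsto : ∀ k : ℕ, 2 ≤ k → ∀ F : SimpleGraph (Fin k), F.Connected →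
    ∃ c : ℝ≥0, Tendsto (fun i => homDensity F (G i)) l (𝓝 (c : ℝ≥0∞))

end Densities

/-! ### The cut metric and the stretched cut metric -/

section CutMetric

variable {S S₁ S₂ : Type*} [MeasurableSpace S] [MeasurableSpace S₁] [MeasurableSpace S₂]

/-- The cut norm `sup_{U, V} |∫_{U × V} W dμ dμ|` over measurable sets `U`, `V`. -/
def cutNorm (μ : Measure S) (W : S → S → ℝ) : ℝ≥0∞ :=
  ⨆ (U : Set S) (V : Set S) (_ : MeasurableSet U) (_ : MeasurableSet V),
    ENNReal.ofReal |∫ p in U ×ˢ V, W p.1 p.2 ∂(μ.prod μ)|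

/-- `γ` is a coupling of `μ₁` and `μ₂`. -/
def IsCoupling (γ : Measure (S₁ × S₂)) (μ₁ : Measure S₁) (μ₂ : Measure S₂) : Prop :=
  γ.map Prod.fst = μ₁ ∧ γ.map Prod.snd = μ₂

/-- The infimum of `‖W₁^{π₁} - W₂^{π₂}‖_{□, γ}` over all couplings `γ`; this is the cut distance
of graphons over spaces of the same total measure. -/
def couplingCutDist (μ₁ : Measure S₁) (W₁ : S₁ → S₁ → ℝ) (μ₂ : Measure S₂) (W₂ : S₂ → S₂ → ℝ) :
    ℝ≥0∞ :=
  ⨅ (γ : Measure (S₁ × S₂)) (_ : IsCoupling γ μ₁ μ₂),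
    cutNorm γ fun x y => W₁ x.1 y.1 - W₂ x.2 y.2

/-- The extension of the measure space `(S, μ)` by a disjoint copy of `ℝ₊` with Lebesgue measure;
its total measure is infinite. -/
def extendMeasure (μ : Measure S) : Measure (S ⊕ ℝ≥0) :=
  μ.map Sum.inl + lebesgue.map Sum.inr

/-- The trivial extension of a graphon: zero off `S × S`. -/
def trivialExtension (W : S → S → ℝ) : S ⊕ ℝ≥0 → S ⊕ ℝ≥0 → ℝ
  | Sum.inl x, Sum.inl y => W x y
  | _, _ => 0

/-- The cut metric `δ_□`: infimum over couplings if the total measures agree; otherwise both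
graphons are first extended trivially to spaces of equal (here infinite) total measure. -/
def cutDist (μ₁ : Measure S₁) (W₁ : S₁ → S₁ → ℝ) (μ₂ : Measure S₂) (W₂ : S₂ → S₂ → ℝ) : ℝ≥0∞ :=
  open Classical in
  if μ₁ univ = μ₂ univ then couplingCutDist μ₁ W₁ μ₂ W₂
  else couplingCutDist (extendMeasure μ₁) (trivialExtension W₁)
    (extendMeasure μ₂) (trivialExtension W₂)

/-- The rescaled measure `‖W‖₁^{-1/2} μ` (and `μ` itself if `‖W‖₁ = 0`). -/
def stretchMeasure (μ : Measure S) (W : S → S → ℝ) : Measure S :=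
  open Classical in
  if l1Norm μ W = 0 then μ else (l1Norm μ W) ^ (-(1 / 2 : ℝ)) • μ

/-- The stretched cut metric `δ_□^s`: the cut metric after rescaling both measures. -/
def stretchedCutDist (μ₁ : Measure S₁) (W₁ : S₁ → S₁ → ℝ) (μ₂ : Measure S₂)
    (W₂ : S₂ → S₂ → ℝ) : ℝ≥0∞ :=
  cutDist (stretchMeasure μ₁ W₁) W₁ (stretchMeasure μ₂ W₂) W₂

/-- The graphon over `ℝ₊` (with Lebesgue measure) of a finite simple graph: the vertex `i`
corresponds to the unit interval `[i, i + 1)`, and the function is `1` on the products of the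
intervals of adjacent vertices, `0` elsewhere. -/
def graphGraphon {n : ℕ} (G : SimpleGraph (Fin n)) : ℝ≥0 → ℝ≥0 → ℝ :=
  open Classical in
  fun x y => if ∃ i j : Fin n, x ∈ Ico ((i : ℕ) : ℝ≥0) ((i : ℕ) + 1) ∧
    y ∈ Ico ((j : ℕ) : ℝ≥0) ((j : ℕ) + 1) ∧ G.Adj i j then 1 else 0

/-- The stretched cut distance of two finite simple graphs. -/
def graphStretchedCutDist {m n : ℕ} (G : SimpleGraph (Fin m)) (H : SimpleGraph (Fin n)) : ℝ≥0∞ :=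
  stretchedCutDist lebesgue (graphGraphon G) lebesgue (graphGraphon H)

/-- A sequence of finite simple graphs is convergent in the stretched cut metric if it is a Cauchy
sequence for this metric. -/
def StretchedCutConvergent {N : ℕ → ℕ} (G : ∀ n, SimpleGraph (Fin (N n))) : Prop :=
  ∀ ε : ℝ≥0∞, 0 < ε → ∃ n₀ : ℕ, ∀ m n : ℕ, n₀ ≤ m → n₀ ≤ n →
    graphStretchedCutDist (G m) (G n) < ε

end CutMetric

/-! ### Graph processes -/

/-- Simple graphs whose vertices are labeled by distinct natural numbers: a set `verts` of labels
and a symmetric irreflexive adjacency relation between elements of `verts`. -/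
abbrev LabeledGraph : Type := (⊤ : SimpleGraph ℕ).Subgraph

namespace LabeledGraph

/-- The indicators of the possible vertices and edges. -/
def code (G : LabeledGraph) : (ℕ → Bool) × (ℕ → ℕ → Bool) :=
  open Classical in
  (fun i => decide (i ∈ G.verts), fun i j => decide (G.Adj i j))

/-- The topology of pointwise convergence of the vertex and edge indicators. -/
instance : TopologicalSpace LabeledGraph := TopologicalSpace.induced code inferInstance

instance : MeasurableSpace LabeledGraph := borel LabeledGraph

instance : BorelSpace LabeledGraph := ⟨rfl⟩

/-- The graph obtained by deleting all isolated vertices. -/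
def removeIsolated (G : LabeledGraph) : LabeledGraph where
  verts := {i | ∃ j, G.Adj i j}
  Adj := G.Adj
  adj_sub := G.adj_sub
  edge_vert := fun {_ j} h => ⟨j, h⟩
  symm := G.symm

end LabeledGraph

section Processes

variable {S : Type u} [MeasurableSpace S] {Ω : Type v} [MeasurableSpace Ω]

/-- A graph process: a stochastic process of labeled graphs with finitely many edges whose paths
are almost surely càdlàg. -/
structure IsGraphProcess (P : Measure Ω) (G : ℝ≥0 → Ω → LabeledGraph) : Prop where
  measurable : ∀ t, Measurable (G t)
  finite_edges : ∀ᵐ ω ∂P, ∀ t, (G t ω).edgeSet.Finite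
  right_continuous : ∀ᵐ ω ∂P, ∀ t, ContinuousWithinAt (fun s => G s ω) (Ici t) t
  left_limit : ∀ᵐ ω ∂P, ∀ t, ∃ H : LabeledGraph, H.edgeSet.Finite ∧
    Tendsto (fun s => G s ω) (𝓝[<] t) (𝓝 H)

/-- The number of indices `i` with `Y i ∈ A`. -/
def countIn {E : Type*} (Y : ℕ → Ω → E) (A : Set E) (ω : Ω) : ℝ≥0∞ :=
  ({i | Y i ω ∈ A}.encard : ℝ≥0∞)

/-- The points `Y 0, Y 1, …` are the atoms of a Poisson random measure with intensity `ν`: the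
number of points in a set of finite measure is Poisson distributed, and the numbers of points in
disjoint sets are independent. -/
structure IsPoissonPoints {E : Type*} [MeasurableSpace E] (P : Measure Ω) (ν : Measure E)
    (Y : ℕ → Ω → E) : Prop where
  measurable : ∀ i, Measurable (Y i)
  law : ∀ A, MeasurableSet A → ν A ≠ ∞ →
    P.map (countIn Y A) = (poissonMeasure (ν A).toNNReal).map (fun n : ℕ => (n : ℝ≥0∞))
  indep : ∀ (n : ℕ) (A : Fin n → Set E), (∀ j, MeasurableSet (A j)) →
    Pairwise (fun i j => Disjoint (A i) (A j)) → iIndepFun (fun j => countIn Y (A j)) P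

/-- The random infinite graph from which graphon processes are cut out. Its vertices are the points
`(T i, X i)`, `i ∈ ℕ`, of a Poisson random measure on `ℝ₊ × S` with intensity `λ × μ` (enumerated by
`ℕ`; there are infinitely many, as `μ(S) > 0`); conditionally on all the points, two distinct
vertices `i`, `j` are adjacent with probability `W (X i) (X j)`, independently for all pairs. -/
structure IsGraphonSampling (μ : Measure S) (W : S → S → ℝ) (P : Measure Ω)
    (T : ℕ → Ω → ℝ≥0) (X : ℕ → Ω → S) (E : Ω → SimpleGraph ℕ) : Prop where
  poisson : IsPoissonPoints P (lebesgue.prod μ) fun i ω => (T i ω, X i ω)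
  measurable_adj : ∀ i j, MeasurableSet {ω | (E ω).Adj i j}
  edges : ∀ s : Finset (ℕ × ℕ), (∀ p ∈ s, p.1 < p.2) → ∀ A : Set Ω,
    MeasurableSet[MeasurableSpace.comap (fun ω i => (T i ω, X i ω))
      (inferInstance : MeasurableSpace (ℕ → ℝ≥0 × S))] A →
    P (A ∩ {ω | ∀ p ∈ s, (E ω).Adj p.1 p.2}) =
      ∫⁻ ω in A, ∏ p ∈ s, ENNReal.ofReal (W (X p.1 ω) (X p.2 ω)) ∂P

/-- The subgraph of `E` induced by the vertices born up to time `t`. -/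
def snapshot (T : ℕ → ℝ≥0) (E : SimpleGraph ℕ) (t : ℝ≥0) : LabeledGraph where
  verts := {i | T i ≤ t}
  Adj i j := E.Adj i j ∧ T i ≤ t ∧ T j ≤ t
  adj_sub := fun h => h.1.ne
  edge_vert := fun h => h.2.1
  symm := ⟨fun _ _ h => ⟨h.1.symm, h.2.2, h.2.1⟩⟩

/-- Two families of labeled graphs are equal up to relabeling of the vertices: one bijection of the
vertices that ever occur carries the first family to the second at all times. -/
def EqualUpToRelabeling (G H : ℝ≥0 → LabeledGraph) : Prop :=
  ∃ φ : ℕ → ℕ, BijOn φ (⋃ t, (G t).verts) (⋃ t, (H t).verts) ∧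
    ∀ t, φ '' (G t).verts = (H t).verts ∧
      ∀ i ∈ ⋃ s, (G s).verts, ∀ j ∈ ⋃ s, (G s).verts,
        ((G t).Adj i j ↔ (H t).Adj (φ i) (φ j))

/-- `G` is a graphon process with isolated vertices generated by `(W, (S, μ))`: it is a graph
process which has, up to relabeling of the vertices, the law of the family `(G̃_t)` of the induced
subgraphs on the vertices born up to time `t`. -/
def IsGraphonProcessWithIsolated (μ : Measure S) (W : S → S → ℝ) (P : Measure Ω)
    (G : ℝ≥0 → Ω → LabeledGraph) : Prop :=
  IsGraphProcess P G ∧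
    ∃ (Ω' : Type (max u v)) (_ : MeasurableSpace Ω') (P' : Measure Ω')
      (G' : ℝ≥0 → Ω' → LabeledGraph) (T : ℕ → Ω' → ℝ≥0) (X : ℕ → Ω' → S)
      (E : Ω' → SimpleGraph ℕ),
      IsProbabilityMeasure P' ∧ IsGraphonSampling μ W P' T X E ∧
      IdentDistrib (fun ω t => G t ω) (fun ω t => G' t ω) P P' ∧
      ∀ᵐ ω ∂P', EqualUpToRelabeling (fun t => G' t ω)
        (fun t => snapshot (fun i => T i ω) (E ω) t)

/-- `G` is a graphon process without isolated vertices generated by `(W, (S, μ))`: as above, with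
the isolated vertices of each `G̃_t` deleted. -/
def IsGraphonProcessWithoutIsolated (μ : Measure S) (W : S → S → ℝ) (P : Measure Ω)
    (G : ℝ≥0 → Ω → LabeledGraph) : Prop :=
  IsGraphProcess P G ∧
    ∃ (Ω' : Type (max u v)) (_ : MeasurableSpace Ω') (P' : Measure Ω')
      (G' : ℝ≥0 → Ω' → LabeledGraph) (T : ℕ → Ω' → ℝ≥0) (X : ℕ → Ω' → S)
      (E : Ω' → SimpleGraph ℕ),
      IsProbabilityMeasure P' ∧ IsGraphonSampling μ W P' T X E ∧
      IdentDistrib (fun ω t => G t ω) (fun ω t => G' t ω) P P' ∧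
      ∀ᵐ ω ∂P', EqualUpToRelabeling (fun t => G' t ω)
        (fun t => (snapshot (fun i => T i ω) (E ω) t).removeIsolated)

/-- `G` is a graphon process generated by `(W, (S, μ))`: after removal of all isolated vertices it
is a graphon process without isolated vertices. -/
def IsGraphonProcess (μ : Measure S) (W : S → S → ℝ) (P : Measure Ω)
    (G : ℝ≥0 → Ω → LabeledGraph) : Prop :=
  IsGraphonProcessWithoutIsolated μ W P fun t ω => (G t ω).removeIsolated

end Processes

end GraphonLeft

end

set_option linter.unusedSectionVars false

noncomputable section

namespace GraphonLeft

/-! Parts (i) and (ii) rest on a strong law of large numbers (`ae_tendsto_copyCount`): in the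
sampled graph, the number of injective copies of `F` born up to time `t`, divided by `t ^ k` with `k
= |V(F)|`, tends almost surely to `I(F) = ∫ ∏ W ∈ [0, ∞]`. For a single edge this says that `2|E| /
t ^ 2` tends to `‖W‖₁`, and dividing the two limits gives the limit of the injective density.

The strong law comes from a truncated second moment. The multivariate Campbell formula (`campbell`,
`IsGraphonSampling.campbell_edges`) follows from the factorial moments of Poisson variables and
turns expected numbers of tuples of distinct points with prescribed edges into integrals. The square
of a copy count is a sum over pairs of copies, sorted by how they overlap. Disjoint pairs give the
square of the mean. Pairs overlapping in a vertex set `B` give a term smaller by `t ^ (-|B|)`, but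
weighted by the extension weight `g` of the common part, which need not be square integrable. So
only copies are counted all of whose parts satisfy `g ≤ t ^ |B|` (`goodSet`). Along geometric times
`t = ρ ^ j` two elementary sums, of `q⁻¹ ^ j * g` over `g ≤ q ^ j` and of `q ^ j` over `q ^ j < g`,
are at most constants, respectively constants times `g`. The first makes the variances summable, the
second gives Borel–Cantelli for the discarded copies, and both use only `I(F) < ∞`. Monotonicity in
`t` fills in the remaining times as `ρ` decreases to `1`. If `I(F) = ∞`, one restricts to subsets of
finite measure and lets them grow.

For (ii), a homomorphism that is not injective is an injective homomorphism of a quotient of `F`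
with fewer vertices, so such maps are of lower order once all `I` are finite. Finiteness follows
from the moments of the degree function by integrating out one vertex after another. The edge
density also needs the number of vertices: the number of non-isolated points divided by `t` tends to
`μ {D_W ≠ 0}`, because a Chebyshev bound shows that few points of positive degree are still
isolated.

A graphon process shares only its law, up to relabeling, with the sampled graph. The limits transfer
because the counts are monotone, so that a limit along integer times, a measurable event, determines
the limit along all times.

Part (iii) is a count: `hom(F, G)` is at most `d ^ (k - 1)` times the number of non-isolated
vertices, which is at most `2|E|`, while `h` divides by a power of `2|E|` greater than one when `k ≥
3`. For (iv), perfect matchings have bounded degree, but their stretched graphons spread out without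
limit, so two of very different sizes stay at distance at least `1/2`. Conversely, a star with
`o(|E|)` edges attached to a clique is invisible to the stretched cut metric, yet its two-leaf stars
outnumber `|E| ^ (3/2)`. -/

/-! ### Factorial moments of Poisson counts -/

/-- The falling factorial `c (c - 1) ⋯ (c - m + 1)` of an extended non-negative number. -/
def fallingFactorial (m : ℕ) (c : ℝ≥0∞) : ℝ≥0∞ := ∏ j ∈ Finset.range m, (c - j)

lemma fallingFactorial_natCast (m n : ℕ) :
    fallingFactorial m (n : ℝ≥0∞) = (n.descFactorial m : ℝ≥0∞) := by
  induction m with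
  | zero => simp [fallingFactorial]
  | succ m ih =>
    rw [fallingFactorial, Finset.prod_range_succ, ← fallingFactorial, ih, Nat.descFactorial_succ]
    push_cast
    rw [mul_comm]

lemma measurable_fallingFactorial (m : ℕ) : Measurable (fallingFactorial m) := by
  unfold fallingFactorial
  fun_prop

/-- Since `(i + m)!` is `i!` times the falling factorial of `i + m`, shifting the summation index by
`m` leaves `r ^ m` times the total mass. Falling factorials are the right moments because they count
tuples of distinct points. -/
lemma lintegral_descFactorial_poissonMeasure (r : ℝ≥0) (m : ℕ) :
    ∫⁻ n, (n.descFactorial m : ℝ≥0∞) ∂(poissonMeasure r) = (r : ℝ≥0∞) ^ m := by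
  rw [lintegral_countable']
  simp_rw [poissonMeasure_singleton]
  rw [← ENNReal.summable.sum_add_tsum_nat_add' (k := m)]
  have h0 : ∑ i ∈ Finset.range m, ((i.descFactorial m : ℕ) : ℝ≥0∞) *
      ENNReal.ofReal (Real.exp (-r) * r ^ i / (i.factorial)) = 0 := by
    refine Finset.sum_eq_zero fun i hi => ?_
    rw [Nat.descFactorial_of_lt (Finset.mem_range.1 hi)]
    simp
  rw [h0, zero_add]
  have h1 : ∀ i : ℕ, (((i + m).descFactorial m : ℕ) : ℝ≥0∞) *
      ENNReal.ofReal (Real.exp (-r) * r ^ (i + m) / ((i + m).factorial)) =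
      (r : ℝ≥0∞) ^ m * poissonMeasure r {i} := by
    intro i
    rw [poissonMeasure_singleton, ← ENNReal.ofReal_natCast, ← ENNReal.ofReal_mul (by positivity),
      ← ENNReal.ofReal_coe_nnreal, ← ENNReal.ofReal_pow (by positivity),
      ← ENNReal.ofReal_mul (by positivity)]
    congr 1
    have h2 := Nat.factorial_mul_descFactorial (Nat.le_add_left m i)
    rw [Nat.add_sub_cancel] at h2
    have h3 : ((i + m).factorial : ℝ) = i.factorial * ((i + m).descFactorial m : ℕ) := by
      rw [← h2]; push_cast; ring
    have h4 : ((i + m).descFactorial m : ℝ) ≠ 0 := by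
      intro h
      rw [h, mul_zero] at h3
      exact (Nat.factorial_ne_zero _) (by exact_mod_cast h3)
    have h5 : (i.factorial : ℝ) ≠ 0 := by exact_mod_cast Nat.factorial_ne_zero i
    rw [h3, pow_add]
    field_simp
  simp_rw [h1]
  rw [ENNReal.tsum_mul_left]
  have : ∑' i, poissonMeasure r {i} = 1 := by
    have := lintegral_countable' (μ := poissonMeasure r) (fun _ => 1)
    simpa using this.symm
  rw [this, mul_one]

section Counting

variable {Ω : Type*} [MeasurableSpace Ω] {E : Type*} [MeasurableSpace E] {P : Measure Ω}
  {ν : Measure E} {Y : ℕ → Ω → E}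

lemma encard_eq_tsum_indicator {α : Type*} (s : Set α) :
    ((s.encard : ℕ∞) : ℝ≥0∞) = ∑' a, s.indicator (fun _ => (1 : ℝ≥0∞)) a := by
  rw [← tsum_subtype, ENNReal.tsum_set_const, mul_one]

lemma measurable_countIn (hY : ∀ i, Measurable (Y i)) {A : Set E} (hA : MeasurableSet A) :
    Measurable (countIn Y A) := by
  have : countIn Y A = fun ω => ∑' i, (Y i ⁻¹' A).indicator (fun _ => (1 : ℝ≥0∞)) ω := by
    ext ω
    rw [countIn, encard_eq_tsum_indicator]
    rfl
  rw [this]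
  exact Measurable.tsum fun i => measurable_const.indicator (hY i hA)

lemma IsPoissonPoints.lintegral_fallingFactorial (h : IsPoissonPoints P ν Y) {A : Set E}
    (hA : MeasurableSet A) (hν : ν A ≠ ∞) (m : ℕ) :
    ∫⁻ ω, fallingFactorial m (countIn Y A ω) ∂P = ν A ^ m := by
  rw [← lintegral_map (measurable_fallingFactorial m) (measurable_countIn h.measurable hA),
    h.law A hA hν, lintegral_map (measurable_fallingFactorial m) measurable_from_top]
  simp_rw [fallingFactorial_natCast]
  rw [lintegral_descFactorial_poissonMeasure, ENNReal.coe_toNNReal hν]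

lemma IsPoissonPoints.ae_countIn_lt_top (h : IsPoissonPoints P ν Y) {A : Set E}
    (hA : MeasurableSet A) (hν : ν A ≠ ∞) : ∀ᵐ ω ∂P, countIn Y A ω < ∞ := by
  have h1 := h.lintegral_fallingFactorial hA hν 1
  simp only [fallingFactorial, Finset.range_one, Finset.prod_singleton, Nat.cast_zero, tsub_zero,
    pow_one] at h1
  exact ae_lt_top (measurable_countIn h.measurable hA) (h1 ▸ hν)

end Counting

/-! ### Injections into disjoint colour classes. -/

section Embeddings

variable {ι α : Type*} [Fintype ι] [Fintype α] [DecidableEq α]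

/-- Embeddings of `ι` into `ℕ` respecting a colouring with disjoint colour classes are families of
embeddings of the fibres of the colouring. -/
def coloredEmbeddingEquiv (I : α → Set ℕ) (hI : Pairwise fun a b => Disjoint (I a) (I b))
    (c : ι → α) :
    {θ : ι ↪ ℕ // ∀ i, θ i ∈ I (c i)} ≃ ∀ a, ({i // c i = a} ↪ I a) where
  toFun θ a := ⟨fun i => ⟨θ.1 i, by have := θ.2 i; rwa [i.2] at this⟩, fun i j h => by
    have : θ.1 i = θ.1 j := congrArg Subtype.val h
    exact Subtype.ext (θ.1.injective this)⟩
  invFun η := ⟨⟨fun i => η (c i) ⟨i, rfl⟩, fun i j h => by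
    have hij : c i = c j := by
      by_contra hne
      refine Set.disjoint_left.1 (hI hne) (η (c i) ⟨i, rfl⟩).2 ?_
      simp only at h
      rw [h]
      exact (η (c j) ⟨j, rfl⟩).2
    have key : ∀ a (hi : c i = a) (hj : c j = a), (η a ⟨i, hi⟩ : ℕ) = η a ⟨j, hj⟩ → i = j := by
      intro a hi hj hη
      exact congrArg Subtype.val ((η a).injective (Subtype.ext hη))
    refine key (c j) hij rfl ?_
    have : ∀ a (hi : c i = a), (η a ⟨i, hi⟩ : ℕ) = η (c i) ⟨i, rfl⟩ := by
      rintro a rfl; rfl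
    exact (this _ hij).trans h⟩, fun i => (η (c i) ⟨i, rfl⟩).2⟩
  left_inv θ := by ext; rfl
  right_inv η := by
    funext a
    ext ⟨i, hi⟩
    subst hi
    rfl

/-- As the classes are disjoint, the fibres of `c` can be embedded independently of one another, and
a fibre with `m` elements has as many injections into a set of size `N` as the falling factorial of
`N` of order `m`. -/
lemma encard_colored_embeddings (I : α → Set ℕ) (hI : Pairwise fun a b => Disjoint (I a) (I b))
    (hfin : ∀ a, (I a).Finite) (c : ι → α) :
    (({θ : ι ↪ ℕ | ∀ i, θ i ∈ I (c i)}.encard : ℕ∞) : ℝ≥0∞) =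
      ∏ a, fallingFactorial (Fintype.card {i // c i = a}) (((I a).encard : ℕ∞) : ℝ≥0∞) := by
  classical
  have : ∀ a, Fintype (I a) := fun a => (hfin a).fintype
  have e := coloredEmbeddingEquiv I hI c
  have h1 : ({θ : ι ↪ ℕ | ∀ i, θ i ∈ I (c i)}).encard =
      ENat.card (∀ a, ({i // c i = a} ↪ I a)) := ENat.card_congr e
  rw [h1, ENat.card_eq_coe_fintype_card, Fintype.card_pi]
  rw [ENat.toENNReal_coe, Nat.cast_prod]
  refine Finset.prod_congr rfl fun a _ => ?_
  rw [Fintype.card_embedding_eq, ← fallingFactorial_natCast, ← ENat.card_coe_set_eq,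
    ENat.card_eq_coe_fintype_card, ENat.toENNReal_coe]

end Embeddings

/-! ### Lebesgue measure on the half-line -/

lemma measurableEmbedding_nnreal_toReal : MeasurableEmbedding ((↑) : ℝ≥0 → ℝ) :=
  MeasurableEmbedding.subtype_coe measurableSet_Ici

lemma lebesgue_Iic (t : ℝ≥0) : lebesgue (Iic t) = t := by
  rw [lebesgue, measurableEmbedding_nnreal_toReal.comap_apply]
  have : ((↑) : ℝ≥0 → ℝ) '' Iic t = Icc 0 (t : ℝ) := by
    ext x
    constructor
    · rintro ⟨y, hy, rfl⟩
      exact ⟨y.2, hy⟩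
    · rintro ⟨h0, h1⟩
      exact ⟨⟨x, h0⟩, h1, rfl⟩
  rw [this, Real.volume_Icc, sub_zero, ENNReal.ofReal_coe_nnreal]

instance : SigmaFinite lebesgue :=
  ⟨⟨{ set := fun n : ℕ => Iic (n : ℝ≥0)
      set_mem := fun _ => trivial
      finite := fun n => by rw [lebesgue_Iic]; exact ENNReal.coe_lt_top
      spanning := by
        refine eq_univ_of_forall fun x => mem_iUnion.2 ?_
        obtain ⟨n, hn⟩ := exists_nat_ge x
        exact ⟨n, hn⟩ }⟩⟩

/-! ### The multivariate Campbell formula -/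

section Campbell

variable {Ω : Type*} [MeasurableSpace Ω] {S : Type*} [MeasurableSpace S] {P : Measure Ω}
  {μ : Measure S} [SigmaFinite μ] {T : ℕ → Ω → ℝ≥0} {X : ℕ → Ω → S}
  {ι : Type*} [Fintype ι]

/-- The event that the points with indices in the range of `θ` are born up to time `t`. -/
def bornBy (T : ℕ → Ω → ℝ≥0) (t : ℝ≥0) (θ : ι ↪ ℕ) : Set Ω := {ω | ∀ i, T (θ i) ω ≤ t}

lemma measurableSet_bornBy (hT : ∀ i, Measurable (T i)) (t : ℝ≥0) (θ : ι ↪ ℕ) :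
    MeasurableSet (bornBy T t θ) := by
  have : bornBy T t θ = ⋂ i, T (θ i) ⁻¹' Iic t := by ext; simp [bornBy]
  rw [this]
  exact MeasurableSet.iInter fun i => hT _ measurableSet_Iic

/-- The intensity measure of the tuples of distinct points born up to time `t`. -/
def tupleMeasure (ι : Type*) (P : Measure Ω) (T : ℕ → Ω → ℝ≥0) (X : ℕ → Ω → S) (t : ℝ≥0) :
    Measure (ι → S) :=
  Measure.sum fun θ : ι ↪ ℕ => (P.restrict (bornBy T t θ)).map fun ω i => X (θ i) ω

instance : Countable (ι ↪ ℕ) := DFunLike.coe_injective.countable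

/-- When any two sides of the box are equal or disjoint, the number of tuples of distinct points in
it is a product of falling factorials of the counts in the different sides. These counts are
independent, and each factor has a power of the intensity as its expectation. -/
lemma tupleMeasure_pi_of_disjoint
    (h : IsPoissonPoints P (lebesgue.prod μ) fun i ω => (T i ω, X i ω)) (t : ℝ≥0)
    {α : Type*} [Fintype α] {B : α → Set S} (hB : ∀ a, MeasurableSet (B a))
    (hfin : ∀ a, μ (B a) ≠ ∞) (hd : Pairwise fun a b => Disjoint (B a) (B b)) (c : ι → α) :
    tupleMeasure ι P T X t (univ.pi fun i => B (c i)) = ∏ i, (t * μ (B (c i))) := by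
  classical
  have hT : ∀ i, Measurable (T i) := fun i => (h.measurable i).fst
  have hX : ∀ i, Measurable (X i) := fun i => (h.measurable i).snd
  set A : α → Set (ℝ≥0 × S) := fun a => Iic t ×ˢ B a with hA
  have hAm : ∀ a, MeasurableSet (A a) := fun a => measurableSet_Iic.prod (hB a)
  have hAν : ∀ a, (lebesgue.prod μ) (A a) = t * μ (B a) := fun a => by
    rw [hA, Measure.prod_prod, lebesgue_Iic]
  have hAfin : ∀ a, (lebesgue.prod μ) (A a) ≠ ∞ := fun a => by
    rw [hAν]; exact ENNReal.mul_ne_top ENNReal.coe_ne_top (hfin a)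
  have hAd : Pairwise fun a b => Disjoint (A a) (A b) := fun a b hab =>
    Set.disjoint_left.2 fun x hx hy => Set.disjoint_left.1 (hd hab) hx.2 hy.2
  set Y : ℕ → Ω → ℝ≥0 × S := fun i ω => (T i ω, X i ω) with hY
  set I : Ω → α → Set ℕ := fun ω a => {n | Y n ω ∈ A a} with hIdef
  have hId : ∀ ω, Pairwise fun a b => Disjoint (I ω a) (I ω b) := fun ω a b hab =>
    Set.disjoint_left.2 fun n hn hm => Set.disjoint_left.1 (hAd hab) hn hm
  have hpi : MeasurableSet (univ.pi fun i => B (c i)) := MeasurableSet.univ_pi fun i => hB _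
  have hXθ : ∀ θ : ι ↪ ℕ, Measurable fun ω i => X (θ i) ω := fun θ =>
    measurable_pi_lambda _ fun i => hX _
  have hev : ∀ θ : ι ↪ ℕ, MeasurableSet {ω | ∀ i, θ i ∈ I ω (c i)} := fun θ => by
    have : {ω | ∀ i, θ i ∈ I ω (c i)} = ⋂ i, Y (θ i) ⁻¹' A (c i) := by ext; simp [hIdef]
    rw [this]
    exact MeasurableSet.iInter fun i => h.measurable _ (hAm _)
  have h1 : tupleMeasure ι P T X t (univ.pi fun i => B (c i)) =
      ∑' θ : ι ↪ ℕ, ∫⁻ ω, {ω | ∀ i, θ i ∈ I ω (c i)}.indicator (fun _ => 1) ω ∂P := by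
    rw [tupleMeasure, Measure.sum_apply _ hpi]
    refine tsum_congr fun θ => ?_
    rw [Measure.map_apply (hXθ θ) hpi, Measure.restrict_apply (hXθ θ hpi),
      lintegral_indicator_const (hev θ), one_mul]
    congr 1
    ext ω
    simp only [mem_inter_iff, mem_preimage, Set.mem_pi, mem_univ, true_imp_iff, bornBy, mem_ofPred_eq,
      hIdef, hY, hA, mem_prod, mem_Iic, forall_and]
    tauto
  rw [h1, ← lintegral_tsum fun θ => (measurable_const.indicator (hev θ)).aemeasurable]
  have h2 : ∀ᵐ ω ∂P, ∑' θ : ι ↪ ℕ, {ω | ∀ i, θ i ∈ I ω (c i)}.indicator (fun _ => (1 : ℝ≥0∞)) ω =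
      ∏ a, fallingFactorial (Fintype.card {i // c i = a}) (countIn Y (A a) ω) := by
    have hlt : ∀ᵐ ω ∂P, ∀ a, countIn Y (A a) ω < ∞ :=
      ae_all_iff.2 fun a => h.ae_countIn_lt_top (hAm a) (hAfin a)
    filter_upwards [hlt] with ω hω
    have hI : ∀ a, (I ω a).Finite := fun a => by
      have := hω a
      rw [countIn] at this
      exact Set.encard_ne_top_iff.1 (by simpa using this.ne)
    refine Eq.trans ?_ (encard_colored_embeddings (I ω) (hId ω) hI c)
    rw [encard_eq_tsum_indicator]
    rfl
  rw [lintegral_congr_ae h2]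
  -- Independence is assumed for families indexed by `Fin n`, so the colours are enumerated.
  let e := Fintype.equivFin α
  have hind : iIndepFun (fun j => countIn Y (A (e.symm j))) P :=
    h.indep _ (fun j => A (e.symm j)) (fun j => hAm _) fun i j hij =>
      hAd (e.symm.injective.ne hij)
  have hind' := hind.comp
    (fun j => fallingFactorial (Fintype.card {i // c i = e.symm j}))
    (fun j => measurable_fallingFactorial _)
  have h3 := lintegral_prod_eq_prod_lintegral_of_indepFun Finset.univ _ hind'
    (fun j => (measurable_fallingFactorial _).comp (measurable_countIn h.measurable (hAm _)))
  have h4 : ∀ ω, ∏ a, fallingFactorial (Fintype.card {i // c i = a}) (countIn Y (A a) ω) =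
      ∏ j, fallingFactorial (Fintype.card {i // c i = e.symm j}) (countIn Y (A (e.symm j)) ω) :=
    fun ω => (Equiv.prod_comp e.symm
      fun a => fallingFactorial (Fintype.card {i // c i = a}) (countIn Y (A a) ω)).symm
  simp_rw [h4]
  refine h3.trans ?_
  simp only [Function.comp_apply]
  simp_rw [h.lintegral_fallingFactorial (hAm _) (hAfin _), hAν]
  rw [Equiv.prod_comp e.symm fun a => (t * μ (B a)) ^ (Fintype.card {i // c i = a}),
    ← Finset.prod_fiberwise Finset.univ c]
  refine Finset.prod_congr rfl fun a _ => ?_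
  rw [Finset.prod_congr rfl (g := fun _ => (t * μ (B a)))
    (fun i hi => by rw [(Finset.mem_filter.1 hi).2]), Finset.prod_const, Fintype.card_subtype]

/-- The atoms of the finite algebra generated by the sides are disjoint. The box is a disjoint union
of boxes with atoms as sides, and expanding the product of the sums `μ (A i) = ∑ μ (B a)` gives the
claim. -/
lemma tupleMeasure_pi
    (h : IsPoissonPoints P (lebesgue.prod μ) fun i ω => (T i ω, X i ω)) (t : ℝ≥0)
    {A : ι → Set S} (hA : ∀ i, MeasurableSet (A i)) (hfin : ∀ i, μ (A i) ≠ ∞) :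
    tupleMeasure ι P T X t (univ.pi A) = ∏ i, (t * μ (A i)) := by
  classical
  -- The atom outside all the sides is left out: it is not needed and may have infinite measure.
  let α := {a : Finset ι // a.Nonempty}
  let B : α → Set S := fun a => (⋂ i ∈ a.1, A i) ∩ ⋂ i ∈ a.1ᶜ, (A i)ᶜ
  have hBmem : ∀ a x, x ∈ B a ↔ ∀ i, (x ∈ A i ↔ i ∈ a.1) := by
    intro a x
    simp only [B, mem_inter_iff, mem_iInter, Finset.mem_compl, mem_compl_iff]
    constructor
    · rintro ⟨h1, h2⟩ i
      exact ⟨fun hx => by_contra fun hi => h2 i hi hx, h1 i⟩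
    · intro h1
      exact ⟨fun i hi => (h1 i).2 hi, fun i hi hx => hi ((h1 i).1 hx)⟩
  have hBm : ∀ a, MeasurableSet (B a) := fun a =>
    (Finset.measurableSet_biInter _ fun i _ => hA i).inter
      (Finset.measurableSet_biInter _ fun i _ => (hA i).compl)
  have hBA : ∀ a : α, ∀ i ∈ a.1, B a ⊆ A i := fun a i hi x hx => ((hBmem a x).1 hx i).2 hi
  have hBfin : ∀ a, μ (B a) ≠ ∞ := fun a => by
    obtain ⟨i, hi⟩ := a.2
    exact ne_top_of_le_ne_top (hfin i) (measure_mono (hBA a i hi))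
  have hBd : Pairwise fun a b => Disjoint (B a) (B b) := fun a b hab =>
    Set.disjoint_left.2 fun x hx hy => hab <| Subtype.ext <| Finset.ext fun i =>
      ((hBmem a x).1 hx i).symm.trans ((hBmem b x).1 hy i)
  have hAB : ∀ i, A i = ⋃ a ∈ Finset.univ.filter (fun a : α => i ∈ a.1), B a := by
    intro i
    ext x
    simp only [mem_iUnion, Finset.mem_filter, Finset.mem_univ, true_and, exists_prop]
    constructor
    · intro hx
      exact ⟨⟨Finset.univ.filter fun j => x ∈ A j, ⟨i, by simpa using hx⟩⟩, by simpa using hx,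
        (hBmem _ _).2 fun j => by simp⟩
    · rintro ⟨a, ha, hx⟩
      exact hBA a i ha hx
  have hmuA : ∀ i, μ (A i) = ∑ a ∈ Finset.univ.filter (fun a : α => i ∈ a.1), μ (B a) := fun i => by
    conv_lhs => rw [hAB i]
    exact measure_biUnion_finset (fun a _ b _ hab => hBd hab) fun a _ => hBm a
  have hbox : univ.pi A = ⋃ c ∈ Fintype.piFinset
      (fun i => Finset.univ.filter (fun a : α => i ∈ a.1)), univ.pi fun i => B (c i) := by
    ext x
    simp only [Set.mem_pi, mem_univ, true_imp_iff, mem_iUnion, Fintype.mem_piFinset, exists_prop]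
    constructor
    · intro hx
      have : ∀ i, ∃ a ∈ Finset.univ.filter (fun a : α => i ∈ a.1), x i ∈ B a := fun i => by
        have := hx i
        rw [hAB i] at this
        simpa using this
      choose c hc hxc using this
      exact ⟨c, hc, hxc⟩
    · rintro ⟨c, hc, hx⟩ i
      exact hBA (c i) i (by simpa using hc i) (hx i)
  rw [hbox, measure_biUnion_finset]
  · simp_rw [tupleMeasure_pi_of_disjoint h t hBm hBfin hBd, hmuA, Finset.mul_sum,
      Finset.prod_univ_sum]
  · intro c _ d _ hcd
    obtain ⟨i, hi⟩ := Function.ne_iff.1 hcd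
    exact Set.disjoint_left.2 fun x hx hy =>
      Set.disjoint_left.1 (hBd hi) (hx i (mem_univ i)) (hy i (mem_univ i))
  · exact fun c _ => MeasurableSet.univ_pi fun i => hBm _

lemma generateFrom_finite_measure (μ : Measure S) [SigmaFinite μ] :
    MeasurableSpace.generateFrom {A : Set S | MeasurableSet A ∧ μ A ≠ ∞} = ‹MeasurableSpace S› := by
  refine le_antisymm (MeasurableSpace.generateFrom_le fun A hA => hA.1) fun A hA => ?_
  have : A = ⋃ n, A ∩ spanningSets μ n := by
    rw [← inter_iUnion, iUnion_spanningSets, inter_univ]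
  rw [this]
  refine MeasurableSet.iUnion fun n => MeasurableSpace.measurableSet_generateFrom ⟨?_, ?_⟩
  · exact hA.inter (measurableSet_spanningSets μ n)
  · exact ne_top_of_le_ne_top (measure_spanningSets_lt_top μ n).ne (measure_mono inter_subset_right)

/-- Boxes with sides of finite measure determine the product measure. The power of `t` is first
distributed over the coordinates, so that the right side becomes a product measure itself. -/
lemma tupleMeasure_eq
    (h : IsPoissonPoints P (lebesgue.prod μ) fun i ω => (T i ω, X i ω)) {t : ℝ≥0} :
    tupleMeasure ι P T X t = (t : ℝ≥0∞) ^ Fintype.card ι • Measure.pi fun _ : ι => μ := by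
  have h0 : (t : ℝ≥0∞) ^ Fintype.card ι • Measure.pi (fun _ : ι => μ) =
      Measure.pi fun _ : ι => t • μ := by
    symm
    refine Measure.pi_eq fun s hs => ?_
    simp only [Measure.smul_apply, Measure.pi_pi, smul_eq_mul, ENNReal.smul_def,
      Finset.prod_mul_distrib, Finset.prod_const, Finset.card_univ]
  rw [h0]
  symm
  refine Measure.pi_eq_generateFrom (C := fun _ => {A : Set S | MeasurableSet A ∧ μ A ≠ ∞})
    (fun _ => generateFrom_finite_measure μ) (fun _ => ?_) (fun _ => ?_) fun s hs => ?_
  · rintro A hA B hB -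
    exact ⟨hA.1.inter hB.1, ne_top_of_le_ne_top hA.2 (measure_mono inter_subset_left)⟩
  · exact
      { set := spanningSets μ
        set_mem := fun n => ⟨measurableSet_spanningSets μ n, (measure_spanningSets_lt_top μ n).ne⟩
        finite := fun n => by
          rw [Measure.smul_apply, ENNReal.smul_def, smul_eq_mul]
          exact ENNReal.mul_lt_top ENNReal.coe_lt_top (measure_spanningSets_lt_top μ n)
        spanning := iUnion_spanningSets μ }
  · rw [tupleMeasure_pi h t (fun i => (hs i).1) fun i => (hs i).2]
    simp_rw [Measure.smul_apply, ENNReal.smul_def, smul_eq_mul]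

/-- The multivariate Campbell formula: the expected sum of a function over all tuples of distinct
points born up to time `t`. -/
lemma campbell (h : IsPoissonPoints P (lebesgue.prod μ) fun i ω => (T i ω, X i ω)) (t : ℝ≥0)
    {g : (ι → S) → ℝ≥0∞} (hg : Measurable g) :
    ∑' θ : ι ↪ ℕ, ∫⁻ ω in bornBy T t θ, g (fun i => X (θ i) ω) ∂P =
      t ^ Fintype.card ι * ∫⁻ x, g x ∂(Measure.pi fun _ => μ) := by
  have := congrArg (fun M => ∫⁻ x, g x ∂M) (tupleMeasure_eq (ι := ι) h (t := t))
  simp only [lintegral_smul_measure, tupleMeasure, lintegral_sum_measure] at this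
  rw [smul_eq_mul] at this
  rw [← this]
  refine tsum_congr fun θ => ?_
  rw [lintegral_map hg (measurable_pi_lambda _ fun i => (h.measurable _).snd)]

end Campbell

/-! ### Expected number of copies of a graph -/

section Edges

variable {Ω : Type*} [MeasurableSpace Ω] {S : Type*} [MeasurableSpace S] {P : Measure Ω}
  {μ : Measure S} {W : S → S → ℝ} {T : ℕ → Ω → ℝ≥0} {X : ℕ → Ω → S} {E : Ω → SimpleGraph ℕ}
  {ι : Type*}

/-- A set of ordered pairs which contains no loops and lists each unordered pair at most once. -/
def Oriented (Q : Finset (ι × ι)) : Prop := ∀ p ∈ Q, p.1 ≠ p.2 ∧ p.swap ∉ Q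

/-- The event that all the pairs in `Q` are mapped to edges by `θ`. -/
def adjEvent (E : Ω → SimpleGraph ℕ) (Q : Finset (ι × ι)) (θ : ι → ℕ) : Set Ω :=
  {ω | ∀ p ∈ Q, (E ω).Adj (θ p.1) (θ p.2)}

/-- The product of the values of `W` over the pairs in `Q`. -/
def edgeWeight (W : S → S → ℝ) (Q : Finset (ι × ι)) (x : ι → S) : ℝ≥0∞ :=
  ∏ p ∈ Q, ENNReal.ofReal (W (x p.1) (x p.2))

lemma measurable_edgeWeight (hW : Measurable (Function.uncurry W)) (Q : Finset (ι × ι)) :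
    Measurable (edgeWeight W Q) := by
  unfold edgeWeight
  refine Finset.measurable_prod _ fun p _ => ENNReal.measurable_ofReal.comp ?_
  exact hW.comp (f := fun x : ι → S => (x p.1, x p.2))
    ((measurable_pi_apply p.1).prodMk (measurable_pi_apply p.2))

lemma edgeWeight_le_one (hW : ∀ x y, W x y ≤ 1) (Q : Finset (ι × ι)) (x : ι → S) :
    edgeWeight W Q x ≤ 1 :=
  Finset.prod_le_one' fun _ _ => ENNReal.ofReal_le_one.2 (hW _ _)

lemma measurableSet_adjEvent (hE : ∀ i j, MeasurableSet {ω | (E ω).Adj i j}) (Q : Finset (ι × ι))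
    (θ : ι → ℕ) : MeasurableSet (adjEvent E Q θ) := by
  have : adjEvent E Q θ = ⋂ p ∈ Q, {ω | (E ω).Adj (θ p.1) (θ p.2)} := by ext; simp [adjEvent]
  rw [this]
  exact Finset.measurableSet_biInter _ fun p _ => hE _ _

lemma IsGraphonSampling.measurable_T (h : IsGraphonSampling μ W P T X E) (i : ℕ) :
    Measurable (T i) := (h.poisson.measurable i).fst

lemma IsGraphonSampling.measurable_X (h : IsGraphonSampling μ W P T X E) (i : ℕ) :
    Measurable (X i) := (h.poisson.measurable i).snd

/-- The sampling law lists pairs with increasing labels, while `θ` may reverse the order of a pair.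
Sorting each pair by `σ` is injective on `Q` because `Q` never contains a pair together with its
swap, and symmetry of `W` leaves the weights unchanged. -/
lemma IsGraphonSampling.measure_inter_adjEvent (h : IsGraphonSampling μ W P T X E)
    (hsymm : ∀ x y, W x y = W y x) {Q : Finset (ι × ι)} (hQ : Oriented Q) (θ : ι ↪ ℕ) {A : Set Ω}
    (hA : MeasurableSet[MeasurableSpace.comap (fun ω i => (T i ω, X i ω))
      (inferInstance : MeasurableSpace (ℕ → ℝ≥0 × S))] A) :
    P (A ∩ adjEvent E Q θ) = ∫⁻ ω in A, edgeWeight W Q (fun i => X (θ i) ω) ∂P := by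
  classical
  let σ : ι × ι → ℕ × ℕ := fun p => (min (θ p.1) (θ p.2), max (θ p.1) (θ p.2))
  have hσ : ∀ p : ι × ι, σ p = (θ p.1, θ p.2) ∨ σ p = (θ p.2, θ p.1) := by
    intro p
    rcases le_total (θ p.1) (θ p.2) with hp | hp
    · left; simp [σ, hp]
    · right; simp [σ, hp]
  have hinj : Set.InjOn σ Q := by
    rintro ⟨a, b⟩ hp ⟨c, d⟩ hq heq
    have hne := (hQ _ hp).2
    rcases hσ (a, b) with h1 | h1 <;> rcases hσ (c, d) with h2 | h2 <;>
      rw [h1, h2] at heq <;> simp only [Prod.mk.injEq, EmbeddingLike.apply_eq_iff_eq] at heq <;>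
      obtain ⟨rfl, rfl⟩ := heq
    · rfl
    · exact absurd hq hne
    · exact absurd hq hne
    · rfl
  have h1 := h.edges (Q.image σ) (by
    intro p hp
    obtain ⟨q, hq, rfl⟩ := Finset.mem_image.1 hp
    exact min_lt_max.2 (θ.injective.ne (hQ q hq).1)) A hA
  have h2 : {ω | ∀ p ∈ Q.image σ, (E ω).Adj p.1 p.2} = adjEvent E Q θ := by
    ext ω
    simp only [Finset.forall_mem_image, adjEvent, mem_ofPred_eq]
    refine forall₂_congr fun p _ => ?_
    rcases hσ p with hp | hp <;> rw [hp]
    exact SimpleGraph.adj_comm _ _ _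
  rw [h2] at h1
  rw [h1]
  refine lintegral_congr fun ω => ?_
  rw [Finset.prod_image hinj, edgeWeight]
  refine Finset.prod_congr rfl fun p _ => ?_
  rcases hσ p with hp | hp <;> rw [hp]
  rw [hsymm]

variable [Fintype ι]

/-- Birth times and positions are functions of the points, so requiring the edges multiplies the law
of the positions by the density `edgeWeight`. This is checked on measurable sets and then integrated
against `g`. -/
lemma IsGraphonSampling.setLIntegral_adjEvent (h : IsGraphonSampling μ W P T X E)
    (hsymm : ∀ x y, W x y = W y x) (hW : Measurable (Function.uncurry W)) {Q : Finset (ι × ι)}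
    (hQ : Oriented Q) (t : ℝ≥0) (θ : ι ↪ ℕ) {g : (ι → S) → ℝ≥0∞} (hg : Measurable g) :
    ∫⁻ ω in bornBy T t θ ∩ adjEvent E Q θ, g (fun i => X (θ i) ω) ∂P =
      ∫⁻ ω in bornBy T t θ, edgeWeight W Q (fun i => X (θ i) ω) * g (fun i => X (θ i) ω) ∂P := by
  have hXθ : Measurable fun ω i => X (θ i) ω := measurable_pi_lambda _ fun i => h.measurable_X _
  have hborn := measurableSet_bornBy h.measurable_T t θ
  have hw := measurable_edgeWeight hW Q
  have key : (P.restrict (bornBy T t θ ∩ adjEvent E Q θ)).map (fun ω i => X (θ i) ω) =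
      ((P.restrict (bornBy T t θ)).map (fun ω i => X (θ i) ω)).withDensity (edgeWeight W Q) := by
    ext Γ hΓ
    rw [Measure.map_apply hXθ hΓ, withDensity_apply _ hΓ, Measure.restrict_apply (hXθ hΓ),
      Measure.restrict_map hXθ hΓ, lintegral_map hw hXθ, Measure.restrict_restrict (hXθ hΓ),
      ← inter_assoc]
    refine h.measure_inter_adjEvent hsymm hQ θ ⟨(fun y i => (y (θ i)).2) ⁻¹' Γ ∩
      ⋂ i, (fun y => (y (θ i)).1) ⁻¹' Iic t, ?_, ?_⟩
    · refine MeasurableSet.inter ?_ ?_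
      swap
      · exact MeasurableSet.iInter fun i =>
          (measurable_fst.comp (measurable_pi_apply (θ i))) measurableSet_Iic
      · exact (measurable_pi_lambda (fun (y : ℕ → ℝ≥0 × S) i => (y (θ i)).2)
          fun i => measurable_snd.comp (measurable_pi_apply (θ i))) hΓ
    · ext ω
      simp [bornBy]
  have := congrArg (fun M => ∫⁻ x, g x ∂M) key
  rw [lintegral_map hg hXθ, lintegral_withDensity_eq_lintegral_mul _ hw hg,
    lintegral_map (hw.mul hg) hXθ] at this
  exact this

/-- The expected sum of a function over all tuples of distinct points born up to time `t` with
prescribed edges between them. -/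
lemma IsGraphonSampling.campbell_edges [SigmaFinite μ] (h : IsGraphonSampling μ W P T X E)
    (hsymm : ∀ x y, W x y = W y x) (hW : Measurable (Function.uncurry W)) {Q : Finset (ι × ι)}
    (hQ : Oriented Q) (t : ℝ≥0) {g : (ι → S) → ℝ≥0∞} (hg : Measurable g) :
    ∑' θ : ι ↪ ℕ, ∫⁻ ω in bornBy T t θ ∩ adjEvent E Q θ, g (fun i => X (θ i) ω) ∂P =
      t ^ Fintype.card ι * ∫⁻ x, edgeWeight W Q x * g x ∂(Measure.pi fun _ => μ) := by
  rw [← campbell h.poisson t (g := fun x => edgeWeight W Q x * g x)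
    ((measurable_edgeWeight hW Q).mul hg)]
  exact tsum_congr fun θ => h.setLIntegral_adjEvent hsymm hW hQ t θ hg

/-- The expected number of tuples of distinct points born up to time `t` with prescribed edges
between them and prescribed positions. -/
lemma IsGraphonSampling.tsum_measure [SigmaFinite μ] (h : IsGraphonSampling μ W P T X E)
    (hsymm : ∀ x y, W x y = W y x) (hW : Measurable (Function.uncurry W)) {Q : Finset (ι × ι)}
    (hQ : Oriented Q) (t : ℝ≥0) {Γ : Set (ι → S)} (hΓ : MeasurableSet Γ) :
    ∑' θ : ι ↪ ℕ, P (bornBy T t θ ∩ adjEvent E Q θ ∩ {ω | (fun i => X (θ i) ω) ∈ Γ}) =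
      t ^ Fintype.card ι * ∫⁻ x in Γ, edgeWeight W Q x ∂(Measure.pi fun _ => μ) := by
  have := h.campbell_edges hsymm hW hQ t (g := Γ.indicator fun _ => 1)
    (measurable_const.indicator hΓ)
  rw [← lintegral_indicator hΓ]
  convert this using 1
  · refine tsum_congr fun θ => ?_
    have hXθ : Measurable fun ω i => X (θ i) ω := measurable_pi_lambda _ fun i => h.measurable_X _
    have h1 : (fun ω => Γ.indicator (fun _ => (1 : ℝ≥0∞)) (fun i => X (θ i) ω)) =
        ((fun ω i => X (θ i) ω) ⁻¹' Γ).indicator fun _ => 1 := rfl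
    rw [h1, lintegral_indicator (hXθ hΓ), setLIntegral_one, Measure.restrict_apply (hXθ hΓ),
      inter_comm]
    rfl
  · congr 2
    ext x
    by_cases hx : x ∈ Γ <;> simp [hx]

end Edges

/-! ### Almost sure convergence from second moments -/

/-- With truncated subtraction one of the two squares vanishes and the other is the squared distance
of `y` and `c`. This is the binomial formula written without negative terms. -/
lemma sq_add_sq_eq_sub {y c : ℝ≥0∞} (hy : y ≠ ∞) (hc : c ≠ ∞) :
    (y - c) ^ 2 + (c - y) ^ 2 + 2 * c * y = y ^ 2 + c ^ 2 := by
  rcases le_total y c with h | h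
  · obtain ⟨d, rfl⟩ := exists_add_of_le h
    rw [tsub_eq_zero_of_le h, ENNReal.add_sub_cancel_left hy]
    ring
  · obtain ⟨d, rfl⟩ := exists_add_of_le h
    rw [tsub_eq_zero_of_le h, ENNReal.add_sub_cancel_left hc]
    ring

lemma tendsto_zero_of_tsum_sq_ne_top {D : ℕ → ℝ≥0∞} (h : ∑' j, D j ^ 2 ≠ ∞) :
    Tendsto D atTop (𝓝 0) := by
  have h1 := ENNReal.tendsto_atTop_zero_of_tsum_ne_top h
  rw [ENNReal.tendsto_nhds_zero] at h1 ⊢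
  intro ε hε
  filter_upwards [h1 (ε ^ 2) (ENNReal.pow_pos hε 2)] with j hj
  exact (ENNReal.pow_le_pow_left_iff two_ne_zero).1 hj

/-- The integral of the squared distance of `Y j` from its mean `c j` is at most `v j`. Hence the
sum of these squared distances over `j` has finite expectation, is finite almost surely, and its
terms tend to zero. -/
lemma ae_tendsto_of_second_moment {Ω : Type*} [MeasurableSpace Ω] {P : Measure Ω}
    [IsProbabilityMeasure P] {Y : ℕ → Ω → ℝ≥0∞} (hY : ∀ j, Measurable (Y j)) {c v : ℕ → ℝ≥0∞}
    {I : ℝ≥0∞} (hI : I ≠ ∞) (hc : Tendsto c atTop (𝓝 I)) (hcfin : ∀ j, c j ≠ ∞)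
    (h1 : ∀ j, ∫⁻ ω, Y j ω ∂P = c j) (h2 : ∀ j, ∫⁻ ω, Y j ω ^ 2 ∂P ≤ c j ^ 2 + v j)
    (hv : ∑' j, v j ≠ ∞) : ∀ᵐ ω ∂P, Tendsto (fun j => Y j ω) atTop (𝓝 I) := by
  have hfin : ∀ᵐ ω ∂P, ∀ j, Y j ω < ∞ :=
    ae_all_iff.2 fun j => ae_lt_top (hY j) (by rw [h1 j]; exact hcfin j)
  have hD : ∀ j, ∫⁻ ω, ((Y j ω - c j) ^ 2 + (c j - Y j ω) ^ 2) ∂P ≤ v j := by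
    intro j
    have h3 : ∫⁻ ω, ((Y j ω - c j) ^ 2 + (c j - Y j ω) ^ 2) ∂P + 2 * c j ^ 2 =
        ∫⁻ ω, Y j ω ^ 2 ∂P + c j ^ 2 := by
      calc _ = ∫⁻ ω, ((Y j ω - c j) ^ 2 + (c j - Y j ω) ^ 2) ∂P + ∫⁻ ω, 2 * c j * Y j ω ∂P := by
            rw [lintegral_const_mul _ (hY j), h1 j]; ring
        _ = ∫⁻ ω, ((Y j ω - c j) ^ 2 + (c j - Y j ω) ^ 2 + 2 * c j * Y j ω) ∂P := by
            rw [← lintegral_add_right _ ((hY j).const_mul _)]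
        _ = ∫⁻ ω, (Y j ω ^ 2 + c j ^ 2) ∂P := by
            refine lintegral_congr_ae ?_
            filter_upwards [hfin] with ω hω
            exact sq_add_sq_eq_sub (hω j).ne (hcfin j)
        _ = _ := by rw [lintegral_add_right _ measurable_const]; simp
    have h4 : ∫⁻ ω, ((Y j ω - c j) ^ 2 + (c j - Y j ω) ^ 2) ∂P + 2 * c j ^ 2 ≤
        v j + 2 * c j ^ 2 := by
      rw [h3]
      calc _ ≤ c j ^ 2 + v j + c j ^ 2 := by gcongr; exact h2 j
        _ = _ := by ring
    exact (ENNReal.add_le_add_iff_right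
      (ENNReal.mul_ne_top (by simp) (ENNReal.pow_ne_top (hcfin j)))).1 h4
  have hsum : ∀ᵐ ω ∂P, ∑' j, ((Y j ω - c j) ^ 2 + (c j - Y j ω) ^ 2) < ∞ := by
    refine ae_lt_top ?_ ?_
    · exact Measurable.tsum fun j => (((hY j).sub_const _).pow_const 2).add
        (((hY j).const_sub _).pow_const 2)
    · rw [lintegral_tsum (f := fun j ω => (Y j ω - c j) ^ 2 + (c j - Y j ω) ^ 2)
        fun j => ((((hY j).sub_const _).pow_const 2).add
        (((hY j).const_sub _).pow_const 2)).aemeasurable]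
      exact ne_top_of_le_ne_top hv (ENNReal.tsum_le_tsum hD)
  filter_upwards [hsum] with ω hω
  have hA : Tendsto (fun j => Y j ω - c j) atTop (𝓝 0) := tendsto_zero_of_tsum_sq_ne_top
    (ne_top_of_le_ne_top hω.ne (ENNReal.tsum_le_tsum fun j => le_self_add))
  have hB : Tendsto (fun j => c j - Y j ω) atTop (𝓝 0) := tendsto_zero_of_tsum_sq_ne_top
    (ne_top_of_le_ne_top hω.ne (ENNReal.tsum_le_tsum fun j => le_add_self))
  have hlow := ENNReal.Tendsto.sub hc hB (Or.inl hI)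
  have hup := hc.add hA
  rw [tsub_zero] at hlow
  rw [add_zero] at hup
  refine tendsto_of_tendsto_of_tendsto_of_le_of_le hlow hup (fun j => ?_) fun j => ?_
  · exact tsub_le_iff_left.2 (by rw [add_comm, add_comm]; exact le_tsub_add)
  · exact le_add_tsub

/-! ### Truncated geometric sums -/

section Geometric

variable {q : ℝ≥0∞}

lemma inv_one_sub_inv_ne_top (hq : 1 < q) : (1 - q⁻¹)⁻¹ ≠ ∞ := by
  refine ENNReal.inv_ne_top.2 (tsub_pos_of_lt ?_).ne'
  exact ENNReal.inv_lt_one.2 hq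

/-- From the first index `j₀` with `g ≤ q ^ j₀` on, the terms are dominated by the geometric series
started afresh at `j₀`. The bound does not depend on `g`. -/
lemma tsum_mul_inv_pow_le (hq : 1 < q) (hq' : q ≠ ∞) (g : ℝ≥0∞) :
    ∑' j : ℕ, (if g ≤ q ^ j then q⁻¹ ^ j * g else 0) ≤ (1 - q⁻¹)⁻¹ := by
  have hq0 : q ≠ 0 := (zero_lt_one.trans hq).ne'
  by_cases h : ∃ j : ℕ, g ≤ q ^ j
  · classical
    set j₀ := Nat.find h
    have hj₀ : g ≤ q ^ j₀ := Nat.find_spec h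
    rw [← ENNReal.tsum_geometric, ← ENNReal.summable.sum_add_tsum_nat_add' (k := j₀),
      Finset.sum_eq_zero, zero_add]
    · refine ENNReal.tsum_le_tsum fun i => ?_
      split_ifs
      · calc q⁻¹ ^ (i + j₀) * g ≤ q⁻¹ ^ (i + j₀) * q ^ j₀ := by gcongr
          _ = q⁻¹ ^ i := by
            rw [pow_add, mul_assoc, ← mul_pow, ENNReal.inv_mul_cancel hq0 hq', one_pow, mul_one]
      · exact zero_le
    · intro i hi
      exact if_neg (Nat.find_min h (Finset.mem_range.1 hi))
  · push Not at h
    simp [fun j => not_le.2 (h j)]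

/-- Only finitely many powers lie below `g`. Read from the largest one downwards they decrease
geometrically, and the largest is less than `g`. -/
lemma tsum_pow_le (hq : 1 < q) (hq' : q ≠ ∞) (g : ℝ≥0∞) :
    ∑' j : ℕ, (if q ^ j < g then q ^ j else 0) ≤ (1 - q⁻¹)⁻¹ * g := by
  have hq0 : q ≠ 0 := (zero_lt_one.trans hq).ne'
  rcases eq_or_ne g ∞ with rfl | hg
  · rw [ENNReal.mul_top]
    · exact le_top
    · exact ENNReal.inv_ne_zero.2 (ne_top_of_le_ne_top ENNReal.one_ne_top tsub_le_self)
  have h : ∃ j : ℕ, g ≤ q ^ j := by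
    lift q to ℝ≥0 using hq'
    lift g to ℝ≥0 using hg
    obtain ⟨n, hn⟩ := pow_unbounded_of_one_lt g (by exact_mod_cast hq : 1 < q)
    exact ⟨n, by exact_mod_cast hn.le⟩
  classical
  set n := Nat.find h
  have hn : g ≤ q ^ n := Nat.find_spec h
  have hlt : ∀ j < n, q ^ j < g := fun j hj => not_le.1 (Nat.find_min h hj)
  rw [tsum_eq_sum (s := Finset.range n)]
  · rw [← Finset.sum_range_reflect, ← ENNReal.tsum_geometric, mul_comm, ← ENNReal.tsum_mul_left]
    refine le_trans (Finset.sum_le_sum fun i hi => ?_)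
      (ENNReal.sum_le_tsum (f := fun i => g * q⁻¹ ^ i) (Finset.range n))
    have hi := Finset.mem_range.1 hi
    rw [if_pos (hlt _ (by omega))]
    calc q ^ (n - 1 - i) = q ^ (n - 1) * q⁻¹ ^ i := by
          conv_rhs => rw [show n - 1 = (n - 1 - i) + i by omega, pow_add]
          rw [mul_assoc, ← mul_pow, ENNReal.mul_inv_cancel hq0 hq', one_pow, mul_one]
      _ ≤ g * q⁻¹ ^ i := by gcongr; exact (hlt _ (by omega)).le
  · intro j hj
    refine if_neg (not_lt.2 (hn.trans (pow_le_pow_right₀ hq.le ?_)))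
    simpa using hj

end Geometric

/-! ### Interpolation of monotone functions -/

section Interpolation

variable {N : ℝ≥0 → ℝ≥0∞} {k : ℕ} {I : ℝ≥0∞}

lemma tendsto_one_add_inv_pow (k : ℕ) :
    Tendsto (fun n : ℕ => ((1 + 1 / ((n : ℝ≥0) + 1) : ℝ≥0) : ℝ≥0∞) ^ k) atTop (𝓝 1) := by
  have h : Tendsto (fun n : ℕ => (1 + 1 / ((n : ℝ≥0) + 1) : ℝ≥0)) atTop (𝓝 (1 + 0)) :=
    tendsto_const_nhds.add (tendsto_one_div_add_atTop_nhds_zero_nat (𝕜 := ℝ≥0))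
  rw [add_zero] at h
  have := (ENNReal.tendsto_coe.2 h)
  simpa using ENNReal.Tendsto.pow (n := k) this

/-- Between `ρ ^ j` and `ρ ^ (j + 1)` monotonicity costs at most a factor `ρ ^ k` on either side.
The hypothesis is available for `ρ = 1 + 1 / (n + 1)` with any `n`, and the cost tends to `1`. -/
lemma tendsto_div_pow_of_geometric (hN : Monotone N)
    (h : ∀ n : ℕ, Tendsto (fun j : ℕ => N ((1 + 1 / ((n : ℝ≥0) + 1)) ^ j) /
      (((1 + 1 / ((n : ℝ≥0) + 1)) ^ j : ℝ≥0) : ℝ≥0∞) ^ k) atTop (𝓝 I)) :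
    Tendsto (fun t : ℝ≥0 => N t / (t : ℝ≥0∞) ^ k) atTop (𝓝 I) := by
  have near : ∀ ρ : ℝ≥0, 1 < ρ → ∀ j₀ : ℕ, ∀ᶠ t : ℝ≥0 in atTop,
      ∃ j ≥ j₀, ρ ^ j ≤ t ∧ t ≤ ρ ^ (j + 1) := by
    intro ρ hρ j₀
    filter_upwards [eventually_ge_atTop (ρ ^ j₀)] with t ht
    obtain ⟨j, hj, hj'⟩ := exists_nat_pow_near ((one_le_pow₀ hρ.le).trans ht) hρ
    refine ⟨j, ?_, hj, hj'.le⟩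
    by_contra hlt
    push Not at hlt
    exact absurd (ht.trans_lt hj') (not_lt.2 (pow_le_pow_right₀ hρ.le hlt))
  have hρ1 : ∀ n : ℕ, (1 : ℝ≥0) < 1 + 1 / ((n : ℝ≥0) + 1) := fun n => by
    have : (0 : ℝ≥0) < 1 / ((n : ℝ≥0) + 1) := by positivity
    exact lt_add_of_pos_right _ this
  have step : ∀ (ρ : ℝ≥0), 1 < ρ → ∀ j : ℕ, ∀ t : ℝ≥0, ρ ^ j ≤ t → t ≤ ρ ^ (j + 1) →
      N (ρ ^ j) / ((ρ ^ j : ℝ≥0) : ℝ≥0∞) ^ k ≤ (ρ : ℝ≥0∞) ^ k * (N t / (t : ℝ≥0∞) ^ k) ∧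
      N t / (t : ℝ≥0∞) ^ k ≤
        (ρ : ℝ≥0∞) ^ k * (N (ρ ^ (j + 1)) / ((ρ ^ (j + 1) : ℝ≥0) : ℝ≥0∞) ^ k) := by
    intro ρ hρ j t h1 h2
    have hρ0 : (ρ : ℝ≥0∞) ≠ 0 := by exact_mod_cast (zero_lt_one.trans hρ).ne'
    have key : ∀ a b : ℝ≥0, 0 < b → b ≤ ρ * a → ∀ x y : ℝ≥0∞, x ≤ y →
        x / (a : ℝ≥0∞) ^ k ≤ (ρ : ℝ≥0∞) ^ k * (y / (b : ℝ≥0∞) ^ k) := by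
      intro a b hb hab x y hxy
      have hb0 : (b : ℝ≥0∞) ≠ 0 := by exact_mod_cast hb.ne'
      have ha : 0 < a := by
        rcases (zero_le (a := a)).eq_or_lt with h0 | h0
        · rw [← h0, mul_zero] at hab
          exact absurd hb (not_lt.2 hab)
        · exact h0
      have ha0 : (a : ℝ≥0∞) ≠ 0 := by exact_mod_cast ha.ne'
      rw [ENNReal.div_le_iff (pow_ne_zero _ ha0) (ENNReal.pow_ne_top ENNReal.coe_ne_top)]
      calc x ≤ y := hxy
        _ = y / (b : ℝ≥0∞) ^ k * (b : ℝ≥0∞) ^ k := by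
          rw [ENNReal.div_mul_cancel (pow_ne_zero _ hb0) (ENNReal.pow_ne_top ENNReal.coe_ne_top)]
        _ ≤ y / (b : ℝ≥0∞) ^ k * ((ρ : ℝ≥0∞) * a) ^ k := by
          gcongr
          exact_mod_cast hab
        _ = _ := by rw [mul_pow]; ring
    have hpos : ∀ i : ℕ, 0 < ρ ^ i := fun i => pow_pos (zero_lt_one.trans hρ) i
    constructor
    · exact key _ _ ((hpos j).trans_le h1) (by rwa [← pow_succ']) _ _ (hN h1)
    · refine key _ _ (hpos _) ?_ _ _ (hN h2)
      rw [pow_succ']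
      gcongr
  rw [tendsto_order]
  constructor
  · intro a ha
    have h1 : Tendsto (fun n : ℕ => ((1 + 1 / ((n : ℝ≥0) + 1) : ℝ≥0) : ℝ≥0∞) ^ k * a) atTop
        (𝓝 (1 * a)) := ENNReal.Tendsto.mul_const (tendsto_one_add_inv_pow k) (Or.inl one_ne_zero)
    rw [one_mul] at h1
    obtain ⟨n, hn⟩ := (h1.eventually (gt_mem_nhds ha)).exists
    obtain ⟨j₀, hj₀⟩ := eventually_atTop.1 ((h n).eventually (lt_mem_nhds hn))
    filter_upwards [near _ (hρ1 n) j₀] with t ⟨j, hj, h2, h3⟩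
    have h4 := (hj₀ j hj).trans_le (step _ (hρ1 n) j t h2 h3).1
    exact lt_of_mul_lt_mul_left' h4
  · intro b hb
    have h1 : Tendsto (fun n : ℕ => ((1 + 1 / ((n : ℝ≥0) + 1) : ℝ≥0) : ℝ≥0∞) ^ k * I) atTop
        (𝓝 (1 * I)) := ENNReal.Tendsto.mul_const (tendsto_one_add_inv_pow k) (Or.inl one_ne_zero)
    rw [one_mul] at h1
    obtain ⟨n, hn⟩ := (h1.eventually (gt_mem_nhds hb)).exists
    have h2 := ENNReal.Tendsto.const_mul
      (a := ((1 + 1 / ((n : ℝ≥0) + 1) : ℝ≥0) : ℝ≥0∞) ^ k) (h n)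
      (Or.inr (ENNReal.pow_ne_top ENNReal.coe_ne_top))
    obtain ⟨j₀, hj₀⟩ := eventually_atTop.1 (h2.eventually (gt_mem_nhds hn))
    filter_upwards [near _ (hρ1 n) j₀] with t ⟨j, hj, h3, h4⟩
    exact (step _ (hρ1 n) j t h3 h4).2.trans_lt (hj₀ (j + 1) (by omega))

/-- Here `N t` is squeezed between the values at `⌊t⌋` and `⌊t⌋ + 1`, whose ratio of normalizations
`((n + 1) / n) ^ k` tends to `1`. -/
lemma tendsto_div_pow_of_nat (hN : Monotone N)
    (h : Tendsto (fun n : ℕ => N n / (n : ℝ≥0∞) ^ k) atTop (𝓝 I)) :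
    Tendsto (fun t : ℝ≥0 => N t / (t : ℝ≥0∞) ^ k) atTop (𝓝 I) := by
  have hr : Tendsto (fun n : ℕ => (((n : ℝ≥0∞) + 1) / n) ^ k) atTop (𝓝 1) := by
    have h1 : Tendsto (fun n : ℕ => (1 + (n : ℝ≥0∞)⁻¹) ^ k) atTop (𝓝 ((1 + 0) ^ k)) :=
      ENNReal.Tendsto.pow (tendsto_const_nhds.add ENNReal.tendsto_inv_nat_nhds_zero)
    rw [add_zero, one_pow] at h1
    refine h1.congr' ?_
    filter_upwards [eventually_ge_atTop 1] with n hn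
    have hn0 : (n : ℝ≥0∞) ≠ 0 := by exact_mod_cast (by omega : n ≠ 0)
    rw [ENNReal.add_div, ENNReal.div_self hn0 (by simp), one_div]
  have hup : Tendsto (fun n : ℕ => N ((n + 1 : ℕ) : ℝ≥0) / ((n + 1 : ℕ) : ℝ≥0∞) ^ k *
      (((n : ℝ≥0∞) + 1) / n) ^ k) atTop (𝓝 I) := by
    have := ENNReal.Tendsto.mul (h.comp (tendsto_add_atTop_nat 1)) (Or.inr ENNReal.one_ne_top)
      hr (Or.inl one_ne_zero)
    rwa [mul_one] at this
  have hlow : Tendsto (fun n : ℕ => N n / (n : ℝ≥0∞) ^ k / (((n : ℝ≥0∞) + 1) / n) ^ k) atTop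
      (𝓝 I) := by
    have := ENNReal.Tendsto.div h (Or.inr one_ne_zero) hr (Or.inl ENNReal.one_ne_top)
    rwa [div_one] at this
  have hfl : Tendsto (fun t : ℝ≥0 => ⌊t⌋₊) atTop atTop := tendsto_nat_floor_atTop
  refine tendsto_of_tendsto_of_tendsto_of_le_of_le' (hlow.comp hfl) (hup.comp hfl) ?_ ?_
  · filter_upwards [eventually_ge_atTop 1] with t ht
    have hn : 1 ≤ ⌊t⌋₊ := (Nat.one_le_floor_iff _).2 ht
    set n := ⌊t⌋₊
    have hn0 : (n : ℝ≥0∞) ≠ 0 := by exact_mod_cast (by omega : n ≠ 0)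
    simp only [Function.comp_apply]
    have e1 : N n / (n : ℝ≥0∞) ^ k / (((n : ℝ≥0∞) + 1) / n) ^ k = N n / ((n : ℝ≥0∞) + 1) ^ k := by
      rw [div_eq_mul_inv (N n / _), div_eq_mul_inv (N n), div_eq_mul_inv (N n), mul_assoc,
        ← ENNReal.mul_inv, ← mul_pow, ENNReal.mul_div_cancel hn0 (by simp)]
      · left; exact pow_ne_zero _ hn0
      · left; exact ENNReal.pow_ne_top (by simp)
    rw [e1]
    gcongr
    · exact hN (Nat.floor_le zero_le)
    · have := (Nat.lt_floor_add_one t).le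
      have h3 : (t : ℝ≥0∞) ≤ ((⌊t⌋₊ + 1 : ℝ≥0) : ℝ≥0∞) := by exact_mod_cast this
      simpa using h3
  · filter_upwards [eventually_ge_atTop 1] with t ht
    have hn : 1 ≤ ⌊t⌋₊ := (Nat.one_le_floor_iff _).2 ht
    have hle : (⌊t⌋₊ : ℝ≥0) ≤ t := Nat.floor_le zero_le
    have hlt := (Nat.lt_floor_add_one t).le
    set n := ⌊t⌋₊
    have hn0 : (n : ℝ≥0∞) ≠ 0 := by exact_mod_cast (by omega : n ≠ 0)
    simp only [Function.comp_apply]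
    have e1 : N ((n + 1 : ℕ) : ℝ≥0) / ((n + 1 : ℕ) : ℝ≥0∞) ^ k * (((n : ℝ≥0∞) + 1) / n) ^ k =
        N ((n + 1 : ℕ) : ℝ≥0) / (n : ℝ≥0∞) ^ k := by
      have h5 : (((n : ℝ≥0∞) + 1) / n) ^ k = ((n : ℝ≥0∞) + 1) ^ k / (n : ℝ≥0∞) ^ k := by
        rw [div_eq_mul_inv, mul_pow, ← ENNReal.inv_pow, div_eq_mul_inv]
      rw [h5, ← mul_div_assoc]
      push_cast
      rw [ENNReal.div_mul_cancel (pow_ne_zero _ (by simp)) (ENNReal.pow_ne_top (by simp))]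
    rw [e1]
    gcongr
    · exact hN (by exact_mod_cast hlt)
    · have h3 : ((n : ℝ≥0) : ℝ≥0∞) ≤ t := by exact_mod_cast hle
      simpa using h3

end Interpolation

/-- The number of tuples of distinct points born up to time `t` such that the pairs in `Q` are
edges. -/
def copyCount {Ω κ : Type*} (T : ℕ → Ω → ℝ≥0) (E : Ω → SimpleGraph ℕ) (Q : Finset (κ × κ))
    (t : ℝ≥0) (ω : Ω) : ℝ≥0∞ :=
  ∑' φ : κ ↪ ℕ, (bornBy T t φ ∩ adjEvent E Q φ).indicator (fun _ => 1) ω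

/-! ### Splitting the vertices of a graph -/

section Split

variable {S : Type*} [MeasurableSpace S] {μ : Measure S} {W : S → S → ℝ}
  {κ : Type*} [Fintype κ] [DecidableEq κ]

/-- The tuple which agrees with `u` on `B` and with `z` off `B`. -/
def glue (B : Finset κ) {A : Type*} (u : {b // b ∈ B} → A) (z : {b // b ∉ B} → A) : κ → A :=
  fun b => if h : b ∈ B then u ⟨b, h⟩ else z ⟨b, h⟩

/-- The pairs in `Q` that lie inside `B`. -/
def innerPairs (Q : Finset (κ × κ)) (B : Finset κ) : Finset ({b // b ∈ B} × {b // b ∈ B}) :=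
  Finset.univ.filter fun p => (p.1.1, p.2.1) ∈ Q

/-- The pairs in `Q` that do not lie inside `B`. -/
def outerPairs (Q : Finset (κ × κ)) (B : Finset κ) : Finset (κ × κ) :=
  Q.filter fun p => ¬ (p.1 ∈ B ∧ p.2 ∈ B)

lemma Oriented.innerPairs {Q : Finset (κ × κ)} (hQ : Oriented Q) (B : Finset κ) :
    Oriented (innerPairs Q B) := by
  intro p hp
  simp only [GraphonLeft.innerPairs, Finset.mem_filter, Finset.mem_univ, true_and] at hp ⊢
  have := hQ _ hp
  exact ⟨fun h => this.1 (congrArg Subtype.val h), this.2⟩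

lemma glue_apply_mem (B : Finset κ) {A : Type*} (u : {b // b ∈ B} → A) (z : {b // b ∉ B} → A)
    (b : {b // b ∈ B}) : glue B u z b = u b := by
  simp [glue]

lemma edgeWeight_glue (Q : Finset (κ × κ)) (B : Finset κ) (u : {b // b ∈ B} → S)
    (z : {b // b ∉ B} → S) :
    edgeWeight W Q (glue B u z) =
      edgeWeight W (innerPairs Q B) u * edgeWeight W (outerPairs Q B) (glue B u z) := by
  rw [edgeWeight, ← Finset.prod_filter_mul_prod_filter_not Q (fun p => p.1 ∈ B ∧ p.2 ∈ B)]
  congr 1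
  symm
  refine Finset.prod_bij (fun p _ => (p.1.1, p.2.1)) ?_ ?_ ?_ ?_
  · intro p hp
    simp only [innerPairs, Finset.mem_filter, Finset.mem_univ, true_and] at hp
    exact Finset.mem_filter.2 ⟨hp, p.1.2, p.2.2⟩
  · intro p _ q _ h
    simp only [Prod.mk.injEq] at h
    exact Prod.ext (Subtype.ext h.1) (Subtype.ext h.2)
  · intro p hp
    obtain ⟨h1, h2, h3⟩ := Finset.mem_filter.1 hp
    exact ⟨(⟨p.1, h2⟩, ⟨p.2, h3⟩), by simpa [innerPairs] using h1, rfl⟩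
  · intro p _
    rw [glue_apply_mem, glue_apply_mem]

lemma measurable_glue (B : Finset κ) :
    Measurable fun p : ({b // b ∈ B} → S) × ({b // b ∉ B} → S) => glue B p.1 p.2 :=
  (MeasurableEquiv.piEquivPiSubtypeProd (fun _ : κ => S) (· ∈ B)).symm.measurable

lemma lintegral_glue [SigmaFinite μ] (B : Finset κ) {h : (κ → S) → ℝ≥0∞} (hh : Measurable h) :
    ∫⁻ x, h x ∂(Measure.pi fun _ => μ) =
      ∫⁻ u, ∫⁻ z, h (glue B u z) ∂(Measure.pi fun _ => μ) ∂(Measure.pi fun _ => μ) := by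
  have hmp := (measurePreserving_piEquivPiSubtypeProd (fun _ : κ => μ) (· ∈ B)).symm
  rw [← hmp.lintegral_comp hh, lintegral_prod]
  · rw [show Finset.Subtype.fintype B = Subtype.fintype (fun x => x ∈ B) from Subsingleton.elim _ _]
    rfl
  · exact (hh.comp (measurable_glue B)).aemeasurable

/-- The total weight of the extensions of a tuple on `B` to all the vertices, not counting the
edges inside `B`. -/
def extWeight (μ : Measure S) (W : S → S → ℝ) (Q : Finset (κ × κ)) (B : Finset κ)
    (u : {b // b ∈ B} → S) : ℝ≥0∞ :=
  ∫⁻ z, edgeWeight W (outerPairs Q B) (glue B u z) ∂(Measure.pi fun _ => μ)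

lemma measurable_extWeight [SigmaFinite μ] (hW : Measurable (Function.uncurry W))
    (Q : Finset (κ × κ)) (B : Finset κ) : Measurable (extWeight μ W Q B) :=
  Measurable.lintegral_prod_right' (f := fun p : ({b // b ∈ B} → S) × ({b // b ∉ B} → S) =>
    edgeWeight W (outerPairs Q B) (glue B p.1 p.2))
    ((measurable_edgeWeight hW _).comp (measurable_glue B))

/-- Fubini, integrating out the vertices off `B`. With `h = 1` it says that the inner edge weight
times the extension weight has the same integral as the full edge weight, which is the source of all
the finiteness below. -/
lemma lintegral_edgeWeight_mul [SigmaFinite μ] (hW : Measurable (Function.uncurry W))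
    (Q : Finset (κ × κ)) (B : Finset κ) {h : ({b // b ∈ B} → S) → ℝ≥0∞} (hh : Measurable h) :
    ∫⁻ x, edgeWeight W Q x * h (fun b => x b) ∂(Measure.pi fun _ => μ) =
      ∫⁻ u, edgeWeight W (innerPairs Q B) u * extWeight μ W Q B u * h u
        ∂(Measure.pi fun _ => μ) := by
  rw [lintegral_glue B (h := fun x => edgeWeight W Q x * h (fun b => x b))]
  · refine lintegral_congr fun u => ?_
    have h1 : ∀ z, edgeWeight W Q (glue B u z) * h (fun b => glue B u z b) =
        edgeWeight W (innerPairs Q B) u * h u * edgeWeight W (outerPairs Q B) (glue B u z) := by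
      intro z
      rw [edgeWeight_glue, show (fun b : {b // b ∈ B} => glue B u z b) = u from
        funext fun b => glue_apply_mem B u z b]
      ring
    simp_rw [h1]
    rw [lintegral_const_mul, extWeight]
    · ring
    · exact (measurable_edgeWeight hW _).comp
        ((measurable_glue B).comp (measurable_const.prodMk measurable_id))
  · exact (measurable_edgeWeight hW Q).mul
      (hh.comp (measurable_pi_lambda _ fun b => measurable_pi_apply _))

end Split

/-! ### Pairs of copies -/

section Overlap

variable {S : Type*} [MeasurableSpace S] {μ : Measure S} {W : S → S → ℝ}
  {κ : Type*} [Fintype κ] [DecidableEq κ]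

/-- The position of the vertices of a second copy relative to a first copy: the vertices in `B` are
identified with vertices of the first copy through `r`, the others are new. -/
def overlapMap (B : Finset κ) (r : {b // b ∈ B} ↪ κ) : κ ↪ κ ⊕ {b // b ∉ B} where
  toFun := glue B (fun b => Sum.inl (r b)) fun b => Sum.inr b
  inj' := by
    intro a b h
    by_cases ha : a ∈ B <;> by_cases hb : b ∈ B <;> simp [glue, ha, hb] at h <;> exact h

lemma overlapMap_apply (B : Finset κ) (r : {b // b ∈ B} ↪ κ) (b : κ) :
    overlapMap B r b = glue B (fun b => Sum.inl (r b)) (fun b => Sum.inr b) b := rfl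

lemma overlapMap_of_notMem (B : Finset κ) (r : {b // b ∈ B} ↪ κ) {b : κ} (hb : b ∉ B) :
    overlapMap B r b = Sum.inr ⟨b, hb⟩ := by
  simp [overlapMap_apply, glue, hb]

lemma sumElim_overlapMap (B : Finset κ) (r : {b // b ∈ B} ↪ κ) {A : Type*} (x : κ → A)
    (z : {b // b ∉ B} → A) :
    (fun b => Sum.elim x z (overlapMap B r b)) = glue B (fun b => x (r b)) z := by
  ext b
  by_cases hb : b ∈ B <;> simp [overlapMap_apply, glue, hb]

/-- The edges of the union of two overlapping copies, except for the edges of the second copy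
between the common vertices. -/
def overlapPairs (Q : Finset (κ × κ)) (B : Finset κ) (r : {b // b ∈ B} ↪ κ) :
    Finset ((κ ⊕ {b // b ∉ B}) × (κ ⊕ {b // b ∉ B})) :=
  Q.image (Prod.map Sum.inl Sum.inl) ∪
    (outerPairs Q B).image (Prod.map (overlapMap B r) (overlapMap B r))

lemma exists_inr_of_mem_outerPairs {Q : Finset (κ × κ)} {B : Finset κ} (r : {b // b ∈ B} ↪ κ)
    {p : κ × κ} (hp : p ∈ outerPairs Q B) :
    (∃ b, overlapMap B r p.1 = Sum.inr b) ∨ ∃ b, overlapMap B r p.2 = Sum.inr b := by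
  have := (Finset.mem_filter.1 hp).2
  by_cases h1 : p.1 ∈ B
  · have h2 : p.2 ∉ B := fun h2 => this ⟨h1, h2⟩
    exact Or.inr ⟨_, overlapMap_of_notMem B r h2⟩
  · exact Or.inl ⟨_, overlapMap_of_notMem B r h1⟩

/-- An edge of the second copy between common vertices could repeat an edge of the first copy, in
either direction, and is therefore left out. Every remaining edge of the second copy has a new
endpoint and cannot clash with the first copy. -/
lemma Oriented.overlapPairs {Q : Finset (κ × κ)} (hQ : Oriented Q) (B : Finset κ)
    (r : {b // b ∈ B} ↪ κ) : Oriented (overlapPairs Q B r) := by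
  have hout : ∀ p ∈ outerPairs Q B, p ∈ Q := fun p hp => (Finset.mem_filter.1 hp).1
  intro p hp
  simp only [GraphonLeft.overlapPairs, Finset.mem_union, Finset.mem_image] at hp ⊢
  rcases hp with ⟨q, hq, rfl⟩ | ⟨q, hq, rfl⟩
  · refine ⟨fun h => (hQ q hq).1 (Sum.inl_injective h), ?_⟩
    rintro (⟨q', hq', h⟩ | ⟨q', hq', h⟩)
    · simp only [Prod.map, Prod.swap_prod_mk, Prod.mk.injEq, Sum.inl.injEq] at h
      exact (hQ q hq).2 (by rwa [Prod.swap, ← h.1, ← h.2])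
    · simp only [Prod.map, Prod.swap_prod_mk, Prod.mk.injEq] at h
      rcases exists_inr_of_mem_outerPairs r hq' with ⟨b, hb⟩ | ⟨b, hb⟩ <;> simp [hb] at h
  · refine ⟨fun h => (hQ q (hout q hq)).1 ((overlapMap B r).injective h), ?_⟩
    rintro (⟨q', hq', h⟩ | ⟨q', hq', h⟩)
    · simp only [Prod.map, Prod.swap_prod_mk, Prod.mk.injEq] at h
      rcases exists_inr_of_mem_outerPairs r hq with ⟨b, hb⟩ | ⟨b, hb⟩ <;> simp [hb] at h
    · simp only [Prod.map, Prod.swap_prod_mk, Prod.mk.injEq, EmbeddingLike.apply_eq_iff_eq] at h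
      exact (hQ q (hout q hq)).2 (by rw [Prod.swap, ← h.1, ← h.2]; exact hout q' hq')

lemma edgeWeight_overlapPairs (Q : Finset (κ × κ)) (B : Finset κ) (r : {b // b ∈ B} ↪ κ)
    (y : κ ⊕ {b // b ∉ B} → S) :
    edgeWeight W (overlapPairs Q B r) y = edgeWeight W Q (fun a => y (Sum.inl a)) *
      edgeWeight W (outerPairs Q B) (fun a => y (overlapMap B r a)) := by
  rw [edgeWeight, overlapPairs, Finset.prod_union]
  · rw [Finset.prod_image fun p _ q _ h => Sum.inl_injective.prodMap Sum.inl_injective h,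
      Finset.prod_image fun p _ q _ h =>
        (overlapMap B r).injective.prodMap (overlapMap B r).injective h]
    rfl
  · rw [Finset.disjoint_left]
    intro p hp hp'
    obtain ⟨q, hq, rfl⟩ := Finset.mem_image.1 hp
    obtain ⟨q', hq', h⟩ := Finset.mem_image.1 hp'
    simp only [Prod.map, Prod.mk.injEq] at h
    rcases exists_inr_of_mem_outerPairs r hq' with ⟨b, hb⟩ | ⟨b, hb⟩ <;> simp [hb] at h

/-- Any two copies overlap in one of the ways described by `overlapMap`. -/
lemma exists_overlap (φ ψ : κ ↪ ℕ) :
    ∃ (B : Finset κ) (r : {b // b ∈ B} ↪ κ) (θ : κ ⊕ {b // b ∉ B} ↪ ℕ),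
      φ = Function.Embedding.inl.trans θ ∧ ψ = (overlapMap B r).trans θ := by
  classical
  let B : Finset κ := Finset.univ.filter fun b => ∃ a, φ a = ψ b
  have hB : ∀ b : {b // b ∈ B}, ∃ a, φ a = ψ b := fun b => (Finset.mem_filter.1 b.2).2
  choose r hr using hB
  have hrinj : Function.Injective r := fun b c h => Subtype.ext <| ψ.injective <| by
    rw [← hr, ← hr, h]
  have hnB : ∀ b : {b // b ∉ B}, ∀ a, φ a ≠ ψ b := fun b a h =>
    b.2 (Finset.mem_filter.2 ⟨Finset.mem_univ _, a, h⟩)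
  refine ⟨B, ⟨r, hrinj⟩, ⟨Sum.elim φ fun b => ψ b, ?_⟩, ?_, ?_⟩
  · rintro (a | a) (b | b) h
    · exact congrArg _ (φ.injective h)
    · exact absurd h (hnB b a)
    · exact absurd h.symm (hnB a b)
    · exact congrArg _ (Subtype.ext (ψ.injective h))
  · ext a; rfl
  · ext b
    have := congrFun (sumElim_overlapMap B ⟨r, hrinj⟩ φ fun b => ψ b) b
    simp only [Function.Embedding.trans_apply]
    refine Eq.trans ?_ this.symm
    by_cases hb : b ∈ B
    · simp [glue, hb, hr]
    · simp [glue, hb]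

lemma lintegral_overlapPairs [SigmaFinite μ] (hW : Measurable (Function.uncurry W))
    (Q : Finset (κ × κ)) (B : Finset κ) (r : {b // b ∈ B} ↪ κ)
    {g h : (κ → S) → ℝ≥0∞} (hg : Measurable g) (hh : Measurable h) :
    ∫⁻ y, edgeWeight W (overlapPairs Q B r) y * (g (fun a => y (Sum.inl a)) *
        h (fun a => y (overlapMap B r a))) ∂(Measure.pi fun _ => μ) =
      ∫⁻ x, edgeWeight W Q x * g x * ∫⁻ z, edgeWeight W (outerPairs Q B)
        (glue B (fun b => x (r b)) z) * h (glue B (fun b => x (r b)) z)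
        ∂(Measure.pi fun _ => μ) ∂(Measure.pi fun _ => μ) := by
  have hmp := measurePreserving_sumPiEquivProdPi_symm (X := fun _ : κ ⊕ {b // b ∉ B} => S)
    (fun _ => μ)
  have hm1 : Measurable fun (y : κ ⊕ {b // b ∉ B} → S) a => y (Sum.inl a) :=
    measurable_pi_lambda _ fun a => measurable_pi_apply _
  have hm2 : Measurable fun (y : κ ⊕ {b // b ∉ B} → S) a => y (overlapMap B r a) :=
    measurable_pi_lambda _ fun a => measurable_pi_apply _
  have hmeas : Measurable fun y : κ ⊕ {b // b ∉ B} → S =>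
      edgeWeight W (overlapPairs Q B r) y * (g (fun a => y (Sum.inl a)) *
        h (fun a => y (overlapMap B r a))) :=
    (measurable_edgeWeight hW _).mul ((hg.comp hm1).mul (hh.comp hm2))
  rw [← hmp.lintegral_comp hmeas, lintegral_prod]
  · refine lintegral_congr fun x => ?_
    rw [← lintegral_const_mul]
    · refine lintegral_congr fun z => ?_
      have e : ((MeasurableEquiv.sumPiEquivProdPi fun _ : κ ⊕ {b // b ∉ B} => S).symm (x, z)) =
          Sum.elim x z := by
        ext (a | a) <;> rfl
      rw [e, edgeWeight_overlapPairs, sumElim_overlapMap]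
      simp only [Sum.elim_inl]
      ring
    · have hm3 : Measurable fun z : {b // b ∉ B} → S => glue B (fun b => x (r b)) z :=
        (measurable_glue B).comp
          (g := fun p : ({b // b ∈ B} → S) × ({b // b ∉ B} → S) => glue B p.1 p.2)
          (f := fun z => (fun b => x (r b), z)) (measurable_const.prodMk measurable_id)
      exact ((measurable_edgeWeight hW _).comp hm3).mul (hh.comp hm3)
  · exact (hmeas.comp (MeasurableEquiv.measurable _)).aemeasurable

end Overlap

/-! ### The law of large numbers for the number of copies of a graph -/

lemma lintegral_tsum_indicator_sq {Ω ι : Type*} [MeasurableSpace Ω] [Countable ι] {P : Measure Ω}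
    {A : ι → Set Ω} (hA : ∀ i, MeasurableSet (A i)) :
    ∫⁻ ω, (∑' i, (A i).indicator (fun _ => (1 : ℝ≥0∞)) ω) ^ 2 ∂P =
      ∑' p : ι × ι, P (A p.1 ∩ A p.2) := by
  have h2 : ∀ ω, (∑' i, (A i).indicator (fun _ => (1 : ℝ≥0∞)) ω) ^ 2 =
      ∑' p : ι × ι, (A p.1 ∩ A p.2).indicator (fun _ => 1) ω := by
    intro ω
    rw [ENNReal.tsum_prod (f := fun i j => (A i ∩ A j).indicator (fun _ => (1 : ℝ≥0∞)) ω), sq,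
      ← ENNReal.tsum_mul_right]
    refine tsum_congr fun i => ?_
    rw [← ENNReal.tsum_mul_left]
    refine tsum_congr fun j => ?_
    by_cases hi : ω ∈ A i <;> by_cases hj : ω ∈ A j <;> simp [hi, hj]
  simp_rw [h2]
  rw [lintegral_tsum fun p : ι × ι =>
    (measurable_const.indicator ((hA p.1).inter (hA p.2))).aemeasurable]
  refine tsum_congr fun p => ?_
  rw [lintegral_indicator ((hA p.1).inter (hA p.2)), setLIntegral_one]

/-! ### First and second moments of copy counts. -/

section Counts

variable {Ω : Type*} [MeasurableSpace Ω] {S : Type*} [MeasurableSpace S] {P : Measure Ω}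
  {μ : Measure S} [SigmaFinite μ] {W : S → S → ℝ} {T : ℕ → Ω → ℝ≥0} {X : ℕ → Ω → S}
  {E : Ω → SimpleGraph ℕ} {κ : Type*} [Fintype κ] [DecidableEq κ] {Q : Finset (κ × κ)}

/-- The event that `φ` is a copy of `Q`, born up to time `t`, with positions in `Γ`. -/
def copyEvent (T : ℕ → Ω → ℝ≥0) (X : ℕ → Ω → S) (E : Ω → SimpleGraph ℕ) (Q : Finset (κ × κ))
    (t : ℝ≥0) (Γ : Set (κ → S)) (φ : κ ↪ ℕ) : Set Ω :=
  bornBy T t φ ∩ adjEvent E Q φ ∩ {ω | (fun i => X (φ i) ω) ∈ Γ}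

/-- The number of copies of `Q` born up to time `t` with positions in `Γ`. -/
def copyCountIn (T : ℕ → Ω → ℝ≥0) (X : ℕ → Ω → S) (E : Ω → SimpleGraph ℕ) (Q : Finset (κ × κ))
    (t : ℝ≥0) (Γ : Set (κ → S)) (ω : Ω) : ℝ≥0∞ :=
  ∑' φ : κ ↪ ℕ, (copyEvent T X E Q t Γ φ).indicator (fun _ => 1) ω

lemma measurableSet_copyEvent (h : IsGraphonSampling μ W P T X E) (t : ℝ≥0) {Γ : Set (κ → S)}
    (hΓ : MeasurableSet Γ) (φ : κ ↪ ℕ) : MeasurableSet (copyEvent T X E Q t Γ φ) := by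
  have hXφ : Measurable fun ω i => X (φ i) ω := measurable_pi_lambda _ fun i => h.measurable_X _
  exact ((measurableSet_bornBy h.measurable_T t φ).inter
    (measurableSet_adjEvent h.measurable_adj Q φ)).inter (hXφ hΓ)

lemma measurable_copyCountIn (h : IsGraphonSampling μ W P T X E) (t : ℝ≥0) {Γ : Set (κ → S)}
    (hΓ : MeasurableSet Γ) : Measurable (copyCountIn T X E Q t Γ) :=
  Measurable.tsum fun φ => measurable_const.indicator (measurableSet_copyEvent h t hΓ φ)

lemma lintegral_copyCountIn (h : IsGraphonSampling μ W P T X E)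
    (hsymm : ∀ x y, W x y = W y x) (hW : Measurable (Function.uncurry W)) (hQ : Oriented Q)
    (t : ℝ≥0) {Γ : Set (κ → S)} (hΓ : MeasurableSet Γ) :
    ∫⁻ ω, copyCountIn T X E Q t Γ ω ∂P =
      t ^ Fintype.card κ * ∫⁻ x in Γ, edgeWeight W Q x ∂(Measure.pi fun _ => μ) := by
  rw [← h.tsum_measure hsymm hW hQ t hΓ]
  simp only [copyCountIn]
  rw [lintegral_tsum fun φ =>
    (measurable_const.indicator (measurableSet_copyEvent h t hΓ φ)).aemeasurable]
  refine tsum_congr fun φ => ?_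
  rw [lintegral_indicator (measurableSet_copyEvent h t hΓ φ), setLIntegral_one, copyEvent]

/-- The total weight of pairs of copies that overlap as described by `overlapMap`. -/
def overlapWeight (μ : Measure S) (W : S → S → ℝ) (Q : Finset (κ × κ)) (Γ : Set (κ → S))
    (B : Finset κ) (r : {b // b ∈ B} ↪ κ) : ℝ≥0∞ :=
  ∫⁻ x, edgeWeight W Q x * Γ.indicator (fun _ => 1) x * ∫⁻ z, edgeWeight W (outerPairs Q B)
    (glue B (fun b => x (r b)) z) * Γ.indicator (fun _ => 1) (glue B (fun b => x (r b)) z)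
    ∂(Measure.pi fun _ => μ) ∂(Measure.pi fun _ => μ)

/-- The square counts ordered pairs of copies, and each pair comes from an overlap pattern `(B, r)`
and an injective placement `θ` of the union; surjectivity of this parametrization suffices for an
upper bound. Forgetting the edges of the second copy inside `B` only enlarges the event, and the
Campbell formula for the union finishes. -/
lemma lintegral_copyCountIn_sq_le (h : IsGraphonSampling μ W P T X E)
    (hsymm : ∀ x y, W x y = W y x) (hW : Measurable (Function.uncurry W)) (hQ : Oriented Q)
    (t : ℝ≥0) {Γ : Set (κ → S)} (hΓ : MeasurableSet Γ) :
    ∫⁻ ω, copyCountIn T X E Q t Γ ω ^ 2 ∂P ≤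
      ∑ B : Finset κ, ∑ r : {b // b ∈ B} ↪ κ,
        t ^ (Fintype.card κ + Fintype.card {b // b ∉ B}) * overlapWeight μ W Q Γ B r := by
  have h1 := lintegral_tsum_indicator_sq (P := P) (fun φ => measurableSet_copyEvent (Q := Q) h t hΓ φ)
  let pairOf : (Σ B : Finset κ, Σ _ : {b // b ∈ B} ↪ κ, (κ ⊕ {b // b ∉ B} ↪ ℕ)) →
      (κ ↪ ℕ) × (κ ↪ ℕ) :=
    fun s => (Function.Embedding.inl.trans s.2.2, (overlapMap s.1 s.2.1).trans s.2.2)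
  have hsurj : Function.Surjective pairOf := by
    rintro ⟨φ, ψ⟩
    obtain ⟨B, r, θ, h1, h2⟩ := exists_overlap φ ψ
    exact ⟨⟨B, r, θ⟩, by simp [pairOf, h1, h2]⟩
  refine h1.le.trans ?_
  refine (ENNReal.tsum_le_tsum_comp_of_surjective hsurj _).trans ?_
  rw [ENNReal.tsum_sigma', tsum_fintype]
  refine Finset.sum_le_sum fun B _ => ?_
  rw [ENNReal.tsum_sigma', tsum_fintype]
  refine Finset.sum_le_sum fun r _ => ?_
  have hg : Measurable (Γ.indicator fun _ => (1 : ℝ≥0∞)) := measurable_const.indicator hΓ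
  rw [overlapWeight, ← lintegral_overlapPairs hW Q B r hg hg,
    show Fintype.card κ + Fintype.card {b // b ∉ B} = Fintype.card (κ ⊕ {b // b ∉ B}) from
      Fintype.card_sum.symm]
  have hm1 : Measurable fun (y : κ ⊕ {b // b ∉ B} → S) a => y (Sum.inl a) :=
    measurable_pi_lambda _ fun a => measurable_pi_apply _
  have hm2 : Measurable fun (y : κ ⊕ {b // b ∉ B} → S) a => y (overlapMap B r a) :=
    measurable_pi_lambda _ fun a => measurable_pi_apply _
  let Γ' : Set (κ ⊕ {b // b ∉ B} → S) :=
    (fun y a => y (Sum.inl a)) ⁻¹' Γ ∩ (fun y a => y (overlapMap B r a)) ⁻¹' Γ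
  have hΓ' : MeasurableSet Γ' := (hm1 hΓ).inter (hm2 hΓ)
  have h3 : ∀ y, edgeWeight W (overlapPairs Q B r) y *
      (Γ.indicator (fun _ => (1 : ℝ≥0∞)) (fun a => y (Sum.inl a)) *
        Γ.indicator (fun _ => 1) (fun a => y (overlapMap B r a))) =
      Γ'.indicator (edgeWeight W (overlapPairs Q B r)) y := by
    intro y
    by_cases ha : (fun a => y (Sum.inl a)) ∈ Γ <;>
      by_cases hb : (fun a => y (overlapMap B r a)) ∈ Γ <;>
      simp [Γ', Set.indicator, ha, hb]
  simp_rw [h3]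
  rw [lintegral_indicator hΓ', ← h.tsum_measure hsymm hW (hQ.overlapPairs B r) t hΓ']
  refine ENNReal.tsum_le_tsum fun θ => measure_mono ?_
  rintro ω ⟨⟨⟨hb1, ha1⟩, hx1⟩, ⟨hb2, ha2⟩, hx2⟩
  refine ⟨⟨?_, ?_⟩, hx1, hx2⟩
  · rintro (a | b)
    · exact hb1 a
    · have := hb2 b
      simpa [pairOf, overlapMap_of_notMem B r b.2] using this
  · intro p hp
    rcases Finset.mem_union.1 hp with hp | hp
    · obtain ⟨q, hq, rfl⟩ := Finset.mem_image.1 hp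
      exact ha1 q hq
    · obtain ⟨q, hq, rfl⟩ := Finset.mem_image.1 hp
      exact ha2 q (Finset.mem_filter.1 hq).1

end Counts

/-! ### Truncation by extension weights. -/

section Good

variable {S : Type*} [MeasurableSpace S] {μ : Measure S} [SigmaFinite μ] {W : S → S → ℝ}
  {κ : Type*} [Fintype κ] [DecidableEq κ] {Q : Finset (κ × κ)}

/-- The tuples none of whose parts has too many extensions for the time `t`. -/
def goodSet (μ : Measure S) (W : S → S → ℝ) (Q : Finset (κ × κ)) (t : ℝ≥0) : Set (κ → S) :=
  {x | ∀ B : Finset κ, B.Nonempty → extWeight μ W Q B (fun b => x b) ≤ (t : ℝ≥0∞) ^ B.card}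

lemma measurableSet_goodSet (hW : Measurable (Function.uncurry W)) (t : ℝ≥0) :
    MeasurableSet (goodSet μ W Q t) := by
  have : goodSet μ W Q t = ⋂ B : Finset κ, ⋂ _ : B.Nonempty,
      (fun x : κ → S => extWeight μ W Q B (fun b => x b)) ⁻¹' Iic ((t : ℝ≥0∞) ^ B.card) := by
    ext x; simp [goodSet]
  rw [this]
  refine MeasurableSet.iInter fun B => MeasurableSet.iInter fun _ => ?_
  exact ((measurable_extWeight hW Q B).comp
    (measurable_pi_lambda _ fun b => measurable_pi_apply _)) measurableSet_Iic

/-- Disjoint copies do not interact: this pattern contributes exactly the square of the mean, the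
part that cancels in the variance. -/
lemma overlapWeight_empty (hW : Measurable (Function.uncurry W)) {Γ : Set (κ → S)}
    (hΓ : MeasurableSet Γ) (r : {b // b ∈ (∅ : Finset κ)} ↪ κ) :
    overlapWeight μ W Q Γ ∅ r = (∫⁻ x in Γ, edgeWeight W Q x ∂(Measure.pi fun _ => μ)) ^ 2 := by
  have hmeas : Measurable fun x => edgeWeight W Q x * Γ.indicator (fun _ => (1 : ℝ≥0∞)) x :=
    (measurable_edgeWeight hW Q).mul (measurable_const.indicator hΓ)
  have h0 : ∫⁻ x in Γ, edgeWeight W Q x ∂(Measure.pi fun _ => μ) =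
      ∫⁻ x, edgeWeight W Q x * Γ.indicator (fun _ => (1 : ℝ≥0∞)) x ∂(Measure.pi fun _ => μ) := by
    rw [← lintegral_indicator hΓ]
    refine lintegral_congr fun x => ?_
    by_cases hx : x ∈ Γ <;> simp [hx]
  have hout : outerPairs Q ∅ = Q := by simp [outerPairs]
  have h1 : ∀ u : {b // b ∈ (∅ : Finset κ)} → S, ∫⁻ z, edgeWeight W (outerPairs Q ∅) (glue ∅ u z) *
      Γ.indicator (fun _ => 1) (glue ∅ u z) ∂(Measure.pi fun _ => μ) =
      ∫⁻ x in Γ, edgeWeight W Q x ∂(Measure.pi fun _ => μ) := by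
    intro u
    have : IsEmpty {b // b ∈ (∅ : Finset κ)} := ⟨fun b => absurd b.2 (Finset.notMem_empty _)⟩
    rw [h0, lintegral_glue ∅ hmeas, hout, Measure.pi_of_empty _ u, lintegral_dirac]
  rw [overlapWeight]
  simp_rw [h1]
  rw [lintegral_mul_const _ hmeas, ← h0, sq]

/-- The total weight of pairs of overlapping copies for which the common part has few
extensions. -/
def truncWeight (μ : Measure S) (W : S → S → ℝ) (Q : Finset (κ × κ)) (B : Finset κ)
    (r : {b // b ∈ B} ↪ κ) (a : ℝ≥0∞) : ℝ≥0∞ :=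
  ∫⁻ x, edgeWeight W Q x * (if extWeight μ W Q B (fun b => x (r b)) ≤ a then
    extWeight μ W Q B (fun b => x (r b)) else 0) ∂(Measure.pi fun _ => μ)

/-- Goodness of the second copy already bounds the extension weight of the common part, which
depends on `x ∘ r` only. If that weight exceeds `t ^ |B|`, the inner integrand vanishes identically.
-/
lemma overlapWeight_goodSet_le (t : ℝ≥0) {B : Finset κ} (hB : B.Nonempty)
    (r : {b // b ∈ B} ↪ κ) :
    overlapWeight μ W Q (goodSet μ W Q t) B r ≤
      truncWeight μ W Q B r ((t : ℝ≥0∞) ^ B.card) := by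
  refine lintegral_mono fun x => ?_
  refine mul_le_mul' (mul_le_of_le_one_right' (Set.indicator_le_self' (by simp) _)) ?_
  split_ifs with h
  · refine lintegral_mono fun z => ?_
    exact mul_le_of_le_one_right' (Set.indicator_le_self' (by simp) _)
  · refine le_of_eq ?_
    rw [lintegral_eq_zero_of_ae_eq_zero]
    refine Eventually.of_forall fun z => ?_
    have : glue B (fun b => x (r b)) z ∉ goodSet μ W Q t := by
      intro hz
      apply h
      have h1 := hz B hB
      rwa [show (fun b : {b // b ∈ B} => glue B (fun b => x (r b)) z b) = fun b => x (r b) from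
        funext fun b => glue_apply_mem B _ z b] at h1
    simp [this]

/-- For fixed `x` the sum over `j` is bounded by a constant whatever the extension weight, by
`tsum_mul_inv_pow_le`. So the variances along geometric times are summable although no second moment
of the extension weight is assumed. -/
lemma tsum_truncWeight_le (hW : Measurable (Function.uncurry W)) (B : Finset κ)
    (r : {b // b ∈ B} ↪ κ) {q : ℝ≥0∞} (hq : 1 < q) (hq' : q ≠ ∞) :
    ∑' j : ℕ, q⁻¹ ^ j * truncWeight μ W Q B r (q ^ j) ≤
      (1 - q⁻¹)⁻¹ * ∫⁻ x, edgeWeight W Q x ∂(Measure.pi fun _ => μ) := by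
  have hext : Measurable fun x : κ → S => extWeight μ W Q B (fun b => x (r b)) :=
    (measurable_extWeight hW Q B).comp (measurable_pi_lambda _ fun b => measurable_pi_apply _)
  have hmeas : ∀ j : ℕ, Measurable fun x : κ → S => edgeWeight W Q x *
      (if extWeight μ W Q B (fun b => x (r b)) ≤ q ^ j then
        extWeight μ W Q B (fun b => x (r b)) else 0) := fun j =>
    (measurable_edgeWeight hW Q).mul
      (Measurable.ite (hext measurableSet_Iic) hext measurable_const)
  simp_rw [truncWeight, ← lintegral_const_mul _ (hmeas _)]
  rw [← lintegral_tsum fun j => ((hmeas j).const_mul _).aemeasurable,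
    ← lintegral_const_mul _ (measurable_edgeWeight hW Q)]
  refine lintegral_mono fun x => ?_
  calc ∑' j : ℕ, q⁻¹ ^ j * (edgeWeight W Q x *
        (if extWeight μ W Q B (fun b => x (r b)) ≤ q ^ j then
          extWeight μ W Q B (fun b => x (r b)) else 0))
      = edgeWeight W Q x * ∑' j : ℕ, (if extWeight μ W Q B (fun b => x (r b)) ≤ q ^ j then
          q⁻¹ ^ j * extWeight μ W Q B (fun b => x (r b)) else 0) := by
        rw [← ENNReal.tsum_mul_left]
        refine tsum_congr fun j => ?_
        split_ifs <;> ring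
    _ ≤ edgeWeight W Q x * (1 - q⁻¹)⁻¹ := by
        gcongr
        exact tsum_mul_inv_pow_le hq hq' _
    _ = _ := mul_comm _ _

/-- Summing `q ^ j` over the levels below the extension weight returns a multiple of that weight, by
`tsum_pow_le`, and integrating the weight against the inner edges gives back the full integral. This
is the Borel–Cantelli bound for parts with too many extensions. -/
lemma tsum_setLIntegral_innerPairs_le (hW : Measurable (Function.uncurry W)) (B : Finset κ)
    {q : ℝ≥0∞} (hq : 1 < q) (hq' : q ≠ ∞) :
    ∑' j : ℕ, q ^ j * ∫⁻ u in {u | q ^ j < extWeight μ W Q B u},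
        edgeWeight W (innerPairs Q B) u ∂(Measure.pi fun _ => μ) ≤
      (1 - q⁻¹)⁻¹ * ∫⁻ x, edgeWeight W Q x ∂(Measure.pi fun _ => μ) := by
  have hext := measurable_extWeight (μ := μ) hW Q B
  have hin := measurable_edgeWeight hW (innerPairs Q B)
  have hset : ∀ j : ℕ, MeasurableSet {u | q ^ j < extWeight μ W Q B u} := fun j =>
    hext measurableSet_Ioi
  have h1 := lintegral_edgeWeight_mul (μ := μ) hW Q B (h := fun _ => 1) measurable_const
  simp only [mul_one] at h1
  have hie : Measurable fun u => edgeWeight W (innerPairs Q B) u * extWeight μ W Q B u :=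
    hin.mul hext
  rw [h1, ← lintegral_const_mul _ hie]
  simp_rw [← lintegral_indicator (hset _), ← lintegral_const_mul _ (hin.indicator (hset _))]
  rw [← lintegral_tsum fun j => ((hin.indicator (hset j)).const_mul _).aemeasurable]
  refine lintegral_mono fun u => ?_
  calc ∑' j : ℕ, q ^ j * {u | q ^ j < extWeight μ W Q B u}.indicator
        (edgeWeight W (innerPairs Q B)) u
      = edgeWeight W (innerPairs Q B) u *
          ∑' j : ℕ, (if q ^ j < extWeight μ W Q B u then q ^ j else 0) := by
        rw [← ENNReal.tsum_mul_left]
        refine tsum_congr fun j => ?_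
        simp only [Set.indicator, mem_ofPred_eq]
        split_ifs <;> ring
    _ ≤ edgeWeight W (innerPairs Q B) u * ((1 - q⁻¹)⁻¹ * extWeight μ W Q B u) := by
        gcongr
        exact tsum_pow_le hq hq' _
    _ = _ := by ring

/-- The product of the inner edge weight and the extension weight is integrable, so the inner edge
weight vanishes almost everywhere where the extension weight is infinite, and with it the full edge
weight. -/
lemma ae_extWeight_lt_top (hW : Measurable (Function.uncurry W))
    (hI : ∫⁻ x, edgeWeight W Q x ∂(Measure.pi fun _ : κ => μ) ≠ ∞) (B : Finset κ) :
    ∀ᵐ x ∂(Measure.pi fun _ : κ => μ), edgeWeight W Q x ≠ 0 →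
      extWeight μ W Q B (fun b => x b) < ∞ := by
  have hext := measurable_extWeight (μ := μ) hW Q B
  have hin := measurable_edgeWeight hW (innerPairs Q B)
  have h1 := lintegral_edgeWeight_mul (μ := μ) hW Q B (h := fun _ => 1) measurable_const
  simp only [mul_one] at h1
  have hset : MeasurableSet {u | extWeight μ W Q B u = ∞} := hext (measurableSet_singleton _)
  have hind : Measurable ({u | extWeight μ W Q B u = ∞}.indicator fun _ => (1 : ℝ≥0∞)) :=
    measurable_const.indicator hset
  have h2 := lintegral_edgeWeight_mul (μ := μ) hW Q B hind
  have h3 : ∫⁻ u, edgeWeight W (innerPairs Q B) u * extWeight μ W Q B u *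
      {u | extWeight μ W Q B u = ∞}.indicator (fun _ => 1) u ∂(Measure.pi fun _ => μ) = 0 := by
    have hie : Measurable fun u => edgeWeight W (innerPairs Q B) u * extWeight μ W Q B u :=
      hin.mul hext
    refine lintegral_eq_zero_of_ae_eq_zero ?_
    filter_upwards [ae_lt_top hie (h1 ▸ hI)] with u hu
    by_cases hinf : extWeight μ W Q B u = ∞
    · rw [hinf] at hu
      have : edgeWeight W (innerPairs Q B) u = 0 := by
        by_contra h0
        rw [ENNReal.mul_top h0] at hu
        exact lt_irrefl _ hu
      simp [this]
    · simp [hinf]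
  have hm : Measurable fun x : κ → S => edgeWeight W Q x *
      {u | extWeight μ W Q B u = ∞}.indicator (fun _ => 1) (fun b => x b) :=
    (measurable_edgeWeight hW Q).mul
      (hind.comp (measurable_pi_lambda _ fun b => measurable_pi_apply _))
  rw [h3, lintegral_eq_zero_iff hm] at h2
  filter_upwards [h2] with x hx hne
  by_contra hinf
  rw [not_lt, top_le_iff] at hinf
  simp [hinf, hne] at hx

/-- Dominated convergence: almost every tuple of positive weight has finite extension weights, and
each is eventually below `t ^ |B|` because `B` is nonempty and `t` tends to infinity. So truncation
does not change the limit of the mean. -/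
lemma tendsto_setLIntegral_goodSet (hW : Measurable (Function.uncurry W))
    (hI : ∫⁻ x, edgeWeight W Q x ∂(Measure.pi fun _ : κ => μ) ≠ ∞) {t : ℕ → ℝ≥0}
    (ht : Tendsto t atTop atTop) :
    Tendsto (fun j => ∫⁻ x in goodSet μ W Q (t j), edgeWeight W Q x ∂(Measure.pi fun _ => μ)) atTop
      (𝓝 (∫⁻ x, edgeWeight W Q x ∂(Measure.pi fun _ => μ))) := by
  simp_rw [← lintegral_indicator (measurableSet_goodSet (Q := Q) (μ := μ) hW _)]
  refine tendsto_lintegral_of_dominated_convergence (edgeWeight W Q)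
    (fun j => (measurable_edgeWeight hW Q).indicator (measurableSet_goodSet hW _))
    (fun j => Eventually.of_forall fun x => Set.indicator_le_self _ _ x) hI ?_
  have h1 : ∀ᵐ x ∂(Measure.pi fun _ : κ => μ), ∀ B : Finset κ, edgeWeight W Q x ≠ 0 →
      extWeight μ W Q B (fun b => x b) < ∞ := ae_all_iff.2 fun B => ae_extWeight_lt_top hW hI B
  filter_upwards [h1] with x hx
  by_cases h0 : edgeWeight W Q x = 0
  · simp [Set.indicator, h0]
  refine tendsto_const_nhds.congr' ?_
  have h2 : ∀ B : Finset κ, ∀ᶠ j in atTop, B.Nonempty →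
      extWeight μ W Q B (fun b => x b) ≤ (t j : ℝ≥0∞) ^ B.card := by
    intro B
    have hB := hx B h0
    lift extWeight μ W Q B (fun b => x b) to ℝ≥0 using hB.ne with e
    filter_upwards [ht.eventually_ge_atTop (max e 1)] with j hj hne
    have h3 : e ≤ t j := (le_max_left _ _).trans hj
    have h4 : 1 ≤ t j := (le_max_right _ _).trans hj
    have h5 : e ≤ t j ^ B.card := h3.trans (le_self_pow₀ h4 (Finset.card_ne_zero.2 hne))
    exact_mod_cast h5
  filter_upwards [eventually_all.2 h2] with j hj
  rw [Set.indicator_of_mem]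
  exact fun B hB => hj B hB

end Good

/-! ### The strong law for copy counts with finite expectation. -/

section LawOfLargeNumbers

variable {Ω : Type*} [MeasurableSpace Ω] {S : Type*} [MeasurableSpace S] {P : Measure Ω}
  {μ : Measure S} [SigmaFinite μ] {W : S → S → ℝ} {T : ℕ → Ω → ℝ≥0} {X : ℕ → Ω → S}
  {E : Ω → SimpleGraph ℕ} {κ : Type*} [Fintype κ] [DecidableEq κ] {Q : Finset (κ × κ)}

/-- After division by `t ^ (2 * k)` a pattern with overlap `B` retains the factor `t ^ (-|B|)`, as
the union of the two copies has `2 * k - |B|` vertices. -/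
lemma lintegral_goodCount_sq_le (h : IsGraphonSampling μ W P T X E)
    (hsymm : ∀ x y, W x y = W y x) (hW : Measurable (Function.uncurry W)) (hQ : Oriented Q)
    {t : ℝ≥0} (ht : t ≠ 0) :
    ∫⁻ ω, (copyCountIn T X E Q t (goodSet μ W Q t) ω / (t : ℝ≥0∞) ^ Fintype.card κ) ^ 2 ∂P ≤
      (∫⁻ x in goodSet μ W Q t, edgeWeight W Q x ∂(Measure.pi fun _ => μ)) ^ 2 +
      ∑ B : Finset κ with B.Nonempty, ∑ r : {b // b ∈ B} ↪ κ,
        ((t : ℝ≥0∞) ^ B.card)⁻¹ * truncWeight μ W Q B r ((t : ℝ≥0∞) ^ B.card) := by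
  classical
  have hΓ := measurableSet_goodSet (μ := μ) (Q := Q) hW t
  set c := ∫⁻ x in goodSet μ W Q t, edgeWeight W Q x ∂(Measure.pi fun _ => μ) with hc
  have ht0 : (t : ℝ≥0∞) ≠ 0 := by exact_mod_cast ht
  have htT : (t : ℝ≥0∞) ≠ ∞ := ENNReal.coe_ne_top
  set k := Fintype.card κ with hk
  have hpow0 : ∀ n : ℕ, (t : ℝ≥0∞) ^ n ≠ 0 := fun n => pow_ne_zero _ ht0
  have hpowT : ∀ n : ℕ, (t : ℝ≥0∞) ^ n ≠ ∞ := fun n => ENNReal.pow_ne_top htT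
  have hcard : ∀ B : Finset κ, Fintype.card {b // b ∉ B} + B.card = k := fun B => by
    rw [Fintype.card_subtype_compl, Fintype.card_coe]
    exact Nat.sub_add_cancel B.card_le_univ
  have h1 := lintegral_copyCountIn_sq_le h hsymm hW hQ t hΓ
  have h2 : ∀ ω, (copyCountIn T X E Q t (goodSet μ W Q t) ω / (t : ℝ≥0∞) ^ k) ^ 2 =
      (((t : ℝ≥0∞) ^ k) ^ 2)⁻¹ * copyCountIn T X E Q t (goodSet μ W Q t) ω ^ 2 := fun ω => by
    rw [div_eq_mul_inv, mul_pow, ← ENNReal.inv_pow, mul_comm]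
  simp_rw [h2]
  rw [lintegral_const_mul _ ((measurable_copyCountIn h t hΓ).pow_const 2)]
  have h3 : ∑ B : Finset κ, ∑ r : {b // b ∈ B} ↪ κ,
        t ^ (k + Fintype.card {b // b ∉ B}) * overlapWeight μ W Q (goodSet μ W Q t) B r ≤
      ((t : ℝ≥0∞) ^ k) ^ 2 * (c ^ 2 + ∑ B : Finset κ with B.Nonempty,
        ∑ r : {b // b ∈ B} ↪ κ,
        ((t : ℝ≥0∞) ^ B.card)⁻¹ * truncWeight μ W Q B r ((t : ℝ≥0∞) ^ B.card)) := by
    rw [← Finset.sum_filter_not_add_sum_filter (s := Finset.univ)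
      (p := fun B : Finset κ => B.Nonempty), mul_add]
    refine add_le_add ?_ ?_
    · have he : (Finset.univ.filter fun B : Finset κ => ¬ B.Nonempty) = {∅} := by
        ext B; simp [Finset.not_nonempty_iff_eq_empty]
      rw [he, Finset.sum_singleton]
      have hem : IsEmpty {b // b ∈ (∅ : Finset κ)} :=
        ⟨fun b => absurd b.2 (Finset.notMem_empty _)⟩
      simp_rw [overlapWeight_empty hW hΓ]
      have := hcard ∅
      rw [Finset.card_empty, add_zero] at this
      rw [Finset.sum_const, Finset.card_univ, Fintype.card_embedding_eq,
        Fintype.card_eq_zero (α := {b // b ∈ (∅ : Finset κ)}), Nat.descFactorial_zero, one_smul, this, ← pow_mul, ← mul_two]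
    · rw [Finset.mul_sum]
      refine Finset.sum_le_sum fun B hB => ?_
      rw [Finset.mul_sum]
      refine Finset.sum_le_sum fun r _ => ?_
      rw [← mul_assoc]
      have e : ((t : ℝ≥0∞) ^ k) ^ 2 * ((t : ℝ≥0∞) ^ B.card)⁻¹ =
          t ^ (k + Fintype.card {b // b ∉ B}) := by
        rw [sq, ← pow_add]
        conv_lhs => rw [show k + k = k + Fintype.card {b // b ∉ B} + B.card by
          have := hcard B; omega]
        rw [pow_add _ _ B.card, mul_assoc, ENNReal.mul_inv_cancel (hpow0 _) (hpowT _), mul_one]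
      rw [e]
      gcongr
      exact overlapWeight_goodSet_le t (Finset.mem_filter.1 hB).2 r
  calc _ ≤ (((t : ℝ≥0∞) ^ k) ^ 2)⁻¹ * (((t : ℝ≥0∞) ^ k) ^ 2 * _) := by
        gcongr
        exact h1.trans h3
    _ = _ := by
        rw [← mul_assoc, ENNReal.inv_mul_cancel, one_mul]
        · exact pow_ne_zero _ (hpow0 _)
        · exact ENNReal.pow_ne_top (hpowT _)

/-- Almost surely no tuple of points has too many extensions, along a geometric sequence of
times. -/
lemma ae_eventually_copyCountIn_eq (h : IsGraphonSampling μ W P T X E)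
    (hsymm : ∀ x y, W x y = W y x) (hW : Measurable (Function.uncurry W)) (hQ : Oriented Q)
    (hI : ∫⁻ x, edgeWeight W Q x ∂(Measure.pi fun _ : κ => μ) ≠ ∞) {ρ : ℝ≥0} (hρ : 1 < ρ) :
    ∀ᵐ ω ∂P, ∀ᶠ j : ℕ in atTop,
      copyCountIn T X E Q (ρ ^ j) (goodSet μ W Q (ρ ^ j)) ω = copyCount T E Q (ρ ^ j) ω := by
  have hbad : ∀ B : Finset κ, B.Nonempty → ∀ᵐ ω ∂P, ∀ᶠ j : ℕ in atTop,
      ω ∉ ⋃ θ : {b // b ∈ B} ↪ ℕ, copyEvent T X E (innerPairs Q B) (ρ ^ j)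
        {u | ((ρ : ℝ≥0∞) ^ B.card) ^ j < extWeight μ W Q B u} θ := by
    intro B hB
    have hq : 1 < (ρ : ℝ≥0∞) ^ B.card :=
      one_lt_pow₀ (by exact_mod_cast hρ) (Finset.card_ne_zero.2 hB)
    have hq' : (ρ : ℝ≥0∞) ^ B.card ≠ ∞ := ENNReal.pow_ne_top ENNReal.coe_ne_top
    -- Borel–Cantelli: the probability of a bad part at time `ρ ^ j` is at most the expected number
    -- of bad parts, which is summable over `j`.
    refine ae_eventually_notMem (ne_top_of_le_ne_top ?_
      ((ENNReal.tsum_le_tsum fun j => ?_).trans (tsum_setLIntegral_innerPairs_le (μ := μ) (Q := Q) hW B hq hq')))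
    · exact ENNReal.mul_ne_top (inv_one_sub_inv_ne_top hq) hI
    · refine (measure_iUnion_le _).trans ?_
      have hset : MeasurableSet {u | ((ρ : ℝ≥0∞) ^ B.card) ^ j < extWeight μ W Q B u} :=
        measurable_extWeight hW Q B measurableSet_Ioi
      have := h.tsum_measure hsymm hW (hQ.innerPairs B) (ρ ^ j) hset
      refine this.le.trans (le_of_eq ?_)
      rw [Fintype.card_coe]
      push_cast
      rw [← pow_mul, ← pow_mul, mul_comm j]
  have hbad' : ∀ᵐ ω ∂P, ∀ B : Finset κ, B.Nonempty → ∀ᶠ j : ℕ in atTop,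
      ω ∉ ⋃ θ : {b // b ∈ B} ↪ ℕ, copyEvent T X E (innerPairs Q B) (ρ ^ j)
        {u | ((ρ : ℝ≥0∞) ^ B.card) ^ j < extWeight μ W Q B u} θ :=
    ae_all_iff.2 fun B => by
      by_cases hB : B.Nonempty
      · filter_upwards [hbad B hB] with ω hω _ using hω
      · exact Eventually.of_forall fun ω hB' => absurd hB' hB
  filter_upwards [hbad'] with ω hω
  have hω' : ∀ᶠ j : ℕ in atTop, ∀ B : Finset κ, B.Nonempty →
      ω ∉ ⋃ θ : {b // b ∈ B} ↪ ℕ, copyEvent T X E (innerPairs Q B) (ρ ^ j)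
        {u | ((ρ : ℝ≥0∞) ^ B.card) ^ j < extWeight μ W Q B u} θ :=
    eventually_all.2 fun B => by
      by_cases hB : B.Nonempty
      · filter_upwards [hω B hB] with ω hω _ using hω
      · exact Eventually.of_forall fun ω hB' => absurd hB' hB
  filter_upwards [hω'] with j hj
  refine tsum_congr fun φ => ?_
  by_cases hφ : ω ∈ bornBy T (ρ ^ j) φ ∩ adjEvent E Q φ
  · rw [Set.indicator_of_mem hφ, Set.indicator_of_mem]
    refine ⟨hφ, fun B hB => ?_⟩
    by_contra hlt
    rw [not_le] at hlt
    -- Restricting a copy that is not good to `B` gives a copy of the inner pairs with too large an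
    -- extension weight, and none is left at this time.
    refine hj B hB (mem_iUnion.2 ⟨(Function.Embedding.subtype _).trans φ,
      ⟨fun b => hφ.1 b, fun p hp => hφ.2 _ (Finset.mem_filter.1 hp).2⟩, ?_⟩)
    change ((ρ : ℝ≥0∞) ^ B.card) ^ j < _
    refine lt_of_eq_of_lt ?_ hlt
    push_cast
    rw [← pow_mul, ← pow_mul, mul_comm]
  · rw [Set.indicator_of_notMem hφ, Set.indicator_of_notMem]
    exact fun h' => hφ h'.1

lemma copyCount_mono (ω : Ω) : Monotone fun t => copyCount T E Q t ω := by
  intro s t hst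
  refine ENNReal.tsum_le_tsum fun φ => ?_
  refine Set.indicator_le_indicator_of_subset ?_ (fun _ => zero_le) ω
  exact inter_subset_inter_left _ fun ω hω i => (hω i).trans hst

/-- The law of large numbers for the number of copies of a graph, in the case of finite
expectation. -/
theorem ae_tendsto_copyCount_of_ne_top [IsProbabilityMeasure P]
    (h : IsGraphonSampling μ W P T X E)
    (hsymm : ∀ x y, W x y = W y x) (hW : Measurable (Function.uncurry W)) (hQ : Oriented Q)
    (hI : ∫⁻ x, edgeWeight W Q x ∂(Measure.pi fun _ : κ => μ) ≠ ∞) :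
    ∀ᵐ ω ∂P, Tendsto (fun t : ℝ≥0 => copyCount T E Q t ω / (t : ℝ≥0∞) ^ Fintype.card κ) atTop
      (𝓝 (∫⁻ x, edgeWeight W Q x ∂(Measure.pi fun _ : κ => μ))) := by
  have key : ∀ n : ℕ, ∀ᵐ ω ∂P, Tendsto (fun j : ℕ =>
      copyCount T E Q ((1 + 1 / ((n : ℝ≥0) + 1)) ^ j) ω /
        (((1 + 1 / ((n : ℝ≥0) + 1)) ^ j : ℝ≥0) : ℝ≥0∞) ^ Fintype.card κ) atTop
      (𝓝 (∫⁻ x, edgeWeight W Q x ∂(Measure.pi fun _ : κ => μ))) := by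
    intro n
    set ρ : ℝ≥0 := 1 + 1 / ((n : ℝ≥0) + 1) with hρdef
    have hρ : 1 < ρ := by
      have : (0 : ℝ≥0) < 1 / ((n : ℝ≥0) + 1) := by positivity
      exact lt_add_of_pos_right _ this
    have hρ0 : ∀ j : ℕ, ρ ^ j ≠ 0 := fun j => pow_ne_zero _ (zero_lt_one.trans hρ).ne'
    have hlim : Tendsto (fun j : ℕ => ρ ^ j) atTop atTop := tendsto_pow_atTop_atTop_of_one_lt hρ
    have hΓ := fun j : ℕ => measurableSet_goodSet (μ := μ) (Q := Q) hW (ρ ^ j)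
    have h0 : ∀ j : ℕ, ((ρ ^ j : ℝ≥0) : ℝ≥0∞) ^ Fintype.card κ ≠ 0 := fun j =>
      pow_ne_zero _ (by exact_mod_cast hρ0 j)
    have hT : ∀ j : ℕ, ((ρ ^ j : ℝ≥0) : ℝ≥0∞) ^ Fintype.card κ ≠ ∞ := fun j =>
      ENNReal.pow_ne_top ENNReal.coe_ne_top
    have hmain := ae_tendsto_of_second_moment (P := P)
      (Y := fun j ω => copyCountIn T X E Q (ρ ^ j) (goodSet μ W Q (ρ ^ j)) ω /
        ((ρ ^ j : ℝ≥0) : ℝ≥0∞) ^ Fintype.card κ)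
      (fun j => (measurable_copyCountIn h _ (hΓ j)).div_const _) hI
      (tendsto_setLIntegral_goodSet hW hI hlim)
      (fun j => ne_top_of_le_ne_top hI (setLIntegral_le_lintegral _ _))
      (fun j => by
        simp_rw [div_eq_mul_inv]
        rw [lintegral_mul_const _ (measurable_copyCountIn h _ (hΓ j)),
          lintegral_copyCountIn h hsymm hW hQ _ (hΓ j), mul_right_comm,
          ENNReal.mul_inv_cancel (h0 j) (hT j), one_mul])
      (fun j => lintegral_goodCount_sq_le h hsymm hW hQ (hρ0 j))
      (by
        rw [Summable.tsum_finsetSum fun _ _ => ENNReal.summable]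
        refine (ENNReal.sum_lt_top.2 fun B hB => ?_).ne
        rw [Summable.tsum_finsetSum fun _ _ => ENNReal.summable]
        refine ENNReal.sum_lt_top.2 fun r _ => ?_
        have hq : 1 < (ρ : ℝ≥0∞) ^ B.card := one_lt_pow₀ (by exact_mod_cast hρ)
          (Finset.card_ne_zero.2 (Finset.mem_filter.1 hB).2)
        have hq' : (ρ : ℝ≥0∞) ^ B.card ≠ ∞ := ENNReal.pow_ne_top ENNReal.coe_ne_top
        refine lt_of_eq_of_lt (tsum_congr fun j => ?_)
          ((tsum_truncWeight_le (μ := μ) (Q := Q) hW B r hq hq').trans_lt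
          (ENNReal.mul_lt_top (inv_one_sub_inv_ne_top hq).lt_top hI.lt_top))
        have e : ((ρ ^ j : ℝ≥0) : ℝ≥0∞) ^ B.card = ((ρ : ℝ≥0∞) ^ B.card) ^ j := by
          push_cast
          rw [← pow_mul, ← pow_mul, mul_comm]
        rw [e, ENNReal.inv_pow])
    filter_upwards [hmain, ae_eventually_copyCountIn_eq h hsymm hW hQ hI hρ] with ω h1 h2
    refine h1.congr' ?_
    filter_upwards [h2] with j hj
    rw [hj]
  filter_upwards [ae_all_iff.2 key] with ω hω
  exact tendsto_div_pow_of_geometric (copyCount_mono ω) hω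

end LawOfLargeNumbers

/-! ### Infinite expectation: restriction to sets of finite measure. -/

section Restriction

variable {Ω : Type*} [MeasurableSpace Ω] {S : Type*} [MeasurableSpace S] {P : Measure Ω}
  {μ : Measure S} {W : S → S → ℝ} {T : ℕ → Ω → ℝ≥0} {X : ℕ → Ω → S}
  {E : Ω → SimpleGraph ℕ}

open Classical in
/-- The graphon `W` with the values off `D × D` replaced by `0`. -/
def restrictGraphon (W : S → S → ℝ) (D : Set S) (x y : S) : ℝ :=
  if x ∈ D ∧ y ∈ D then W x y else 0

lemma restrictGraphon_symm (hsymm : ∀ x y, W x y = W y x) (D : Set S) (x y : S) :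
    restrictGraphon W D x y = restrictGraphon W D y x := by
  by_cases hx : x ∈ D <;> by_cases hy : y ∈ D <;> simp [restrictGraphon, hx, hy, hsymm x y]

/-- The subgraph of the edges between points with positions in `D`. -/
def restrictEdges (X : ℕ → Ω → S) (E : Ω → SimpleGraph ℕ) (D : Set S) (ω : Ω) : SimpleGraph ℕ where
  Adj i j := (E ω).Adj i j ∧ X i ω ∈ D ∧ X j ω ∈ D
  symm := ⟨fun _ _ h => ⟨h.1.symm, h.2.2, h.2.1⟩⟩
  loopless := ⟨fun _ h => (E ω).irrefl h.1⟩

lemma measurable_restrictGraphon (hW : Measurable (Function.uncurry W)) {D : Set S}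
    (hD : MeasurableSet D) : Measurable (Function.uncurry (restrictGraphon W D)) := by
  classical
  have : Function.uncurry (restrictGraphon W D) = (D ×ˢ D).indicator (Function.uncurry W) := by
    ext ⟨x, y⟩
    simp [restrictGraphon, Set.indicator, Function.uncurry]
  rw [this]
  exact hW.indicator (hD.prod hD)

/-- Whether the endpoints lie in `D` is determined by the points, on which the edge law is
conditioned. Deleting the other edges therefore gives a sampling of the restricted graphon with the
same points. -/
lemma IsGraphonSampling.restrict (h : IsGraphonSampling μ W P T X E) {D : Set S}
    (hD : MeasurableSet D) :
    IsGraphonSampling μ (restrictGraphon W D) P T X (restrictEdges X E D) where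
  poisson := h.poisson
  measurable_adj i j :=
    (h.measurable_adj i j).inter ((h.measurable_X i hD).inter (h.measurable_X j hD))
  edges s hs A hA := by
    classical
    have hle : MeasurableSpace.comap (fun ω i => (T i ω, X i ω))
        (inferInstance : MeasurableSpace (ℕ → ℝ≥0 × S)) ≤ ‹MeasurableSpace Ω› :=
      (measurable_pi_lambda _ fun i => h.poisson.measurable i).comap_le
    let C : Set Ω := ⋂ p ∈ s, X p.1 ⁻¹' D ∩ X p.2 ⁻¹' D
    have hX : ∀ i, MeasurableSet[MeasurableSpace.comap (fun ω i => (T i ω, X i ω))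
        (inferInstance : MeasurableSpace (ℕ → ℝ≥0 × S))] (X i ⁻¹' D) := fun i =>
      ⟨(fun y => (y i).2) ⁻¹' D, (measurable_snd.comp (measurable_pi_apply i)) hD, rfl⟩
    have hC : MeasurableSet[MeasurableSpace.comap (fun ω i => (T i ω, X i ω))
        (inferInstance : MeasurableSpace (ℕ → ℝ≥0 × S))] C :=
      Finset.measurableSet_biInter _ fun p _ => (hX p.1).inter (hX p.2)
    have hCmem : ∀ ω, ω ∈ C ↔ ∀ p ∈ s, X p.1 ω ∈ D ∧ X p.2 ω ∈ D := fun ω => by simp [C]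
    have h1 := h.edges s hs (A ∩ C) (hA.inter hC)
    have h2 : A ∩ {ω | ∀ p ∈ s, (restrictEdges X E D ω).Adj p.1 p.2} =
        A ∩ C ∩ {ω | ∀ p ∈ s, (E ω).Adj p.1 p.2} := by
      ext ω
      have : (∀ p ∈ s, (restrictEdges X E D ω).Adj p.1 p.2) ↔
          (∀ p ∈ s, X p.1 ω ∈ D ∧ X p.2 ω ∈ D) ∧ ∀ p ∈ s, (E ω).Adj p.1 p.2 := by
        rw [← forall₂_and]
        exact forall₂_congr fun p _ => and_comm
      rw [mem_inter_iff, mem_inter_iff, mem_inter_iff, hCmem, mem_ofPred_eq, this, mem_ofPred_eq,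
        and_assoc]
    rw [h2, h1, inter_comm A C, ← Measure.restrict_restrict (hle _ hC),
      ← lintegral_indicator (hle _ hC)]
    refine lintegral_congr fun ω => ?_
    by_cases hω : ω ∈ C
    · rw [Set.indicator_of_mem hω]
      refine Finset.prod_congr rfl fun p hp => ?_
      rw [restrictGraphon, if_pos ((hCmem ω).1 hω p hp)]
    · rw [Set.indicator_of_notMem hω]
      have : ∃ p ∈ s, ¬ (X p.1 ω ∈ D ∧ X p.2 ω ∈ D) := by
        rw [hCmem] at hω
        push Not at hω ⊢
        exact hω
      obtain ⟨p, hp, hpD⟩ := this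
      rw [Finset.prod_eq_zero hp]
      rw [restrictGraphon, if_neg hpD, ENNReal.ofReal_zero]

variable [SigmaFinite μ] {κ : Type*} [Fintype κ] [DecidableEq κ] {Q : Finset (κ × κ)}

/-- Every vertex belongs to some pair of `Q`, so a single coordinate outside `D` makes a factor
vanish. An isolated vertex would remain unconstrained. -/
lemma edgeWeight_restrictGraphon (hcov : ∀ a, ∃ p ∈ Q, a = p.1 ∨ a = p.2) (D : Set S) (x : κ → S) :
    edgeWeight (restrictGraphon W D) Q x = (univ.pi fun _ => D).indicator (edgeWeight W Q) x := by
  classical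
  by_cases hx : x ∈ univ.pi fun _ : κ => D
  · rw [Set.indicator_of_mem hx]
    refine Finset.prod_congr rfl fun p _ => ?_
    rw [restrictGraphon, if_pos ⟨hx _ (mem_univ _), hx _ (mem_univ _)⟩]
  · rw [Set.indicator_of_notMem hx]
    have : ∃ a, x a ∉ D := by
      by_contra hall
      push Not at hall
      exact hx fun a _ => hall a
    obtain ⟨a, ha⟩ := this
    obtain ⟨p, hp, hap⟩ := hcov a
    refine Finset.prod_eq_zero hp ?_
    rw [restrictGraphon, if_neg, ENNReal.ofReal_zero]
    rcases hap with rfl | rfl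
    · exact fun h => ha h.1
    · exact fun h => ha h.2

/-- The law of large numbers for the number of copies of a graph without isolated vertices. -/
theorem ae_tendsto_copyCount [IsProbabilityMeasure P] (h : IsGraphonSampling μ W P T X E)
    (hsymm : ∀ x y, W x y = W y x) (hW : Measurable (Function.uncurry W))
    (hW1 : ∀ x y, W x y ≤ 1) (hQ : Oriented Q) (hcov : ∀ a, ∃ p ∈ Q, a = p.1 ∨ a = p.2) :
    ∀ᵐ ω ∂P, Tendsto (fun t : ℝ≥0 => copyCount T E Q t ω / (t : ℝ≥0∞) ^ Fintype.card κ) atTop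
      (𝓝 (∫⁻ x, edgeWeight W Q x ∂(Measure.pi fun _ : κ => μ))) := by
  by_cases hI : ∫⁻ x, edgeWeight W Q x ∂(Measure.pi fun _ : κ => μ) = ∞
  swap
  · exact ae_tendsto_copyCount_of_ne_top h hsymm hW hQ hI
  rw [hI]
  let D : ℕ → Set S := spanningSets μ
  have hD : ∀ n, MeasurableSet (D n) := measurableSet_spanningSets μ
  have hpi : ∀ n, MeasurableSet (univ.pi fun _ : κ => D n) := fun n =>
    MeasurableSet.univ_pi fun _ => hD n
  -- As `W ≤ 1`, the restricted integral is at most `μ (D n) ^ |κ|`.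
  have hfin : ∀ n, ∫⁻ x, edgeWeight (restrictGraphon W (D n)) Q x
      ∂(Measure.pi fun _ : κ => μ) ≠ ∞ := by
    intro n
    simp_rw [edgeWeight_restrictGraphon hcov]
    rw [lintegral_indicator (hpi n)]
    refine ne_top_of_le_ne_top ?_ (setLIntegral_mono measurable_const
      fun x _ => edgeWeight_le_one hW1 Q x)
    rw [setLIntegral_one, Measure.pi_pi]
    exact ENNReal.prod_ne_top fun _ _ => (measure_spanningSets_lt_top μ n).ne
  have hlim : ∀ᵐ ω ∂P, ∀ n, Tendsto (fun t : ℝ≥0 =>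
      copyCount T (restrictEdges X E (D n)) Q t ω / (t : ℝ≥0∞) ^ Fintype.card κ) atTop
      (𝓝 (∫⁻ x, edgeWeight (restrictGraphon W (D n)) Q x ∂(Measure.pi fun _ : κ => μ))) :=
    ae_all_iff.2 fun n => ae_tendsto_copyCount_of_ne_top (h.restrict (hD n))
      (restrictGraphon_symm hsymm _)
      (measurable_restrictGraphon hW (hD n)) hQ (hfin n)
  have hsup : Tendsto (fun n => ∫⁻ x, edgeWeight (restrictGraphon W (D n)) Q x
      ∂(Measure.pi fun _ : κ => μ)) atTop (𝓝 ∞) := by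
    rw [← hI]
    simp_rw [edgeWeight_restrictGraphon hcov]
    refine lintegral_tendsto_of_tendsto_of_monotone
      (fun n => ((measurable_edgeWeight hW Q).indicator (hpi n)).aemeasurable) ?_ ?_
    · refine Eventually.of_forall fun x m n hmn => ?_
      refine Set.indicator_le_indicator_of_subset ?_ (fun _ => zero_le) x
      exact Set.pi_mono fun _ _ => monotone_spanningSets μ hmn
    · refine Eventually.of_forall fun x => tendsto_const_nhds.congr' ?_
      have : ∀ a : κ, ∀ᶠ n in atTop, x a ∈ D n := fun a => by
        filter_upwards [eventually_ge_atTop (spanningSetsIndex μ (x a))] with n hn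
        exact mem_spanningSets_of_index_le μ (x a) hn
      filter_upwards [eventually_all.2 this] with n hn
      rw [Set.indicator_of_mem]
      exact fun a _ => hn a
  filter_upwards [hlim] with ω hω
  rw [ENNReal.tendsto_nhds_top_iff_nnreal]
  intro c
  obtain ⟨n, hn⟩ := (hsup.eventually (lt_mem_nhds (ENNReal.coe_lt_top (r := c)))).exists
  filter_upwards [(hω n).eventually (lt_mem_nhds hn)] with t ht
  -- Copies in the restricted graph are copies in the whole graph, so every restricted limit is an
  -- eventual lower bound.
  refine ht.trans_le ?_
  gcongr
  refine ENNReal.tsum_le_tsum fun φ => ?_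
  by_cases hφ : ω ∈ bornBy T t φ ∩ adjEvent (restrictEdges X E (D n)) Q φ
  · rw [Set.indicator_of_mem hφ, Set.indicator_of_mem]
    exact ⟨hφ.1, fun p hp => (hφ.2 p hp).1⟩
  · rw [Set.indicator_of_notMem hφ]
    exact zero_le

end Restriction

/-! ### The number of points in a set -/

section Vertices

variable {Ω : Type*} [MeasurableSpace Ω] {S : Type*} [MeasurableSpace S] {P : Measure Ω}
  {μ : Measure S} [SigmaFinite μ] {T : ℕ → Ω → ℝ≥0} {X : ℕ → Ω → S}

lemma sq_eq_fallingFactorial_add (c : ℕ∞) :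
    (c : ℝ≥0∞) ^ 2 = fallingFactorial 2 c + fallingFactorial 1 c := by
  induction c using ENat.recTopCoe with
  | top => simp [fallingFactorial]
  | coe n =>
    rw [ENat.toENNReal_coe, fallingFactorial_natCast, fallingFactorial_natCast]
    norm_cast
    rcases n with _ | n
    · simp
    · simp only [Nat.descFactorial_succ, Nat.descFactorial_zero, Nat.add_sub_cancel]
      ring_nf
      simp
      ring

/-- The number of points born up to time `t` with positions in `D`. -/
def pointCount (T : ℕ → Ω → ℝ≥0) (X : ℕ → Ω → S) (D : Set S) (t : ℝ≥0) (ω : Ω) : ℝ≥0∞ :=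
  countIn (fun i ω => (T i ω, X i ω)) (Iic t ×ˢ D) ω

lemma pointCount_mono (D : Set S) (ω : Ω) : Monotone fun t => pointCount T X D t ω := by
  intro s t hst
  refine ENat.toENNReal_le.2 (Set.encard_le_encard fun i hi => ?_)
  exact ⟨le_trans hi.1 hst, hi.2⟩

lemma lintegral_pointCount (h : IsPoissonPoints P (lebesgue.prod μ) fun i ω => (T i ω, X i ω))
    {D : Set S} (hD : MeasurableSet D) (hfin : μ D ≠ ∞) (t : ℝ≥0) :
    ∫⁻ ω, pointCount T X D t ω ∂P = t * μ D := by
  have hA : (lebesgue.prod μ) (Iic t ×ˢ D) = t * μ D := by rw [Measure.prod_prod, lebesgue_Iic]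
  have := h.lintegral_fallingFactorial (measurableSet_Iic.prod hD)
    (by rw [hA]; exact ENNReal.mul_ne_top ENNReal.coe_ne_top hfin) 1
  simpa [fallingFactorial, hA, pointCount] using this

/-- The count is Poisson with mean `t * μ D`, so the variance of the count divided by `t` is `μ D /
t`, which is summable along geometric times. -/
theorem ae_tendsto_pointCount [IsProbabilityMeasure P]
    (h : IsPoissonPoints P (lebesgue.prod μ) fun i ω => (T i ω, X i ω))
    {D : Set S} (hD : MeasurableSet D) (hfin : μ D ≠ ∞) :
    ∀ᵐ ω ∂P, Tendsto (fun t : ℝ≥0 => pointCount T X D t ω / t) atTop (𝓝 (μ D)) := by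
  have hm : ∀ t : ℝ≥0, MeasurableSet (Iic t ×ˢ D) := fun t => measurableSet_Iic.prod hD
  have hA : ∀ t : ℝ≥0, (lebesgue.prod μ) (Iic t ×ˢ D) = t * μ D := fun t => by
    rw [Measure.prod_prod, lebesgue_Iic]
  have hAfin : ∀ t : ℝ≥0, (lebesgue.prod μ) (Iic t ×ˢ D) ≠ ∞ := fun t => by
    rw [hA]; exact ENNReal.mul_ne_top ENNReal.coe_ne_top hfin
  have hmeas : ∀ t : ℝ≥0, Measurable (pointCount T X D t) := fun t =>
    measurable_countIn h.measurable (hm t)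
  have key : ∀ n : ℕ, ∀ᵐ ω ∂P, Tendsto (fun j : ℕ =>
      pointCount T X D ((1 + 1 / ((n : ℝ≥0) + 1)) ^ j) ω /
        (((1 + 1 / ((n : ℝ≥0) + 1)) ^ j : ℝ≥0) : ℝ≥0∞) ^ 1) atTop (𝓝 (μ D)) := by
    intro n
    set ρ : ℝ≥0 := 1 + 1 / ((n : ℝ≥0) + 1) with hρdef
    have hρ : 1 < ρ := by
      have : (0 : ℝ≥0) < 1 / ((n : ℝ≥0) + 1) := by positivity
      exact lt_add_of_pos_right _ this
    have h0 : ∀ j : ℕ, ((ρ ^ j : ℝ≥0) : ℝ≥0∞) ≠ 0 := fun j => by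
      exact_mod_cast pow_ne_zero _ (zero_lt_one.trans hρ).ne'
    simp_rw [pow_one]
    refine ae_tendsto_of_second_moment (P := P) (c := fun _ => μ D)
      (v := fun j => ((ρ : ℝ≥0∞)⁻¹) ^ j * μ D)
      (fun j => (hmeas _).div_const _) hfin tendsto_const_nhds (fun _ => hfin)
      (fun j => ?_) (fun j => ?_) ?_
    · simp_rw [div_eq_mul_inv]
      rw [lintegral_mul_const _ (hmeas _), lintegral_pointCount h hD hfin, mul_right_comm,
        ENNReal.mul_inv_cancel (h0 j) ENNReal.coe_ne_top, one_mul]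
    · simp_rw [div_eq_mul_inv, mul_pow]
      rw [lintegral_mul_const _ ((hmeas _).pow_const 2)]
      have h2 : ∫⁻ ω, pointCount T X D (ρ ^ j) ω ^ 2 ∂P =
          (((ρ ^ j : ℝ≥0) : ℝ≥0∞) * μ D) ^ 2 + (((ρ ^ j : ℝ≥0) : ℝ≥0∞) * μ D) ^ 1 := by
        rw [← hA, ← h.lintegral_fallingFactorial (hm _) (hAfin _) 2,
          ← h.lintegral_fallingFactorial (hm _) (hAfin _) 1, ← lintegral_add_left]
        · exact lintegral_congr fun ω => sq_eq_fallingFactorial_add _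
        · exact (measurable_fallingFactorial 2).comp (measurable_countIn h.measurable (hm _))
      rw [h2]
      refine le_of_eq ?_
      have h3 : ((ρ : ℝ≥0∞)⁻¹) ^ j = (((ρ ^ j : ℝ≥0) : ℝ≥0∞))⁻¹ := by
        push_cast; rw [ENNReal.inv_pow]
      rw [h3]
      set a := ((ρ ^ j : ℝ≥0) : ℝ≥0∞)
      have ha : a * a⁻¹ = 1 := ENNReal.mul_inv_cancel (h0 j) ENNReal.coe_ne_top
      calc ((a * μ D) ^ 2 + (a * μ D) ^ 1) * a⁻¹ ^ 2
          = (a * a⁻¹) ^ 2 * μ D ^ 2 + (a * a⁻¹) * (a⁻¹ * μ D) := by ring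
        _ = _ := by rw [ha]; ring
    · rw [ENNReal.tsum_mul_right, ENNReal.tsum_geometric]
      exact ENNReal.mul_ne_top (inv_one_sub_inv_ne_top (by exact_mod_cast hρ)) hfin
  filter_upwards [ae_all_iff.2 key] with ω hω
  have := tendsto_div_pow_of_geometric (pointCount_mono D ω) hω
  simpa using this

end Vertices

/-! ### The number of non-isolated vertices -/

section NonIsolated

variable {Ω : Type*} [MeasurableSpace Ω] {S : Type*} [MeasurableSpace S] {P : Measure Ω}
  {μ : Measure S} {W : S → S → ℝ} {T : ℕ → Ω → ℝ≥0} {X : ℕ → Ω → S}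
  {E : Ω → SimpleGraph ℕ}

/-- The degree function of a non-negative graphon, with values in `[0, ∞]`. -/
def lDegree (μ : Measure S) (W : S → S → ℝ) (x : S) : ℝ≥0∞ := ∫⁻ y, ENNReal.ofReal (W x y) ∂μ

lemma measurable_lDegree [SFinite μ] (hW : Measurable (Function.uncurry W)) :
    Measurable (lDegree μ W) :=
  Measurable.lintegral_prod_right' (f := fun p : S × S => ENNReal.ofReal (W p.1 p.2))
    (ENNReal.measurable_ofReal.comp hW)

/-- The neighbours born up to time `t`. -/
def nbrs (T : ℕ → Ω → ℝ≥0) (E : Ω → SimpleGraph ℕ) (t : ℝ≥0) (ω : Ω) (i : ℕ) : Set ℕ :=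
  {j | T j ω ≤ t ∧ (E ω).Adj i j}

/-- The points born up to time `t` that are not isolated at time `t`. -/
def nonIsolated (T : ℕ → Ω → ℝ≥0) (E : Ω → SimpleGraph ℕ) (t : ℝ≥0) (ω : Ω) : Set ℕ :=
  {i | T i ω ≤ t ∧ (nbrs T E t ω i).Nonempty}

/-- The points in `D` born up to time `t` that are isolated at time `t`. -/
def isolatedIn (T : ℕ → Ω → ℝ≥0) (X : ℕ → Ω → S) (E : Ω → SimpleGraph ℕ) (D : Set S) (t : ℝ≥0)
    (ω : Ω) : Set ℕ :=
  {i | T i ω ≤ t ∧ X i ω ∈ D ∧ nbrs T E t ω i = ∅}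

open Classical in
/-- The sum over the points born up to time `t` of a function of the position times the degree. -/
lemma tsum_fin_two (t : ℝ≥0) (ω : Ω) (g : S → ℝ≥0∞) :
    ∑' θ : Fin 2 ↪ ℕ, (bornBy T t θ ∩ adjEvent E {((0 : Fin 2), (1 : Fin 2))} θ).indicator
        (fun ω => g (X (θ 0) ω)) ω =
      ∑' i, (if T i ω ≤ t then g (X i ω) * ((nbrs T E t ω i).encard : ℝ≥0∞) else 0) := by
  have h1 : ∀ i, (if T i ω ≤ t then g (X i ω) * ((nbrs T E t ω i).encard : ℝ≥0∞) else 0) =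
      ∑' j, (if T i ω ≤ t ∧ j ∈ nbrs T E t ω i then g (X i ω) else 0) := by
    intro i
    rw [encard_eq_tsum_indicator, ← ENNReal.tsum_mul_left]
    by_cases hi : T i ω ≤ t
    · simp only [hi, if_true, true_and, Set.indicator, mul_ite, mul_one, mul_zero]
    · simp [hi]
  simp_rw [h1]
  rw [← ENNReal.tsum_prod (f := fun i j => if T i ω ≤ t ∧ j ∈ nbrs T E t ω i then g (X i ω) else 0)]
  have hinj : Function.Injective fun θ : Fin 2 ↪ ℕ => (θ 0, θ 1) := by
    intro θ η h
    simp only [Prod.mk.injEq] at h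
    ext a
    fin_cases a
    · exact h.1
    · exact h.2
  rw [← hinj.tsum_eq]
  · refine tsum_congr fun θ => ?_
    simp only [Set.indicator, bornBy, adjEvent, nbrs, mem_inter_iff, mem_ofPred_eq,
      Finset.mem_singleton, forall_eq, Fin.forall_fin_two, and_assoc]
    congr
  · rintro ⟨i, j⟩ hij
    rw [Function.mem_support] at hij
    have h2 : T i ω ≤ t ∧ j ∈ nbrs T E t ω i := by
      by_contra hcon
      exact hij (if_neg hcon)
    have hne : i ≠ j := h2.2.2.ne
    refine ⟨⟨![i, j], fun a b hab => ?_⟩, rfl⟩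
    fin_cases a <;> fin_cases b <;> simp_all

-- The square of a degree splits into the degree and the number of ordered pairs of distinct
-- neighbours. First and second moments of degrees thus become sums over pairs and triples of
-- distinct points, to which the Campbell formula applies.
open Classical in
lemma encard_sq_eq (s : Set ℕ) : ((s.encard : ℕ∞) : ℝ≥0∞) ^ 2 =
    (s.encard : ℝ≥0∞) + ∑' p : ℕ × ℕ, (if p.1 ∈ s ∧ p.2 ∈ s ∧ p.1 ≠ p.2 then 1 else 0) := by
  have h1 : ((s.encard : ℕ∞) : ℝ≥0∞) ^ 2 =
      ∑' p : ℕ × ℕ, ((if p.1 ∈ s ∧ p.1 = p.2 then 1 else 0) +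
        (if p.1 ∈ s ∧ p.2 ∈ s ∧ p.1 ≠ p.2 then 1 else 0)) := by
    rw [encard_eq_tsum_indicator, sq, ← ENNReal.tsum_mul_right]
    simp_rw [← ENNReal.tsum_mul_left]
    rw [← ENNReal.tsum_prod (f := fun i j => s.indicator (fun _ => (1 : ℝ≥0∞)) i *
      s.indicator (fun _ => (1 : ℝ≥0∞)) j)]
    refine tsum_congr fun p => ?_
    by_cases h1 : p.1 = p.2
    · by_cases h2 : p.2 ∈ s <;> simp [h1, h2]
    · by_cases h2 : p.1 ∈ s <;> by_cases h3 : p.2 ∈ s <;> simp [h1, h2, h3]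
  rw [h1, ENNReal.tsum_add]
  congr 1
  rw [encard_eq_tsum_indicator,
    ENNReal.tsum_prod (f := fun i j => if i ∈ s ∧ i = j then (1 : ℝ≥0∞) else 0)]
  refine tsum_congr fun i => ?_
  rw [tsum_eq_single i]
  · simp [Set.indicator]
  · intro j hj
    exact if_neg fun h => hj h.2.symm

open Classical in
lemma tsum_fin_three (t : ℝ≥0) (ω : Ω) (g : S → ℝ≥0∞) :
    ∑' θ : Fin 3 ↪ ℕ, (bornBy T t θ ∩
        adjEvent E {((0 : Fin 3), (1 : Fin 3)), ((0 : Fin 3), (2 : Fin 3))} θ).indicator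
        (fun ω => g (X (θ 0) ω)) ω =
      ∑' i, (if T i ω ≤ t then g (X i ω) * ∑' p : ℕ × ℕ,
        (if p.1 ∈ nbrs T E t ω i ∧ p.2 ∈ nbrs T E t ω i ∧ p.1 ≠ p.2 then 1 else 0) else 0) := by
  have h1 : ∀ i, (if T i ω ≤ t then g (X i ω) * ∑' p : ℕ × ℕ,
        (if p.1 ∈ nbrs T E t ω i ∧ p.2 ∈ nbrs T E t ω i ∧ p.1 ≠ p.2 then 1 else 0) else 0) =
      ∑' p : ℕ × ℕ, (if T i ω ≤ t ∧ p.1 ∈ nbrs T E t ω i ∧ p.2 ∈ nbrs T E t ω i ∧ p.1 ≠ p.2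
        then g (X i ω) else 0) := by
    intro i
    rw [← ENNReal.tsum_mul_left]
    by_cases hi : T i ω ≤ t
    · simp only [hi, if_true, true_and, mul_ite, mul_one, mul_zero]
    · simp [hi]
  simp_rw [h1]
  rw [← ENNReal.tsum_prod (f := fun i (p : ℕ × ℕ) => if T i ω ≤ t ∧ p.1 ∈ nbrs T E t ω i ∧
    p.2 ∈ nbrs T E t ω i ∧ p.1 ≠ p.2 then g (X i ω) else 0)]
  have hinj : Function.Injective fun θ : Fin 3 ↪ ℕ => (θ 0, (θ 1, θ 2)) := by
    intro θ η h
    simp only [Prod.mk.injEq] at h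
    ext a
    fin_cases a
    · exact h.1
    · exact h.2.1
    · exact h.2.2
  rw [← hinj.tsum_eq]
  · refine tsum_congr fun θ => ?_
    have hne : θ 1 ≠ θ 2 := θ.injective.ne (by decide)
    simp only [Set.indicator, bornBy, adjEvent, nbrs, mem_inter_iff, mem_ofPred_eq,
      Finset.mem_insert, Finset.mem_singleton, forall_eq_or_imp, forall_eq, ne_eq, hne,
      not_false_eq_true, and_true, Fin.forall_fin_succ]
    refine if_congr ?_ rfl rfl
    simp only [Fin.succ_zero_eq_one, Fin.succ_one_eq_two, IsEmpty.forall_iff, and_true]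
    tauto
  · rintro ⟨i, j, l⟩ hij
    rw [Function.mem_support] at hij
    have h2 : T i ω ≤ t ∧ j ∈ nbrs T E t ω i ∧ l ∈ nbrs T E t ω i ∧ j ≠ l := by
      by_contra hcon
      exact hij (if_neg hcon)
    have hne : i ≠ j := h2.2.1.2.ne
    have hne' : i ≠ l := h2.2.2.1.2.ne
    have hne'' := h2.2.2.2
    refine ⟨⟨![i, j, l], fun a b hab => ?_⟩, rfl⟩
    fin_cases a <;> fin_cases b <;> simp_all

lemma two_mul_le_one_add_sq (d : ℝ≥0∞) : 2 * d ≤ 1 + d ^ 2 := by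
  rcases eq_or_ne d ∞ with rfl | hd
  · simp
  · lift d to ℝ≥0 using hd
    have : (2 * d : ℝ≥0) ≤ 1 + d ^ 2 := by
      rw [← NNReal.coe_le_coe]
      push_cast
      nlinarith [sq_nonneg ((d : ℝ) - 1)]
    exact_mod_cast this

/-! #### Integrals over pairs and triples -/

lemma lintegral_edgeWeight_fin_two [SigmaFinite μ] (hW : Measurable (Function.uncurry W))
    {g : S → ℝ≥0∞} (hg : Measurable g) :
    ∫⁻ x, edgeWeight W {((0 : Fin 2), (1 : Fin 2))} x * g (x 0) ∂(Measure.pi fun _ => μ) =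
      ∫⁻ x, lDegree μ W x * g x ∂μ := by
  have hW' : Measurable fun p : S × S => ENNReal.ofReal (W p.1 p.2) :=
    ENNReal.measurable_ofReal.comp hW
  have hm : Measurable fun p : S × S => ENNReal.ofReal (W p.1 p.2) * g p.1 :=
    hW'.mul (hg.comp measurable_fst)
  have h1 := (measurePreserving_finTwoArrow μ).lintegral_comp hm
  simp only [edgeWeight, Finset.prod_singleton]
  refine h1.trans ?_
  rw [lintegral_prod _ hm.aemeasurable]
  refine lintegral_congr fun x => ?_
  have hWx : Measurable fun y => ENNReal.ofReal (W x y) :=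
    hW'.comp (f := fun y => (x, y)) (measurable_const.prodMk measurable_id)
  exact lintegral_mul_const (g x) hWx

lemma lintegral_edgeWeight_fin_three [SigmaFinite μ] (hW : Measurable (Function.uncurry W))
    {g : S → ℝ≥0∞} (hg : Measurable g) :
    ∫⁻ x, edgeWeight W {((0 : Fin 3), (1 : Fin 3)), ((0 : Fin 3), (2 : Fin 3))} x * g (x 0)
      ∂(Measure.pi fun _ => μ) = ∫⁻ x, lDegree μ W x ^ 2 * g x ∂μ := by
  have hW' : Measurable fun p : S × S => ENNReal.ofReal (W p.1 p.2) :=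
    ENNReal.measurable_ofReal.comp hW
  have hWx : ∀ x, Measurable fun y => ENNReal.ofReal (W x y) := fun x =>
    hW'.comp (f := fun y => (x, y)) (measurable_const.prodMk measurable_id)
  have hm : Measurable fun p : S × (Fin 2 → S) =>
      ENNReal.ofReal (W p.1 (p.2 0)) * ENNReal.ofReal (W p.1 (p.2 1)) * g p.1 := by
    have hp : ∀ a : Fin 2, Measurable fun p : S × (Fin 2 → S) => ENNReal.ofReal (W p.1 (p.2 a)) :=
      fun a => hW'.comp (f := fun p : S × (Fin 2 → S) => (p.1, p.2 a))
        (measurable_fst.prodMk ((measurable_pi_apply a).comp measurable_snd))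
    exact ((hp 0).mul (hp 1)).mul (hg.comp measurable_fst)
  have h1 := (measurePreserving_piFinSuccAbove (fun _ : Fin 3 => μ) 0).lintegral_comp hm
  have h2 : ∀ x : Fin 3 → S,
      edgeWeight W {((0 : Fin 3), (1 : Fin 3)), ((0 : Fin 3), (2 : Fin 3))} x =
      ENNReal.ofReal (W (x 0) (x 1)) * ENNReal.ofReal (W (x 0) (x 2)) := fun x => by
    rw [edgeWeight, Finset.prod_pair (by decide)]
  simp_rw [h2]
  refine h1.trans ?_
  rw [lintegral_prod _ hm.aemeasurable]
  refine lintegral_congr fun x => ?_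
  have hm2 : Measurable fun p : S × S => ENNReal.ofReal (W x p.1) * ENNReal.ofReal (W x p.2) :=
    ((hWx x).comp measurable_fst).mul ((hWx x).comp measurable_snd)
  have h3 := (measurePreserving_finTwoArrow μ).lintegral_comp hm2
  have hm3 : Measurable fun y : Fin 2 → S =>
      ENNReal.ofReal (W x (y 0)) * ENNReal.ofReal (W x (y 1)) :=
    ((hWx x).comp (measurable_pi_apply 0)).mul ((hWx x).comp (measurable_pi_apply 1))
  refine (lintegral_mul_const (g x) hm3).trans ?_
  congr 1
  refine h3.trans ?_
  rw [lintegral_prod_mul (hWx x).aemeasurable (hWx x).aemeasurable, sq]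
  rfl

lemma measurableSet_isolatedIn (h : IsGraphonSampling μ W P T X E) {D : Set S}
    (hD : MeasurableSet D) (t : ℝ≥0) (i : ℕ) : MeasurableSet {ω | i ∈ isolatedIn T X E D t ω} := by
  have : {ω | i ∈ isolatedIn T X E D t ω} = T i ⁻¹' Iic t ∩ (X i ⁻¹' D ∩
      ⋂ j, (T j ⁻¹' Iic t ∩ {ω | (E ω).Adj i j})ᶜ) := by
    ext ω
    simp [isolatedIn, nbrs, Set.eq_empty_iff_forall_notMem]
  rw [this]
  exact (h.measurable_T i measurableSet_Iic).inter ((h.measurable_X i hD).inter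
    (MeasurableSet.iInter fun j =>
      ((h.measurable_T j measurableSet_Iic).inter (h.measurable_adj i j)).compl))

lemma measurable_encard_isolatedIn (h : IsGraphonSampling μ W P T X E) {D : Set S}
    (hD : MeasurableSet D) (t : ℝ≥0) :
    Measurable fun ω => ((isolatedIn T X E D t ω).encard : ℝ≥0∞) := by
  simp_rw [encard_eq_tsum_indicator]
  exact Measurable.tsum fun i =>
    (measurable_const.indicator (measurableSet_isolatedIn h hD t i) :
      Measurable ({ω | i ∈ isolatedIn T X E D t ω}.indicator fun _ => (1 : ℝ≥0∞)))

-- For each point with degree `d` the inequality is `1_{d = 0} ≤ (1 - w d)²`, with the cross term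
-- moved to the left: equality if `d = 0`, and otherwise a square is non-negative. It holds for any
-- weight `w`.
open Classical in
lemma encard_isolatedIn_add_le (D : Set S) (t : ℝ≥0) (ω : Ω) (w : S → ℝ≥0∞) :
    ((isolatedIn T X E D t ω).encard : ℝ≥0∞) +
      2 * ∑' i, (if T i ω ≤ t then D.indicator w (X i ω) * ((nbrs T E t ω i).encard : ℝ≥0∞) else 0) ≤
    pointCount T X D t ω +
      (∑' i, (if T i ω ≤ t then D.indicator (fun x => w x ^ 2) (X i ω) *
        ((nbrs T E t ω i).encard : ℝ≥0∞) else 0) +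
      ∑' i, (if T i ω ≤ t then D.indicator (fun x => w x ^ 2) (X i ω) * ∑' p : ℕ × ℕ,
        (if p.1 ∈ nbrs T E t ω i ∧ p.2 ∈ nbrs T E t ω i ∧ p.1 ≠ p.2 then 1 else 0) else 0)) := by
  rw [pointCount, countIn, encard_eq_tsum_indicator, encard_eq_tsum_indicator,
    ← ENNReal.tsum_mul_left, ← ENNReal.tsum_add, ← ENNReal.tsum_add, ← ENNReal.tsum_add]
  refine ENNReal.tsum_le_tsum fun i => ?_
  by_cases hi : T i ω ≤ t
  swap
  · simp [hi, isolatedIn]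
  by_cases hx : X i ω ∈ D
  swap
  · simp [hx, isolatedIn]
  have h1 : i ∈ {i | (T i ω, X i ω) ∈ Iic t ×ˢ D} := ⟨hi, hx⟩
  rw [Set.indicator_of_mem h1]
  simp only [hi, if_true, Set.indicator_of_mem hx]
  rw [← mul_add, ← encard_sq_eq, ← mul_pow]
  by_cases hiso : nbrs T E t ω i = ∅
  · have h2 : i ∈ isolatedIn T X E D t ω := ⟨hi, hx, hiso⟩
    simp [h2, hiso]
  · have h2 : i ∉ isolatedIn T X E D t ω := fun h => hiso h.2.2
    rw [Set.indicator_of_notMem h2, zero_add]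
    exact two_mul_le_one_add_sq _

lemma lintegral_tsum_fin_two [SigmaFinite μ] (h : IsGraphonSampling μ W P T X E)
    (hsymm : ∀ x y, W x y = W y x) (hW : Measurable (Function.uncurry W)) (t : ℝ≥0)
    {g : S → ℝ≥0∞} (hg : Measurable g) :
    ∫⁻ ω, ∑' θ : Fin 2 ↪ ℕ, (bornBy T t θ ∩ adjEvent E {((0 : Fin 2), (1 : Fin 2))} θ).indicator
        (fun ω => g (X (θ 0) ω)) ω ∂P = t ^ 2 * ∫⁻ x, lDegree μ W x * g x ∂μ := by
  have hev : ∀ θ : Fin 2 ↪ ℕ, MeasurableSet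
      (bornBy T t θ ∩ adjEvent E {((0 : Fin 2), (1 : Fin 2))} θ) := fun θ =>
    (measurableSet_bornBy h.measurable_T t θ).inter (measurableSet_adjEvent h.measurable_adj _ _)
  have hQ : Oriented {((0 : Fin 2), (1 : Fin 2))} := by
    intro p hp
    obtain rfl := Finset.mem_singleton.1 hp
    decide
  have hgX : ∀ i, Measurable fun ω => g (X i ω) := fun i => hg.comp (h.measurable_X i)
  rw [lintegral_tsum fun θ => ((hgX (θ 0)).indicator (hev θ)).aemeasurable]
  simp_rw [fun θ : Fin 2 ↪ ℕ => lintegral_indicator (μ := P) (hev θ) (fun ω => g (X (θ 0) ω))]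
  have := h.campbell_edges hsymm hW hQ t (g := fun x => g (x 0)) (hg.comp (measurable_pi_apply 0))
  rw [lintegral_edgeWeight_fin_two hW hg] at this
  simpa using this

lemma lintegral_tsum_fin_three [SigmaFinite μ] (h : IsGraphonSampling μ W P T X E)
    (hsymm : ∀ x y, W x y = W y x) (hW : Measurable (Function.uncurry W)) (t : ℝ≥0)
    {g : S → ℝ≥0∞} (hg : Measurable g) :
    ∫⁻ ω, ∑' θ : Fin 3 ↪ ℕ, (bornBy T t θ ∩
        adjEvent E {((0 : Fin 3), (1 : Fin 3)), ((0 : Fin 3), (2 : Fin 3))} θ).indicator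
        (fun ω => g (X (θ 0) ω)) ω ∂P = t ^ 3 * ∫⁻ x, lDegree μ W x ^ 2 * g x ∂μ := by
  have hev : ∀ θ : Fin 3 ↪ ℕ, MeasurableSet (bornBy T t θ ∩
      adjEvent E {((0 : Fin 3), (1 : Fin 3)), ((0 : Fin 3), (2 : Fin 3))} θ) := fun θ =>
    (measurableSet_bornBy h.measurable_T t θ).inter (measurableSet_adjEvent h.measurable_adj _ _)
  have hQ : Oriented {((0 : Fin 3), (1 : Fin 3)), ((0 : Fin 3), (2 : Fin 3))} := by
    intro p hp
    simp only [Finset.mem_insert, Finset.mem_singleton] at hp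
    rcases hp with rfl | rfl <;> decide
  have hgX : ∀ i, Measurable fun ω => g (X i ω) := fun i => hg.comp (h.measurable_X i)
  rw [lintegral_tsum fun θ => ((hgX (θ 0)).indicator (hev θ)).aemeasurable]
  simp_rw [fun θ : Fin 3 ↪ ℕ => lintegral_indicator (μ := P) (hev θ) (fun ω => g (X (θ 0) ω))]
  have := h.campbell_edges hsymm hW hQ t (g := fun x => g (x 0)) (hg.comp (measurable_pi_apply 0))
  rw [lintegral_edgeWeight_fin_three hW hg] at this
  simpa using this

end NonIsolated

/-! ### The strong law for non-isolated points. -/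

section NonIsolatedLimit

variable {Ω : Type*} [MeasurableSpace Ω] {S : Type*} [MeasurableSpace S] {P : Measure Ω}
  {μ : Measure S} [SigmaFinite μ] {W : S → S → ℝ} {T : ℕ → Ω → ℝ≥0} {X : ℕ → Ω → S}
  {E : Ω → SimpleGraph ℕ}

/-- The expected number of isolated points in a set where the degrees are bounded below is bounded
uniformly in time. -/
lemma lintegral_encard_isolatedIn_le (h : IsGraphonSampling μ W P T X E)
    (hsymm : ∀ x y, W x y = W y x) (hW : Measurable (Function.uncurry W)) {D : Set S}
    (hD : MeasurableSet D) (hfin : μ D ≠ ∞) {ε : ℝ≥0∞} (hε : ε ≠ 0)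
    (hdeg : ∀ x ∈ D, ε ≤ lDegree μ W x ∧ lDegree μ W x ≠ ∞) {t : ℝ≥0} (ht : t ≠ 0) :
    ∫⁻ ω, ((isolatedIn T X E D t ω).encard : ℝ≥0∞) ∂P ≤ ε⁻¹ * μ D := by
  classical
  have ht0 : (t : ℝ≥0∞) ≠ 0 := by exact_mod_cast ht
  have htT : (t : ℝ≥0∞) ≠ ∞ := ENNReal.coe_ne_top
  have hdm := measurable_lDegree (μ := μ) hW
  -- A point at `x` has expected degree `t * lDegree μ W x` at time `t`. Dividing by it makes the
  -- square `(1 - w d)²` a relative deviation, so this is Chebyshev's inequality.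
  set w : S → ℝ≥0∞ := fun x => (t * lDegree μ W x)⁻¹ with hw
  have hwm : Measurable w := (hdm.const_mul _).inv
  have hw1 : Measurable (D.indicator w) := hwm.indicator hD
  have hw2 : Measurable (D.indicator fun x => w x ^ 2) := (hwm.pow_const 2).indicator hD
  have hpath := fun ω => encard_isolatedIn_add_le (T := T) (X := X) (E := E) D t ω w
  simp_rw [← tsum_fin_two, ← tsum_fin_three] at hpath
  have hev2 : ∀ θ : Fin 2 ↪ ℕ, MeasurableSet
      (bornBy T t θ ∩ adjEvent E {((0 : Fin 2), (1 : Fin 2))} θ) := fun θ =>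
    (measurableSet_bornBy h.measurable_T t θ).inter (measurableSet_adjEvent h.measurable_adj _ _)
  have hm2 : ∀ g : S → ℝ≥0∞, Measurable g → Measurable fun ω => ∑' θ : Fin 2 ↪ ℕ,
      (bornBy T t θ ∩ adjEvent E {((0 : Fin 2), (1 : Fin 2))} θ).indicator
        (fun ω => g (X (θ 0) ω)) ω := fun g hg =>
    Measurable.tsum fun θ => (hg.comp (h.measurable_X (θ 0))).indicator (hev2 θ)
  have hpm : Measurable (pointCount T X D t) :=
    measurable_countIn h.poisson.measurable (measurableSet_Iic.prod hD)
  have hint := lintegral_mono (μ := P) hpath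
  rw [lintegral_add_right _ ((hm2 _ hw1).const_mul 2), lintegral_const_mul _ (hm2 _ hw1),
    lintegral_tsum_fin_two h hsymm hW t hw1, lintegral_add_left hpm,
    lintegral_pointCount h.poisson hD hfin, lintegral_add_left (hm2 _ hw2),
    lintegral_tsum_fin_two h hsymm hW t hw2, lintegral_tsum_fin_three h hsymm hW t hw2] at hint
  have hd0 : ∀ x ∈ D, lDegree μ W x ≠ 0 := fun x hx h0 =>
    hε (le_zero_iff.1 (h0 ▸ (hdeg x hx).1))
  have hwd : ∀ x ∈ D, lDegree μ W x * w x = (t : ℝ≥0∞)⁻¹ := fun x hx => by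
    rw [hw]
    simp only
    rw [ENNReal.mul_inv (Or.inl ht0) (Or.inl htT), mul_left_comm,
      ENNReal.mul_inv_cancel (hd0 x hx) (hdeg x hx).2, mul_one]
  have e1 : (t : ℝ≥0∞) ^ 2 * ∫⁻ x, lDegree μ W x * D.indicator w x ∂μ = t * μ D := by
    have : ∀ x, lDegree μ W x * D.indicator w x = D.indicator (fun _ => (t : ℝ≥0∞)⁻¹) x := by
      intro x
      by_cases hx : x ∈ D <;> simp [hx, hwd x]
    simp_rw [this]
    rw [lintegral_indicator_const hD, sq, mul_assoc, ← mul_assoc _ (t : ℝ≥0∞)⁻¹,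
      ENNReal.mul_inv_cancel ht0 htT, one_mul]
  have e2 : (t : ℝ≥0∞) ^ 2 * ∫⁻ x, lDegree μ W x * D.indicator (fun x => w x ^ 2) x ∂μ ≤
      ε⁻¹ * μ D := by
    have : ∀ x, lDegree μ W x * D.indicator (fun x => w x ^ 2) x ≤
        D.indicator (fun _ => (t : ℝ≥0∞)⁻¹ * ((t : ℝ≥0∞)⁻¹ * ε⁻¹)) x := by
      intro x
      by_cases hx : x ∈ D
      · simp only [hx, Set.indicator_of_mem]
        rw [sq, ← mul_assoc, hwd x hx]
        gcongr
        rw [hw]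
        simp only
        rw [ENNReal.mul_inv (Or.inl ht0) (Or.inl htT)]
        gcongr
        exact (hdeg x hx).1
      · simp [hx]
    refine (mul_le_mul_right (lintegral_mono this) _).trans (le_of_eq ?_)
    rw [lintegral_indicator_const hD]
    calc (t : ℝ≥0∞) ^ 2 * ((t : ℝ≥0∞)⁻¹ * ((t : ℝ≥0∞)⁻¹ * ε⁻¹) * μ D)
        = (t * (t : ℝ≥0∞)⁻¹) ^ 2 * (ε⁻¹ * μ D) := by ring
      _ = _ := by rw [ENNReal.mul_inv_cancel ht0 htT, one_pow, one_mul]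
  have e3 : (t : ℝ≥0∞) ^ 3 * ∫⁻ x, lDegree μ W x ^ 2 * D.indicator (fun x => w x ^ 2) x ∂μ =
      t * μ D := by
    have : ∀ x, lDegree μ W x ^ 2 * D.indicator (fun x => w x ^ 2) x =
        D.indicator (fun _ => (t : ℝ≥0∞)⁻¹ ^ 2) x := by
      intro x
      by_cases hx : x ∈ D
      · simp only [hx, Set.indicator_of_mem]
        rw [← mul_pow, hwd x hx]
      · simp [hx]
    simp_rw [this]
    rw [lintegral_indicator_const hD]
    calc (t : ℝ≥0∞) ^ 3 * ((t : ℝ≥0∞)⁻¹ ^ 2 * μ D)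
        = (t * (t : ℝ≥0∞)⁻¹) ^ 2 * (t * μ D) := by ring
      _ = _ := by rw [ENNReal.mul_inv_cancel ht0 htT, one_pow, one_mul]
  rw [e1, e3] at hint
  -- All terms of order `t` cancel: the number of points and the pairs of distinct neighbours
  -- contribute `t * μ D` each, the cross term twice that. What remains is the diagonal part of the
  -- squared degrees, bounded uniformly in `t`.
  have hcancel : ∫⁻ ω, ((isolatedIn T X E D t ω).encard : ℝ≥0∞) ∂P + 2 * (t * μ D) ≤
      ε⁻¹ * μ D + 2 * (t * μ D) := by
    refine hint.trans ?_
    calc t * μ D + (_ + t * μ D) ≤ t * μ D + (ε⁻¹ * μ D + t * μ D) := by gcongr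
      _ = _ := by ring
  exact (ENNReal.add_le_add_iff_right
    (ENNReal.mul_ne_top (by simp) (ENNReal.mul_ne_top htT hfin))).1 hcancel

lemma ae_tendsto_isolatedIn (h : IsGraphonSampling μ W P T X E)
    (hsymm : ∀ x y, W x y = W y x) (hW : Measurable (Function.uncurry W)) {D : Set S}
    (hD : MeasurableSet D) (hfin : μ D ≠ ∞) {ε : ℝ≥0∞} (hε : ε ≠ 0)
    (hdeg : ∀ x ∈ D, ε ≤ lDegree μ W x ∧ lDegree μ W x ≠ ∞) {ρ : ℝ≥0} (hρ : 1 < ρ) :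
    ∀ᵐ ω ∂P, Tendsto (fun j : ℕ => ((isolatedIn T X E D (ρ ^ j) ω).encard : ℝ≥0∞) /
      ((ρ ^ j : ℝ≥0) : ℝ≥0∞)) atTop (𝓝 0) := by
  have hm : ∀ j : ℕ, Measurable fun ω => ((isolatedIn T X E D (ρ ^ j) ω).encard : ℝ≥0∞) /
      ((ρ ^ j : ℝ≥0) : ℝ≥0∞) := fun j => (measurable_encard_isolatedIn h hD _).div_const _
  have hsum : ∀ᵐ ω ∂P, ∑' j : ℕ, ((isolatedIn T X E D (ρ ^ j) ω).encard : ℝ≥0∞) /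
      ((ρ ^ j : ℝ≥0) : ℝ≥0∞) < ∞ := by
    refine ae_lt_top (Measurable.tsum hm) ?_
    rw [lintegral_tsum fun j => (hm j).aemeasurable]
    refine ne_top_of_le_ne_top (b := (1 - (ρ : ℝ≥0∞)⁻¹)⁻¹ * (ε⁻¹ * μ D)) ?_ ?_
    · exact ENNReal.mul_ne_top (inv_one_sub_inv_ne_top (by exact_mod_cast hρ))
        (ENNReal.mul_ne_top (ENNReal.inv_ne_top.2 hε) hfin)
    · rw [← ENNReal.tsum_geometric, ← ENNReal.tsum_mul_right]
      refine ENNReal.tsum_le_tsum fun j => ?_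
      simp_rw [div_eq_mul_inv]
      rw [lintegral_mul_const _ (measurable_encard_isolatedIn h hD _), mul_comm]
      push_cast
      rw [ENNReal.inv_pow]
      gcongr
      exact lintegral_encard_isolatedIn_le h hsymm hW hD hfin hε hdeg
        (pow_ne_zero _ (zero_lt_one.trans hρ).ne')
  filter_upwards [hsum] with ω hω
  exact ENNReal.tendsto_atTop_zero_of_tsum_ne_top hω.ne

/-- Almost surely the points where the degree function vanishes are isolated. -/
lemma ae_nonIsolated_subset (h : IsGraphonSampling μ W P T X E)
    (hsymm : ∀ x y, W x y = W y x) (hW : Measurable (Function.uncurry W)) :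
    ∀ᵐ ω ∂P, ∀ t, ∀ i ∈ nonIsolated T E t ω, lDegree μ W (X i ω) ≠ 0 := by
  classical
  have hD : MeasurableSet {x | lDegree μ W x = 0} :=
    measurable_lDegree hW (measurableSet_singleton 0)
  have hg : Measurable ({x | lDegree μ W x = 0}.indicator fun _ => (1 : ℝ≥0∞)) :=
    measurable_const.indicator hD
  have hev2 : ∀ (t : ℝ≥0) (θ : Fin 2 ↪ ℕ), MeasurableSet
      (bornBy T t θ ∩ adjEvent E {((0 : Fin 2), (1 : Fin 2))} θ) := fun t θ =>
    (measurableSet_bornBy h.measurable_T t θ).inter (measurableSet_adjEvent h.measurable_adj _ _)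
  have key : ∀ n : ℕ, ∀ᵐ ω ∂P, ∀ i ∈ nonIsolated T E n ω, lDegree μ W (X i ω) ≠ 0 := by
    intro n
    have h1 := lintegral_tsum_fin_two h hsymm hW n hg
    have h2 : ∀ x, lDegree μ W x * {x | lDegree μ W x = 0}.indicator (fun _ => (1 : ℝ≥0∞)) x = 0 := by
      intro x
      by_cases hx : lDegree μ W x = 0 <;> simp [hx]
    simp_rw [h2] at h1
    have hm : Measurable fun ω => ∑' θ : Fin 2 ↪ ℕ,
        (bornBy T n θ ∩ adjEvent E {((0 : Fin 2), (1 : Fin 2))} θ).indicator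
          (fun ω => {x | lDegree μ W x = 0}.indicator (fun _ => (1 : ℝ≥0∞)) (X (θ 0) ω)) ω :=
      Measurable.tsum fun θ => (hg.comp (h.measurable_X (θ 0))).indicator (hev2 n θ)
    rw [lintegral_zero, mul_zero, lintegral_eq_zero_iff hm] at h1
    filter_upwards [h1] with ω hω i hi h0
    rw [Pi.zero_apply, tsum_fin_two, ENNReal.tsum_eq_zero] at hω
    have := hω i
    rw [if_pos hi.1, Set.indicator_of_mem (show X i ω ∈ {x | lDegree μ W x = 0} from h0), one_mul]
      at this
    obtain ⟨j, hj⟩ := hi.2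
    have h3 : (nbrs T E n ω i).encard = 0 := by simpa using this
    rw [Set.encard_eq_zero] at h3
    exact (h3 ▸ hj : j ∈ (∅ : Set ℕ)).elim
  filter_upwards [ae_all_iff.2 key] with ω hω t i hi
  obtain ⟨n, hn⟩ := exists_nat_ge t
  obtain ⟨j, hj⟩ := hi.2
  exact hω n i ⟨hi.1.trans hn, j, hj.1.trans hn, hj.2⟩

lemma nonIsolated_mono (ω : Ω) : Monotone fun t => nonIsolated T E t ω := by
  rintro s t hst i ⟨hi, j, hj⟩
  exact ⟨hi.trans hst, j, hj.1.trans hst, hj.2⟩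

/-- The law of large numbers for the number of non-isolated points. -/
theorem ae_tendsto_nonIsolated [IsProbabilityMeasure P] (h : IsGraphonSampling μ W P T X E)
    (hsymm : ∀ x y, W x y = W y x) (hW : Measurable (Function.uncurry W))
    (hdeg : ∀ᵐ x ∂μ, lDegree μ W x ≠ ∞) :
    ∀ᵐ ω ∂P, Tendsto (fun t : ℝ≥0 => ((nonIsolated T E t ω).encard : ℝ≥0∞) / t) atTop
      (𝓝 (μ {x | lDegree μ W x ≠ 0})) := by
  have hdm := measurable_lDegree (μ := μ) hW
  -- Finite measure and degrees bounded away from zero are what the bound on isolated points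
  -- requires; these sets exhaust `{lDegree ≠ 0}` up to a null set.
  let D : ℕ → Set S := fun m =>
    spanningSets μ m ∩ {x | ((m : ℝ≥0∞) + 1)⁻¹ ≤ lDegree μ W x} ∩ {x | lDegree μ W x ≠ ∞}
  have hD : ∀ m, MeasurableSet (D m) := fun m =>
    ((measurableSet_spanningSets μ m).inter (hdm measurableSet_Ici)).inter
      (hdm (measurableSet_singleton _).compl)
  have hDfin : ∀ m, μ (D m) ≠ ∞ := fun m => ne_top_of_le_ne_top
    (measure_spanningSets_lt_top μ m).ne (measure_mono fun x hx => hx.1.1)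
  have hDmono : Monotone D := by
    intro m n hmn x hx
    refine ⟨⟨monotone_spanningSets μ hmn hx.1.1, ?_⟩, hx.2⟩
    have h1 : ((m : ℝ≥0∞) + 1)⁻¹ ≤ lDegree μ W x := hx.1.2
    refine le_trans (b := ((m : ℝ≥0∞) + 1)⁻¹) ?_ h1
    gcongr
  have hDU : ⋃ m, D m = {x | lDegree μ W x ≠ 0} ∩ {x | lDegree μ W x ≠ ∞} := by
    ext x
    simp only [mem_iUnion]
    constructor
    · rintro ⟨m, hm⟩
      refine ⟨fun h0 => ?_, hm.2⟩
      have := hm.1.2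
      rw [mem_ofPred_eq, h0, le_zero_iff, ENNReal.inv_eq_zero] at this
      exact ENNReal.add_ne_top.2 ⟨ENNReal.natCast_ne_top m, ENNReal.one_ne_top⟩ this
    · rintro ⟨h0, hT⟩
      obtain ⟨n, hn⟩ := ENNReal.exists_inv_nat_lt h0
      refine ⟨max n (spanningSetsIndex μ x), ⟨mem_spanningSets_of_index_le μ x (le_max_right _ _),
        le_trans ?_ hn.le⟩, hT⟩
      rw [ENNReal.inv_le_inv]
      refine le_trans ?_ le_self_add
      exact_mod_cast le_max_left _ _
  have hDlim : Tendsto (fun m => μ (D m)) atTop (𝓝 (μ {x | lDegree μ W x ≠ 0})) := by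
    have h1 := tendsto_measure_iUnion_atTop (μ := μ) hDmono
    rw [hDU, measure_inter_conull (mem_ae_iff.1 hdeg)] at h1
    exact h1
  have hρ1 : ∀ n : ℕ, (1 : ℝ≥0) < 1 + 1 / ((n : ℝ≥0) + 1) := fun n => by
    have : (0 : ℝ≥0) < 1 / ((n : ℝ≥0) + 1) := by positivity
    exact lt_add_of_pos_right _ this
  have hiso : ∀ᵐ ω ∂P, ∀ n m : ℕ, Tendsto (fun j : ℕ =>
      ((isolatedIn T X E (D m) ((1 + 1 / ((n : ℝ≥0) + 1)) ^ j) ω).encard : ℝ≥0∞) /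
      (((1 + 1 / ((n : ℝ≥0) + 1)) ^ j : ℝ≥0) : ℝ≥0∞)) atTop (𝓝 0) :=
    ae_all_iff.2 fun n => ae_all_iff.2 fun m =>
      ae_tendsto_isolatedIn h hsymm hW (hD m) (hDfin m)
        (ENNReal.inv_ne_zero.2 (ENNReal.add_ne_top.2 ⟨ENNReal.natCast_ne_top m, ENNReal.one_ne_top⟩))
        (fun x hx => ⟨hx.1.2, hx.2⟩) (hρ1 n)
  have hpts : ∀ᵐ ω ∂P, ∀ m : ℕ, Tendsto (fun t : ℝ≥0 => pointCount T X (D m) t ω / t) atTop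
      (𝓝 (μ (D m))) := ae_all_iff.2 fun m => ae_tendsto_pointCount h.poisson (hD m) (hDfin m)
  -- If this measure is infinite, no upper bound is needed.
  have hup : ∀ᵐ ω ∂P, μ {x | lDegree μ W x ≠ 0} ≠ ∞ → Tendsto (fun t : ℝ≥0 =>
      pointCount T X {x | lDegree μ W x ≠ 0} t ω / t) atTop (𝓝 (μ {x | lDegree μ W x ≠ 0})) := by
    by_cases hfin : μ {x | lDegree μ W x ≠ 0} = ∞
    · exact Eventually.of_forall fun ω h => absurd hfin h
    · filter_upwards [ae_tendsto_pointCount h.poisson (hdm (measurableSet_singleton 0).compl) hfin]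
        with ω hω _ using hω
  filter_upwards [hiso, hpts, hup, ae_nonIsolated_subset h hsymm hW] with ω hω1 hω2 hω3 hω4
  suffices hk : ∀ n : ℕ, Tendsto (fun j : ℕ =>
      ((nonIsolated T E ((1 + 1 / ((n : ℝ≥0) + 1)) ^ j) ω).encard : ℝ≥0∞) /
      (((1 + 1 / ((n : ℝ≥0) + 1)) ^ j : ℝ≥0) : ℝ≥0∞) ^ 1) atTop
      (𝓝 (μ {x | lDegree μ W x ≠ 0})) by
    have := tendsto_div_pow_of_geometric (N := fun t => ((nonIsolated T E t ω).encard : ℝ≥0∞))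
      (fun s t hst => ENat.toENNReal_le.2 (Set.encard_le_encard (nonIsolated_mono ω hst))) hk
    simpa using this
  intro n
  simp_rw [pow_one]
  have hlim : Tendsto (fun j : ℕ => (1 + 1 / ((n : ℝ≥0) + 1)) ^ j) atTop atTop :=
    tendsto_pow_atTop_atTop_of_one_lt (hρ1 n)
  rw [tendsto_order]
  constructor
  · intro a ha
    obtain ⟨m, hm⟩ := (hDlim.eventually (lt_mem_nhds ha)).exists
    have h1 := ENNReal.Tendsto.sub ((hω2 m).comp hlim) (hω1 n m) (Or.inr ENNReal.zero_ne_top)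
    rw [tsub_zero] at h1
    filter_upwards [h1.eventually (lt_mem_nhds hm)] with j hj
    refine hj.trans_le (tsub_le_iff_right.2 ?_)
    rw [Function.comp_apply, ← ENNReal.add_div]
    gcongr
    rw [pointCount, countIn, ← ENat.toENNReal_add]
    refine ENat.toENNReal_le.2 (le_trans (Set.encard_le_encard ?_) (Set.encard_union_le _ _))
    intro i hi
    by_cases hne : (nbrs T E ((1 + 1 / ((n : ℝ≥0) + 1)) ^ j) ω i).Nonempty
    · exact Or.inl ⟨hi.1, hne⟩
    · exact Or.inr ⟨hi.1, hi.2, Set.not_nonempty_iff_eq_empty.1 hne⟩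
  · intro b hb
    have h1 := (hω3 hb.ne_top).comp hlim
    filter_upwards [h1.eventually (gt_mem_nhds hb)] with j hj
    refine lt_of_le_of_lt ?_ hj
    rw [Function.comp_apply]
    gcongr
    refine ENat.toENNReal_le.2 (Set.encard_le_encard fun i hi => ?_)
    exact ⟨hi.1, hω4 _ i hi⟩

end NonIsolatedLimit

/-! ### Counting homomorphisms -/

section Counting

variable {V V' ι : Type*}

/-- The homomorphisms from `F` to `G`, as maps. -/
def homSet (F : SimpleGraph ι) (G : SimpleGraph V) : Set (ι → V) :=
  {f | ∀ a b, F.Adj a b → G.Adj (f a) (f b)}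

/-- The injective homomorphisms from `F` to `G`, as embeddings. -/
def injSet (F : SimpleGraph ι) (G : SimpleGraph V) : Set (ι ↪ V) :=
  {f | ∀ a b, F.Adj a b → G.Adj (f a) (f b)}

lemma card_hom (F : SimpleGraph ι) (G : SimpleGraph V) :
    ENat.card (F →g G) = (homSet F G).encard :=
  ENat.card_congr
    { toFun f := ⟨f, fun _ _ h => f.map_rel h⟩
      invFun f := ⟨f.1, fun h => f.2 _ _ h⟩
      left_inv _ := rfl
      right_inv _ := rfl }

lemma card_inj (F : SimpleGraph ι) (G : SimpleGraph V) :
    ENat.card {f : F →g G // Function.Injective f} = (injSet F G).encard :=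
  ENat.card_congr
    { toFun f := ⟨⟨f.1, f.2⟩, fun _ _ h => f.1.map_rel h⟩
      invFun f := ⟨⟨f.1, fun h => f.2 _ _ h⟩, f.1.injective⟩
      left_inv _ := rfl
      right_inv _ := rfl }

lemma encard_injSet_congr (F : SimpleGraph ι) {G : SimpleGraph V} {H : SimpleGraph V'}
    (e : G ≃g H) : (injSet F G).encard = (injSet F H).encard := by
  refine ENat.card_congr
    { toFun f := ⟨f.1.trans e.toEquiv.toEmbedding, fun a b h => ?_⟩
      invFun f := ⟨f.1.trans e.symm.toEquiv.toEmbedding, fun a b h => ?_⟩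
      left_inv f := ?_
      right_inv f := ?_ }
  · exact e.map_rel_iff.2 (f.2 _ _ h)
  · exact e.symm.map_rel_iff.2 (f.2 _ _ h)
  · ext; simp
  · ext; simp

lemma injSet_mono (F : SimpleGraph ι) {G H : SimpleGraph V} (h : G ≤ H) :
    injSet F G ⊆ injSet F H := fun _ hf a b hab => h (hf a b hab)

/-- As every vertex of `F` has a neighbour, its image is an endpoint of an edge and automatically a
vertex of `G`. Counts may therefore be made on the fixed vertex type `V`, and isolated vertices of
`G` do not matter. -/
lemma encard_homSet_coe {F : SimpleGraph ι} (hF : ∀ a, ∃ b, F.Adj a b) {G₀ : SimpleGraph V}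
    (G : G₀.Subgraph) : (homSet F G.coe).encard = (homSet F G.spanningCoe).encard := by
  refine ENat.card_congr
    { toFun f := ⟨fun a => f.1 a, fun a b h => f.2 _ _ h⟩
      invFun f := ⟨fun a => ⟨f.1 a, ?_⟩, fun a b h => f.2 _ _ h⟩
      left_inv _ := rfl
      right_inv _ := rfl }
  obtain ⟨b, hb⟩ := hF a
  exact G.edge_vert (f.2 _ _ hb)

lemma encard_injSet_coe {F : SimpleGraph ι} (hF : ∀ a, ∃ b, F.Adj a b) {G₀ : SimpleGraph V}
    (G : G₀.Subgraph) : (injSet F G.coe).encard = (injSet F G.spanningCoe).encard := by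
  refine ENat.card_congr
    { toFun f := ⟨f.1.trans (Function.Embedding.subtype _), fun a b h => f.2 _ _ h⟩
      invFun f := ⟨⟨fun a => ⟨f.1 a, ?_⟩, fun a b h => f.1.injective (congrArg Subtype.val h)⟩,
        fun a b h => f.2 _ _ h⟩
      left_inv _ := rfl
      right_inv _ := rfl }
  obtain ⟨b, hb⟩ := hF a
  exact G.edge_vert (f.2 _ _ hb)

/-- Twice the number of edges is the number of ordered pairs of adjacent vertices. -/
lemma two_mul_encard_edgeSet (G : SimpleGraph V) :
    2 * G.edgeSet.encard = {p : V × V | G.Adj p.1 p.2}.encard := by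
  classical
  let _ : LinearOrder V := linearOrderOfSTO WellOrderingRel
  have h1 : {p : V × V | G.Adj p.1 p.2} =
      {p : V × V | G.Adj p.1 p.2 ∧ p.1 < p.2} ∪ {p : V × V | G.Adj p.1 p.2 ∧ p.2 < p.1} := by
    ext p
    simp only [mem_union, mem_ofPred_eq]
    constructor
    · intro h
      rcases lt_or_gt_of_ne h.ne with h' | h'
      · exact Or.inl ⟨h, h'⟩
      · exact Or.inr ⟨h, h'⟩
    · rintro (h | h) <;> exact h.1
  have h2 : (fun p : V × V => s(p.1, p.2)) '' {p : V × V | G.Adj p.1 p.2 ∧ p.1 < p.2} =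
      G.edgeSet := by
    ext e
    constructor
    · rintro ⟨p, hp, rfl⟩
      exact hp.1
    · induction e with
      | _ a b =>
        intro h
        rcases lt_or_gt_of_ne (G.ne_of_adj h) with h' | h'
        · exact ⟨(a, b), ⟨h, h'⟩, rfl⟩
        · exact ⟨(b, a), ⟨SimpleGraph.Adj.symm h, h'⟩, Sym2.eq_swap⟩
  have h3 : (fun p : V × V => s(p.1, p.2)) '' {p : V × V | G.Adj p.1 p.2 ∧ p.2 < p.1} =
      G.edgeSet := by
    rw [← h2]
    ext e
    constructor
    · rintro ⟨p, hp, rfl⟩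
      exact ⟨p.swap, ⟨hp.1.symm, hp.2⟩, Sym2.eq_swap⟩
    · rintro ⟨p, hp, rfl⟩
      exact ⟨p.swap, ⟨hp.1.symm, hp.2⟩, Sym2.eq_swap⟩
  have hinj : ∀ R : V → V → Prop, (∀ a b, R a b → ¬ R b a) →
      InjOn (fun p : V × V => s(p.1, p.2)) {p : V × V | G.Adj p.1 p.2 ∧ R p.1 p.2} := by
    rintro R hR ⟨a, b⟩ hp ⟨c, d⟩ hq h
    simp only [Sym2.eq_iff] at h
    rcases h with h | h
    · exact Prod.ext h.1 h.2
    · have h1 : R a b := hp.2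
      have h2 : R c d := hq.2
      rw [h.1, h.2] at h1
      exact absurd h2 (hR _ _ h1)
  rw [h1, Set.encard_union_eq]
  · rw [← (hinj (fun a b => a < b) fun a b h => h.asymm).encard_image,
      ← (hinj (fun a b => b < a) fun a b h => h.asymm).encard_image, h2, h3, two_mul]
  · rw [Set.disjoint_left]
    rintro p h h'
    exact h.2.asymm h'.2

lemma encard_injSet_top (G : SimpleGraph V) :
    (injSet (⊤ : SimpleGraph (Fin 2)) G).encard = 2 * G.edgeSet.encard := by
  rw [two_mul_encard_edgeSet]
  refine ENat.card_congr
    { toFun f := ⟨(f.1 0, f.1 1), f.2 _ _ (by simp)⟩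
      invFun p := ⟨⟨![p.1.1, p.1.2], ?_⟩, ?_⟩
      left_inv f := ?_
      right_inv p := ?_ }
  · have := p.2.ne
    intro a b
    fin_cases a <;> fin_cases b <;> simp [this, this.symm]
  · intro a b
    have h1 : G.Adj p.1.1 p.1.2 := p.2
    fin_cases a <;> fin_cases b <;> simp
    · exact h1
    · exact h1.symm
  · ext a
    fin_cases a <;> rfl
  · rfl

lemma encard_homSet_two {F : SimpleGraph (Fin 2)} (hF : F.Adj 0 1) (G : SimpleGraph V) :
    (homSet F G).encard = 2 * G.edgeSet.encard := by
  rw [two_mul_encard_edgeSet]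
  refine ENat.card_congr
    { toFun f := ⟨(f.1 0, f.1 1), f.2 _ _ hF⟩
      invFun p := ⟨![p.1.1, p.1.2], ?_⟩
      left_inv f := ?_
      right_inv p := ?_ }
  · intro a b hab
    have h1 : G.Adj p.1.1 p.1.2 := p.2
    fin_cases a <;> fin_cases b <;> simp_all [h1.symm]
  · ext a
    fin_cases a <;> rfl
  · rfl

lemma exists_adj_of_connected [Nontrivial ι] {F : SimpleGraph ι} (hF : F.Connected) (a : ι) :
    ∃ b, F.Adj a b := hF.preconnected.exists_adj_of_nontrivial a

/-- The edges of a graph on `Fin k`, each listed once. -/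
def edgePairs {k : ℕ} (F : SimpleGraph (Fin k)) : Finset (Fin k × Fin k) :=
  open Classical in
  Finset.univ.filter fun p => p.1 < p.2 ∧ F.Adj p.1 p.2

lemma mem_edgePairs {k : ℕ} {F : SimpleGraph (Fin k)} {p : Fin k × Fin k} :
    p ∈ edgePairs F ↔ p.1 < p.2 ∧ F.Adj p.1 p.2 := by simp [edgePairs]

lemma oriented_edgePairs {k : ℕ} (F : SimpleGraph (Fin k)) : Oriented (edgePairs F) := by
  intro p hp
  rw [mem_edgePairs] at hp
  exact ⟨hp.2.ne, fun h => hp.1.asymm (mem_edgePairs.1 h).1⟩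

lemma forall_edgePairs {k : ℕ} {F : SimpleGraph (Fin k)} {R : Fin k → Fin k → Prop}
    (hR : ∀ a b, R a b → R b a) :
    (∀ p ∈ edgePairs F, R p.1 p.2) ↔ ∀ a b, F.Adj a b → R a b := by
  constructor
  · intro h a b hab
    rcases lt_or_gt_of_ne hab.ne with h' | h'
    · exact h (a, b) (mem_edgePairs.2 ⟨h', hab⟩)
    · exact hR _ _ (h (b, a) (mem_edgePairs.2 ⟨h', hab.symm⟩))
  · intro h p hp
    exact h _ _ (mem_edgePairs.1 hp).2

lemma edgePairs_cover {k : ℕ} {F : SimpleGraph (Fin k)} (hF : ∀ a, ∃ b, F.Adj a b) (a : Fin k) :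
    ∃ p ∈ edgePairs F, a = p.1 ∨ a = p.2 := by
  obtain ⟨b, hab⟩ := hF a
  rcases lt_or_gt_of_ne hab.ne with h' | h'
  · exact ⟨(a, b), mem_edgePairs.2 ⟨h', hab⟩, Or.inl rfl⟩
  · exact ⟨(b, a), mem_edgePairs.2 ⟨h', hab.symm⟩, Or.inr rfl⟩

/-- In the snapshot the birth times are recorded in the edges, so a vertex of `F` is forced to be
born by time `t` only if it has a neighbour. -/
lemma copyCount_edgePairs {Ω : Type*} {k : ℕ} {F : SimpleGraph (Fin k)}
    (hF : ∀ a, ∃ b, F.Adj a b) (T : ℕ → Ω → ℝ≥0) (E : Ω → SimpleGraph ℕ) (t : ℝ≥0) (ω : Ω) :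
    copyCount T E (edgePairs F) t ω =
      ((injSet F (snapshot (fun i => T i ω) (E ω) t).spanningCoe).encard : ℝ≥0∞) := by
  rw [encard_eq_tsum_indicator, copyCount]
  refine tsum_congr fun φ => ?_
  refine Set.indicator_eq_indicator ?_ rfl
  have h1 : ω ∈ adjEvent E (edgePairs F) φ ↔ ∀ a b, F.Adj a b → (E ω).Adj (φ a) (φ b) :=
    forall_edgePairs (R := fun a b => (E ω).Adj (φ a) (φ b)) fun a b h => h.symm
  rw [mem_inter_iff, h1]
  constructor
  · rintro ⟨h, h'⟩ a b hab
    exact ⟨h' a b hab, h a, h b⟩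
  · intro h
    refine ⟨fun a => ?_, fun a b hab => (h a b hab).1⟩
    obtain ⟨b, hab⟩ := hF a
    exact (h a b hab).2.1

end Counting

/-! ### Homomorphisms that are not injective -/

section Quotients

variable {V : Type*} {k : ℕ}

/-- The proper colourings of `F` that use all colours, with fewer colours than vertices. -/
abbrev ProperQuotient (F : SimpleGraph (Fin k)) : Type :=
  Σ k' : Fin k, {q : Fin k → Fin k' // Function.Surjective q ∧ ∀ a b, F.Adj a b → q a ≠ q b}

instance (F : SimpleGraph (Fin k)) : Fintype (ProperQuotient F) := Fintype.ofFinite _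

lemma connected_map {F : SimpleGraph (Fin k)} (hF : F.Connected) {k' : ℕ} {q : Fin k → Fin k'}
    (hq : Function.Surjective q) (hq' : ∀ a b, F.Adj a b → q a ≠ q b) : (F.map q).Connected :=
  hF.map (SimpleGraph.Hom.map q F fun h => hq' _ _ h) hq

lemma two_le_of_proper {F : SimpleGraph (Fin k)} (hk : 2 ≤ k) (hF : F.Connected) {k' : ℕ}
    {q : Fin k → Fin k'} (hq' : ∀ a b, F.Adj a b → q a ≠ q b) : 2 ≤ k' := by
  have : Nontrivial (Fin k) := Fin.nontrivial_iff_two_le.2 hk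
  obtain ⟨b, hb⟩ := exists_adj_of_connected hF ⟨0, by omega⟩
  exact Fin.nontrivial_iff_two_le.1 ⟨_, _, hq' _ _ hb⟩

lemma encard_injSet_le_homSet (F : SimpleGraph (Fin k)) (G : SimpleGraph V) :
    (injSet F G).encard ≤ (homSet F G).encard := by
  have hinj : Function.Injective fun f : Fin k ↪ V => (f : Fin k → V) := DFunLike.coe_injective
  rw [← hinj.injOn.encard_image]
  refine Set.encard_le_encard ?_
  rintro _ ⟨f, hf, rfl⟩
  exact hf

/-- Every homomorphism is an injective homomorphism of a quotient. -/
lemma encard_homSet_le (F : SimpleGraph (Fin k)) (G : SimpleGraph V) :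
    (homSet F G).encard ≤
      (injSet F G).encard + ∑ q : ProperQuotient F, (injSet (F.map q.2.1) G).encard := by
  have hsub : homSet F G ⊆ (fun f : Fin k ↪ V => (f : Fin k → V)) '' injSet F G ∪
      ⋃ q : ProperQuotient F, (fun g : Fin q.1 ↪ V => g ∘ q.2.1) '' injSet (F.map q.2.1) G := by
    intro f hf
    by_cases hinj : Function.Injective f
    · exact Or.inl ⟨⟨f, hinj⟩, hf, rfl⟩
    right
    -- Numbering the image of `f` factors `f` as a surjection `q`, which is a proper colouring of
    -- `F`, followed by an injection `g`.
    let e := Finite.equivFin (range f)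
    let q : Fin k → Fin (Nat.card (range f)) := fun a => e ⟨f a, mem_range_self a⟩
    let g : Fin (Nat.card (range f)) ↪ V :=
      e.symm.toEmbedding.trans (Function.Embedding.subtype _)
    have hgq : g ∘ q = f := by
      ext a
      change ((e.symm (e ⟨f a, _⟩) : range f) : V) = f a
      rw [Equiv.symm_apply_apply]
    have hq : Function.Surjective q := by
      intro i
      obtain ⟨a, ha⟩ := (e.symm i).2
      refine ⟨a, ?_⟩
      apply g.injective
      rw [← Function.comp_apply (f := g), hgq, ha]
      rfl
    have hq' : ∀ a b, F.Adj a b → q a ≠ q b := by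
      intro a b hab h
      have := hf a b hab
      rw [← hgq, Function.comp_apply, Function.comp_apply, h] at this
      exact this.ne rfl
    have hlt : Nat.card (range f) < k := by
      by_contra hle
      push Not at hle
      have h1 := Fintype.card_le_of_surjective q hq
      rw [Fintype.card_fin, Fintype.card_fin] at h1
      have h2 : Function.Bijective q := (Fintype.bijective_iff_surjective_and_card q).2
        ⟨hq, by rw [Fintype.card_fin, Fintype.card_fin]; exact le_antisymm hle h1⟩
      exact hinj (hgq ▸ g.injective.comp h2.1)
    refine mem_iUnion.2 ⟨⟨⟨_, hlt⟩, q, hq, hq'⟩, g, ?_, hgq⟩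
    rintro _ _ ⟨-, a, b, hab, rfl, rfl⟩
    have := hf a b hab
    rwa [← hgq] at this
  refine (Set.encard_le_encard hsub).trans ((Set.encard_union_le _ _).trans
    (add_le_add (Set.encard_image_le _ _) ((Set.encard_iUnion_le_of_fintype _).trans ?_)))
  exact Finset.sum_le_sum fun q _ => Set.encard_image_le _ _

/-- If the numbers of injective homomorphisms of connected graphs grow like the powers of `t`, then
so do the numbers of homomorphisms. -/
lemma tendsto_homSet {G : ℝ≥0 → SimpleGraph V} {I : ∀ k : ℕ, SimpleGraph (Fin k) → ℝ≥0∞}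
    (hI : ∀ k : ℕ, 2 ≤ k → ∀ F : SimpleGraph (Fin k), F.Connected → I k F ≠ ∞)
    (h : ∀ k : ℕ, 2 ≤ k → ∀ F : SimpleGraph (Fin k), F.Connected →
      Tendsto (fun t => ((injSet F (G t)).encard : ℝ≥0∞) / (t : ℝ≥0∞) ^ k) atTop (𝓝 (I k F)))
    (hk : 2 ≤ k) (F : SimpleGraph (Fin k)) (hF : F.Connected) :
    Tendsto (fun t => ((homSet F (G t)).encard : ℝ≥0∞) / (t : ℝ≥0∞) ^ k) atTop (𝓝 (I k F)) := by
  have hinv : Tendsto (fun t : ℝ≥0 => (t : ℝ≥0∞)⁻¹) atTop (𝓝 0) := by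
    have : Tendsto (fun t : ℝ≥0 => (t : ℝ≥0∞)) atTop (𝓝 ∞) := ENNReal.tendsto_coe_nhds_top.2 tendsto_id
    simpa using tendsto_inv_iff.2 this
  have hq : ∀ q : ProperQuotient F, Tendsto (fun t =>
      ((injSet (F.map q.2.1) (G t)).encard : ℝ≥0∞) / (t : ℝ≥0∞) ^ k) atTop (𝓝 0) := by
    intro q
    have h2 := two_le_of_proper hk hF q.2.2.2
    have hc := connected_map hF q.2.2.1 q.2.2.2
    have h1 := h q.1 h2 (F.map q.2.1) hc
    -- A quotient has `q.1 < k` vertices and hence about `t ^ q.1` copies, with a finite constant by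
    -- `hI`; the missing power of `t` sends its share to zero.
    have h3 : Tendsto (fun t : ℝ≥0 => (t : ℝ≥0∞)⁻¹ ^ (k - q.1)) atTop (𝓝 0) := by
      have := ENNReal.Tendsto.pow (n := k - q.1) hinv
      rwa [zero_pow (Nat.sub_ne_zero_of_lt q.1.2)] at this
    have h4 := ENNReal.Tendsto.mul h1 (Or.inr ENNReal.zero_ne_top) h3 (Or.inr (hI _ h2 _ hc))
    rw [mul_zero] at h4
    refine h4.congr fun t => ?_
    rw [div_eq_mul_inv, div_eq_mul_inv, ENNReal.inv_pow, ENNReal.inv_pow, mul_assoc, ← pow_add,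
      Nat.add_sub_cancel' q.1.2.le]
  have hup := (h k hk F hF).add (tendsto_finsetSum Finset.univ fun q _ => hq q)
  rw [Finset.sum_const_zero, add_zero] at hup
  refine tendsto_of_tendsto_of_tendsto_of_le_of_le (h k hk F hF) hup (fun t => ?_) fun t => ?_
  · exact ENNReal.div_le_div_right (ENat.toENNReal_le.2 (encard_injSet_le_homSet F (G t))) _
  · simp only [div_eq_mul_inv, ← Finset.sum_mul, ← add_mul]
    refine mul_le_mul_left ?_ _
    have := ENat.toENNReal_le.2 (encard_homSet_le F (G t))
    refine this.trans (le_of_eq ?_)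
    rw [ENat.toENNReal_add]
    congr 1
    exact map_sum ENat.toENNRealRingHom _ _

end Quotients

/-! ### Finiteness of the densities -/

section Finiteness

/-- A vertex `u` at maximal distance from `v` can be removed: a shortest walk from `v` to another
vertex cannot pass through `u`, as its part up to `u` would be shorter than the distance to `u`. -/
lemma exists_ne_connected_comap {n : ℕ} {F : SimpleGraph (Fin (n + 2))} (hF : F.Connected)
    (v : Fin (n + 2)) : ∃ u, u ≠ v ∧ (F.comap u.succAbove).Connected := by
  obtain ⟨u, -, hu⟩ := Finset.exists_max_image Finset.univ (fun u => F.dist v u) ⟨v, Finset.mem_univ _⟩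
  have huv : u ≠ v := by
    rintro rfl
    obtain ⟨w, hw⟩ := exists_ne u
    have := hu w (Finset.mem_univ _)
    rw [SimpleGraph.dist_self, Nat.le_zero] at this
    exact hw (hF.dist_eq_zero_iff.1 this).symm
  refine ⟨u, huv, ?_⟩
  have hc : (F.induce {x | x ≠ u}).Connected := by
    rw [SimpleGraph.connected_iff_exists_forall_reachable]
    refine ⟨⟨v, huv.symm⟩, fun ⟨w, hw⟩ => ?_⟩
    obtain ⟨p, hp⟩ := hF.exists_walk_length_eq_dist v w
    have hsup : ∀ x ∈ p.support, x ∈ {x | x ≠ u} := by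
      rintro x hx rfl
      have h1 := SimpleGraph.Walk.length_takeUntil_lt_length hx (Ne.symm hw)
      have h2 := SimpleGraph.dist_le (p.takeUntil _ hx)
      have h3 := hu w (Finset.mem_univ _)
      omega
    exact ⟨p.induce _ hsup⟩
  have e : F.comap u.succAbove ≃g F.induce {x | x ≠ u} :=
    { finSuccAboveEquiv u with map_rel_iff' := Iff.rfl }
  exact e.connected_iff.2 hc

variable {S : Type*} [MeasurableSpace S] {μ : Measure S} [SigmaFinite μ] {W : S → S → ℝ}

/-- Since `W ≤ 1`, all edges at `u` except the one to `p` can be dropped. Only one factor then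
depends on the position of `u`, and integrating it out gives a degree. -/
lemma edgeWeight_le_comap (hsymm : ∀ x y, W x y = W y x) (hW1 : ∀ x y, W x y ≤ 1) {n : ℕ}
    (F : SimpleGraph (Fin (n + 1))) {u : Fin (n + 1)} {p : Fin n} (hp : F.Adj (u.succAbove p) u)
    (x : Fin (n + 1) → S) :
    edgeWeight W (edgePairs F) x ≤ edgeWeight W (edgePairs (F.comap u.succAbove))
      (fun i => x (u.succAbove i)) * ENNReal.ofReal (W (x (u.succAbove p)) (x u)) := by
  classical
  let σ : Fin n × Fin n → Fin (n + 1) × Fin (n + 1) := fun r => (u.succAbove r.1, u.succAbove r.2)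
  have hσ : Function.Injective σ := fun a b h => Prod.ext
    (u.succAbove_right_injective (congrArg Prod.fst h))
    (u.succAbove_right_injective (congrArg Prod.snd h))
  obtain ⟨r, hr, hrw, hru⟩ : ∃ r ∈ edgePairs F,
      W (x r.1) (x r.2) = W (x (u.succAbove p)) (x u) ∧ (r.1 = u ∨ r.2 = u) := by
    rcases lt_or_gt_of_ne hp.ne with h' | h'
    · exact ⟨(u.succAbove p, u), mem_edgePairs.2 ⟨h', hp⟩, rfl, Or.inr rfl⟩
    · exact ⟨(u, u.succAbove p), mem_edgePairs.2 ⟨h', hp.symm⟩, hsymm _ _, Or.inl rfl⟩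
  have hnot : r ∉ (edgePairs (F.comap u.succAbove)).image σ := by
    intro h
    obtain ⟨s, -, rfl⟩ := Finset.mem_image.1 h
    rcases hru with h | h <;> exact u.succAbove_ne _ h
  have hsub : insert r ((edgePairs (F.comap u.succAbove)).image σ) ⊆ edgePairs F := by
    intro s hs
    rcases Finset.mem_insert.1 hs with rfl | hs
    · exact hr
    · obtain ⟨s, hs', rfl⟩ := Finset.mem_image.1 hs
      rw [mem_edgePairs] at hs' ⊢
      exact ⟨u.strictMono_succAbove hs'.1, hs'.2⟩
  refine (Finset.prod_le_prod_of_subset_of_le_one' hsub fun i _ _ =>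
    ENNReal.ofReal_le_one.2 (hW1 _ _)).trans (le_of_eq ?_)
  rw [Finset.prod_insert hnot, Finset.prod_image hσ.injOn, hrw, mul_comm]
  rfl

lemma mul_pow_le_add_pow (a b : ℝ≥0∞) (m : ℕ) : a * b ^ m ≤ a ^ (m + 1) + b ^ (m + 1) := by
  rcases le_total a b with h | h
  · calc a * b ^ m ≤ b * b ^ m := by gcongr
      _ = b ^ (m + 1) := by ring
      _ ≤ _ := le_add_self
  · calc a * b ^ m ≤ a * a ^ m := by gcongr
      _ = a ^ (m + 1) := by ring
      _ ≤ _ := le_self_add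

/-- Induction on the number of vertices: integrating out a removable vertex `u ≠ v` attached to `p`
produces the degree at `p`, and `a * b ^ m ≤ a ^ (m + 1) + b ^ (m + 1)` moves both degree factors to
one marked vertex. Carrying the power `m` makes the induction close. The single vertex with `m = 0`
is excluded, as its integral is `μ univ`. -/
lemma lintegral_edgeWeight_mul_pow_ne_top (hsymm : ∀ x y, W x y = W y x)
    (hW : Measurable (Function.uncurry W)) (hW1 : ∀ x y, W x y ≤ 1)
    (hD : ∀ m : ℕ, 1 ≤ m → ∫⁻ x, lDegree μ W x ^ m ∂μ ≠ ∞) :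
    ∀ (n : ℕ) (F : SimpleGraph (Fin (n + 1))), F.Connected → ∀ (v : Fin (n + 1)) (m : ℕ),
      1 ≤ m ∨ 1 ≤ n → ∫⁻ x, edgeWeight W (edgePairs F) x * lDegree μ W (x v) ^ m
        ∂(Measure.pi fun _ => μ) ≠ ∞ := by
  have hdm := measurable_lDegree (μ := μ) hW
  intro n
  induction n with
  | zero =>
    intro F _ v m hm
    have hm : 1 ≤ m := by omega
    refine ne_top_of_le_ne_top (hD m hm) ?_
    calc ∫⁻ x, edgeWeight W (edgePairs F) x * lDegree μ W (x v) ^ m ∂(Measure.pi fun _ => μ)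
        ≤ ∫⁻ x : Fin 1 → S, lDegree μ W (x v) ^ m ∂(Measure.pi fun _ => μ) := by
          refine lintegral_mono fun x => ?_
          exact mul_le_of_le_one_left' (edgeWeight_le_one hW1 _ _)
      _ = _ := by
          have := (measurePreserving_funUnique μ (Fin 1)).lintegral_comp (hdm.pow_const m)
          rw [← this]
          refine lintegral_congr fun x => ?_
          rw [show v = (default : Fin 1) from Subsingleton.elim (α := Fin 1) _ _]
          rfl
  | succ n ih =>
    intro F hF v m _
    obtain ⟨u, huv, hc⟩ := exists_ne_connected_comap hF v
    obtain ⟨v', rfl⟩ := Fin.exists_succAbove_eq huv.symm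
    obtain ⟨w, hw⟩ := exists_adj_of_connected hF u
    obtain ⟨p, rfl⟩ := Fin.exists_succAbove_eq hw.ne.symm
    have hfin : ∀ z, ∫⁻ x, edgeWeight W (edgePairs (F.comap u.succAbove)) x *
        lDegree μ W (x z) ^ (m + 1) ∂(Measure.pi fun _ => μ) ≠ ∞ := fun z =>
      ih _ hc z (m + 1) (Or.inl (by omega))
    refine ne_top_of_le_ne_top (ENNReal.add_ne_top.2 ⟨hfin p, hfin v'⟩) ?_
    have hwm := measurable_edgeWeight hW (edgePairs (F.comap u.succAbove))
    have hwm' := measurable_edgeWeight hW (edgePairs F)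
    have hmz : ∀ z, Measurable fun x : Fin (n + 1) → S =>
        edgeWeight W (edgePairs (F.comap u.succAbove)) x * lDegree μ W (x z) ^ (m + 1) := fun z =>
      hwm.mul ((hdm.comp (measurable_pi_apply z)).pow_const _)
    rw [← lintegral_add_left (hmz p)]
    have hmp := (measurePreserving_piFinSuccAbove (fun _ : Fin (n + 2) => μ) u).symm
    have hmf : Measurable fun x : Fin (n + 2) → S =>
        edgeWeight W (edgePairs F) x * lDegree μ W (x (u.succAbove v')) ^ m :=
      hwm'.mul ((hdm.comp (measurable_pi_apply _)).pow_const _)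
    rw [← hmp.lintegral_comp hmf]
    have hmg : Measurable fun a : S × (Fin (n + 1) → S) => edgeWeight W (edgePairs F)
        ((MeasurableEquiv.piFinSuccAbove (fun _ => S) u).symm a) * lDegree μ W
          ((MeasurableEquiv.piFinSuccAbove (fun _ => S) u).symm a (u.succAbove v')) ^ m :=
      hmf.comp (MeasurableEquiv.measurable _)
    rw [lintegral_prod_symm _ hmg.aemeasurable]
    refine lintegral_mono fun y => ?_
    calc _ ≤ ∫⁻ z, edgeWeight W (edgePairs (F.comap u.succAbove)) y *
            lDegree μ W (y v') ^ m * ENNReal.ofReal (W (y p) z) ∂μ := by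
          refine lintegral_mono fun z => ?_
          have h1 := edgeWeight_le_comap hsymm hW1 F hw.symm
            ((MeasurableEquiv.piFinSuccAbove (fun _ => S) u).symm (z, y))
          have h2 : ∀ i, (MeasurableEquiv.piFinSuccAbove (fun _ : Fin (n + 2) => S) u).symm (z, y)
              (u.succAbove i) = y i := fun i =>
            Fin.insertNth_apply_succAbove (α := fun _ => S) u z y i
          have h3 : (MeasurableEquiv.piFinSuccAbove (fun _ : Fin (n + 2) => S) u).symm (z, y) u =
              z := Fin.insertNth_apply_same (α := fun _ => S) u z y
          simp only [h2, h3] at h1 ⊢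
          rw [mul_right_comm]
          exact mul_le_mul_left h1 _
      _ = edgeWeight W (edgePairs (F.comap u.succAbove)) y *
            (lDegree μ W (y p) * lDegree μ W (y v') ^ m) := by
          have hmy : Measurable fun z => ENNReal.ofReal (W (y p) z) :=
            ENNReal.measurable_ofReal.comp (hW.comp measurable_prodMk_left)
          rw [lintegral_const_mul _ hmy, mul_assoc, mul_comm (lDegree μ W (y v') ^ m)]
          rfl
      _ ≤ _ := by
          rw [← mul_add]
          gcongr
          exact mul_pow_le_add_pow _ _ _

lemma lintegral_edgeWeight_ne_top (hsymm : ∀ x y, W x y = W y x)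
    (hW : Measurable (Function.uncurry W)) (hW1 : ∀ x y, W x y ≤ 1)
    (hD : ∀ m : ℕ, 1 ≤ m → ∫⁻ x, lDegree μ W x ^ m ∂μ ≠ ∞) {k : ℕ} (hk : 2 ≤ k)
    (F : SimpleGraph (Fin k)) (hF : F.Connected) :
    ∫⁻ x, edgeWeight W (edgePairs F) x ∂(Measure.pi fun _ => μ) ≠ ∞ := by
  obtain ⟨n, rfl⟩ : ∃ n, k = n + 2 := ⟨k - 2, by omega⟩
  simpa using lintegral_edgeWeight_mul_pow_ne_top hsymm hW hW1 hD (n + 1) F hF 0 0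
    (Or.inr (by omega))

lemma lDegree_ae_eq (h : IsGraphon μ W) (hW0 : ∀ x y, 0 ≤ W x y) :
    ∀ᵐ x ∂μ, lDegree μ W x = ‖degreeFun μ W x‖ₑ := by
  filter_upwards [h.integrable.prod_right_ae] with x hx
  have h1 := ofReal_integral_eq_lintegral_ofReal hx (Eventually.of_forall fun y => hW0 x y)
  have h2 : 0 ≤ degreeFun μ W x := integral_nonneg fun y => hW0 x y
  rw [Real.enorm_of_nonneg h2]
  exact h1.symm

lemma lintegral_lDegree_pow_ne_top (h : IsGraphon μ W) (hW0 : ∀ x y, 0 ≤ W x y)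
    (hp : ∀ p : ℝ≥0∞, 1 ≤ p → p ≠ ∞ → MemLp (degreeFun μ W) p μ) (m : ℕ) (hm : 1 ≤ m) :
    ∫⁻ x, lDegree μ W x ^ m ∂μ ≠ ∞ := by
  have h1 := (hp m (by exact_mod_cast hm) (ENNReal.natCast_ne_top m)).2
  rw [eLpNorm_lt_top_iff_lintegral_rpow_enorm_lt_top (by positivity) (ENNReal.natCast_ne_top m)]
    at h1
  refine ne_of_lt (lt_of_eq_of_lt (lintegral_congr_ae ?_) h1)
  filter_upwards [lDegree_ae_eq h hW0] with x hx
  rw [hx, ENNReal.toReal_natCast, ENNReal.rpow_natCast]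

end Finiteness

/-! ### Labeled graphs: measurability, relabeling and monotonicity -/

section Labeled

lemma continuous_code : Continuous LabeledGraph.code := continuous_induced_dom

lemma continuous_mem_verts (i : ℕ) :
    Continuous fun G : LabeledGraph => (LabeledGraph.code G).1 i :=
  (continuous_apply i).comp (continuous_fst.comp continuous_code)

lemma continuous_adj (i j : ℕ) :
    Continuous fun G : LabeledGraph => (LabeledGraph.code G).2 i j :=
  (continuous_apply j).comp ((continuous_apply i).comp (continuous_snd.comp continuous_code))

lemma isClopen_mem_verts (i : ℕ) : IsClopen {G : LabeledGraph | i ∈ G.verts} := by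
  have : {G : LabeledGraph | i ∈ G.verts} =
      (fun G : LabeledGraph => (LabeledGraph.code G).1 i) ⁻¹' {true} := by
    ext G
    simp [LabeledGraph.code]
  rw [this]
  exact (isClopen_discrete {true}).preimage (continuous_mem_verts i)

lemma isClopen_adj (i j : ℕ) : IsClopen {G : LabeledGraph | G.Adj i j} := by
  have : {G : LabeledGraph | G.Adj i j} =
      (fun G : LabeledGraph => (LabeledGraph.code G).2 i j) ⁻¹' {true} := by
    ext G
    simp [LabeledGraph.code]
  rw [this]
  exact (isClopen_discrete {true}).preimage (continuous_adj i j)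

lemma measurable_encard_verts : Measurable fun G : LabeledGraph => (G.verts.encard : ℝ≥0∞) := by
  simp_rw [encard_eq_tsum_indicator]
  exact Measurable.tsum fun i => (measurable_const.indicator (f := fun _ => (1 : ℝ≥0∞))
    (isClopen_mem_verts i).isOpen.measurableSet)

lemma measurable_encard_injSet {k : ℕ} (F : SimpleGraph (Fin k)) :
    Measurable fun G : LabeledGraph => ((injSet F G.spanningCoe).encard : ℝ≥0∞) := by
  simp_rw [encard_eq_tsum_indicator]
  refine Measurable.tsum fun φ => ?_
  have : MeasurableSet {G : LabeledGraph | ∀ a b, F.Adj a b → G.Adj (φ a) (φ b)} := by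
    simp only [Set.ofPred_forall]
    exact MeasurableSet.iInter fun a => MeasurableSet.iInter fun b => MeasurableSet.iInter fun _ =>
      (isClopen_adj _ _).isOpen.measurableSet
  exact measurable_const.indicator (f := fun _ => (1 : ℝ≥0∞)) this

lemma spanningCoe_mono {G H : LabeledGraph} (h : G ≤ H) : G.spanningCoe ≤ H.spanningCoe :=
  fun _ _ hab => h.2 hab

lemma removeIsolated_mono : Monotone LabeledGraph.removeIsolated := by
  intro G H h
  exact ⟨fun i ⟨j, hj⟩ => ⟨j, h.2 hj⟩, h.2⟩

lemma snapshot_mono (T : ℕ → ℝ≥0) (E : SimpleGraph ℕ) : Monotone (snapshot T E) := by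
  intro s t hst
  exact ⟨fun i hi => le_trans hi hst, fun i j h => ⟨h.1, h.2.1.trans hst, h.2.2.trans hst⟩⟩

/-- One bijection serves all times, so inclusions between two times can be carried back. -/
lemma EqualUpToRelabeling.monotone {G H : ℝ≥0 → LabeledGraph} (h : EqualUpToRelabeling G H)
    (hH : Monotone H) : Monotone G := by
  obtain ⟨φ, hφ, hGH⟩ := h
  intro s t hst
  constructor
  · intro i hi
    have h1 : φ i ∈ (H t).verts := (hH hst).1 ((hGH s).1 ▸ mem_image_of_mem φ hi)
    rw [← (hGH t).1] at h1
    obtain ⟨j, hj, hij⟩ := h1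
    rwa [← hφ.injOn (mem_iUnion.2 ⟨t, hj⟩) (mem_iUnion.2 ⟨s, hi⟩) hij]
  · intro i j hij
    have hi : i ∈ ⋃ s, (G s).verts := mem_iUnion.2 ⟨s, (G s).edge_vert hij⟩
    have hj : j ∈ ⋃ s, (G s).verts := mem_iUnion.2 ⟨s, (G s).edge_vert hij.symm⟩
    exact ((hGH t).2 i hi j hj).2 ((hH hst).2 (((hGH s).2 i hi j hj).1 hij))

lemma EqualUpToRelabeling.nonempty_iso {G H : ℝ≥0 → LabeledGraph}
    (h : EqualUpToRelabeling G H) (t : ℝ≥0) : Nonempty ((G t).coe ≃g (H t).coe) := by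
  obtain ⟨φ, hφ, hGH⟩ := h
  have hb : BijOn φ (G t).verts (H t).verts :=
    (hGH t).1 ▸ (hφ.injOn.mono (subset_iUnion (fun t => (G t).verts) t)).bijOn_image
  refine ⟨{ hb.equiv φ with map_rel_iff' := ?_ }⟩
  intro a b
  exact ((hGH t).2 a (mem_iUnion.2 ⟨t, a.2⟩) b (mem_iUnion.2 ⟨t, b.2⟩)).symm

end Labeled

/-! ### Transfer of almost sure limits between processes with the same law -/

section Transfer

variable {Ω Ω' : Type*} [MeasurableSpace Ω] [MeasurableSpace Ω'] {P : Measure Ω} {P' : Measure Ω'}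
  {G : ℝ≥0 → Ω → LabeledGraph} {G' : ℝ≥0 → Ω' → LabeledGraph}

/-- The presence of a vertex or an edge is a clopen condition. If it held at `s` and failed at a
later `t`, right continuity would give points of `D` just after `s` and just after `t` with the same
behaviour. -/
lemma monotone_of_rightContinuous {g : ℝ≥0 → LabeledGraph}
    (hg : ∀ t, ContinuousWithinAt g (Ici t) t) {D : Set ℝ≥0} (hD : Dense D)
    (h : ∀ s ∈ D, ∀ t ∈ D, s ≤ t → g s ≤ g t) : Monotone g := by
  have key : ∀ C : Set LabeledGraph, IsClopen C → (∀ s ∈ D, ∀ t ∈ D, s ≤ t → g s ∈ C → g t ∈ C) →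
      ∀ s t, s ≤ t → g s ∈ C → g t ∈ C := by
    intro C hC hCD s t hst hs
    by_contra ht
    rcases hst.eq_or_lt with rfl | hst
    · exact ht hs
    have h1 : ∀ᶠ x in 𝓝[Ici s] s, g x ∈ C := hg s (hC.isOpen.mem_nhds hs)
    have h2 : ∀ᶠ x in 𝓝[Ici t] t, g x ∉ C := hg t (hC.compl.isOpen.mem_nhds ht)
    obtain ⟨u, hu, hu'⟩ := (mem_nhdsGE_iff_exists_Ico_subset' hst).1 h1
    obtain ⟨v, hv, hv'⟩ := (mem_nhdsGE_iff_exists_Ico_subset' (lt_add_one t)).1 h2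
    obtain ⟨x, hxD, hx⟩ := hD.exists_between (lt_min (mem_Ioi.1 hu) hst)
    obtain ⟨y, hyD, hy⟩ := hD.exists_between (mem_Ioi.1 hv)
    have hxC : g x ∈ C := hu' ⟨hx.1.le, hx.2.trans_le (min_le_left _ _)⟩
    have hyC : g y ∉ C := hv' ⟨hy.1.le, hy.2⟩
    exact hyC (hCD x hxD y hyD ((hx.2.trans_le (min_le_right _ _)).le.trans hy.1.le) hxC)
  intro s t hst
  exact ⟨fun i hi => key _ (isClopen_mem_verts i)
      (fun s hs t ht hst hi => (h s hs t ht hst).1 hi) s t hst hi,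
    fun i j hij => key _ (isClopen_adj i j)
      (fun s hs t ht hst hi => (h s hs t ht hst).2 hi) s t hst hij⟩

lemma measurableSet_le_eval (s t : ℝ≥0) :
    MeasurableSet {g : ℝ≥0 → LabeledGraph | g s ≤ g t} := by
  have : {g : ℝ≥0 → LabeledGraph | g s ≤ g t} =
      (⋂ i, {g | g s ∈ {G : LabeledGraph | i ∈ G.verts}}ᶜ ∪
        {g | g t ∈ {G : LabeledGraph | i ∈ G.verts}}) ∩
      (⋂ i, ⋂ j, {g | g s ∈ {G : LabeledGraph | G.Adj i j}}ᶜ ∪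
        {g | g t ∈ {G : LabeledGraph | G.Adj i j}}) := by
    ext g
    simp only [mem_inter_iff, mem_iInter, mem_union, mem_compl_iff, mem_ofPred_eq, ← imp_iff_not_or]
    exact Iff.rfl
  rw [this]
  have hv : ∀ (s : ℝ≥0) (i : ℕ), MeasurableSet
      {g : ℝ≥0 → LabeledGraph | g s ∈ {G : LabeledGraph | i ∈ G.verts}} := fun s i =>
    measurable_pi_apply s (isClopen_mem_verts i).isOpen.measurableSet
  have he : ∀ (s : ℝ≥0) (i j : ℕ), MeasurableSet
      {g : ℝ≥0 → LabeledGraph | g s ∈ {G : LabeledGraph | G.Adj i j}} := fun s i j =>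
    measurable_pi_apply s (isClopen_adj i j).isOpen.measurableSet
  exact (MeasurableSet.iInter fun i => (hv s i).compl.union (hv t i)).inter
    (MeasurableSet.iInter fun i => MeasurableSet.iInter fun j => (he s i j).compl.union (he t i j))

/-- Monotonicity along a countable dense set of times is an event in the product σ-algebra, so it
depends on the law only; right continuity of the paths extends it to all times. -/
lemma ae_monotone_of_identDistrib (hG : IsGraphProcess P G)
    (hid : IdentDistrib (fun ω t => G t ω) (fun ω t => G' t ω) P P')
    (hmono : ∀ᵐ ω ∂P', Monotone fun t => G' t ω) : ∀ᵐ ω ∂P, Monotone fun t => G t ω := by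
  let d := TopologicalSpace.denseSeq ℝ≥0
  have hm : MeasurableSet {g : ℝ≥0 → LabeledGraph | ∀ m n, d m ≤ d n → g (d m) ≤ g (d n)} := by
    simp only [Set.ofPred_forall]
    exact MeasurableSet.iInter fun m => MeasurableSet.iInter fun n => MeasurableSet.iInter fun _ =>
      measurableSet_le_eval _ _
  have h1 := hid.symm.ae_snd hm (by
    filter_upwards [hmono] with ω hω m n hmn using hω hmn)
  filter_upwards [h1, hG.right_continuous] with ω hω hr
  refine monotone_of_rightContinuous hr (TopologicalSpace.denseRange_denseSeq ℝ≥0) ?_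
  rintro _ ⟨m, rfl⟩ _ ⟨n, rfl⟩ hmn
  exact hω m n hmn

/-- Convergence along all real times need not be measurable in the product σ-algebra, but
convergence along integer times is. It transfers with the law, and monotonicity recovers the other
times. -/
lemma ae_tendsto_of_identDistrib (hG : IsGraphProcess P G)
    (hid : IdentDistrib (fun ω t => G t ω) (fun ω t => G' t ω) P P')
    (hmono : ∀ᵐ ω ∂P', Monotone fun t => G' t ω) {c : LabeledGraph → ℝ≥0∞} (hc : Measurable c)
    (hcm : Monotone c) {k : ℕ} {I : ℝ≥0∞}
    (h : ∀ᵐ ω ∂P', Tendsto (fun t : ℝ≥0 => c (G' t ω) / (t : ℝ≥0∞) ^ k) atTop (𝓝 I)) :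
    ∀ᵐ ω ∂P, Tendsto (fun t : ℝ≥0 => c (G t ω) / (t : ℝ≥0∞) ^ k) atTop (𝓝 I) := by
  have hm : MeasurableSet {g : ℝ≥0 → LabeledGraph |
      Tendsto (fun n : ℕ => c (g n) / (n : ℝ≥0∞) ^ k) atTop (𝓝 I)} :=
    measurableSet_tendsto (𝓝 I) fun n =>
      (hc.comp (measurable_pi_apply (n : ℝ≥0))).div_const _
  have h1 := hid.symm.ae_snd hm (by
    filter_upwards [h] with ω hω
    have := hω.comp (tendsto_natCast_atTop_atTop (R := ℝ≥0))
    refine this.congr fun n => ?_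
    simp)
  filter_upwards [h1, ae_monotone_of_identDistrib hG hid hmono] with ω hω hmω
  exact tendsto_div_pow_of_nat (N := fun t => c (G t ω)) (fun s t hst => hcm (hmω hst)) hω

end Transfer

/-! ### Limits of the densities of graphon processes -/

section DensityLimits

variable {S : Type*} [MeasurableSpace S] {μ : Measure S} {W : S → S → ℝ}

/-- The numbers of injective homomorphisms of connected graphs and of vertices in a family of
labeled graphs have the growth of those in a graphon process, with `ν t` vertices at time `t`. -/
structure CountLimits (μ : Measure S) (W : S → S → ℝ) (ν : ℝ≥0∞) (G : ℝ≥0 → LabeledGraph) :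
    Prop where
  inj : ∀ k : ℕ, 2 ≤ k → ∀ F : SimpleGraph (Fin k), F.Connected →
    Tendsto (fun t : ℝ≥0 => ((injSet F (G t).spanningCoe).encard : ℝ≥0∞) / (t : ℝ≥0∞) ^ k) atTop
      (𝓝 (∫⁻ x, edgeWeight W (edgePairs F) x ∂(Measure.pi fun _ => μ)))
  verts : Tendsto (fun t : ℝ≥0 => ((G t).verts.encard : ℝ≥0∞) / t) atTop (𝓝 ν)

lemma graphonDensity_eq {k : ℕ} (F : SimpleGraph (Fin k)) :
    graphonDensity F μ W =
      (∫⁻ x, edgeWeight W (edgePairs F) x ∂(Measure.pi fun _ => μ)) / l1Norm μ W ^ ((k : ℝ) / 2) :=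
  rfl

lemma lintegral_edgeWeight_two [SigmaFinite μ] (hW : Measurable (Function.uncurry W))
    (hW0 : ∀ x y, 0 ≤ W x y) :
    ∫⁻ x, edgeWeight W (edgePairs (⊤ : SimpleGraph (Fin 2))) x ∂(Measure.pi fun _ => μ) =
      l1Norm μ W := by
  have h1 : edgePairs (⊤ : SimpleGraph (Fin 2)) = {(0, 1)} := by
    ext ⟨a, b⟩
    rw [mem_edgePairs]
    fin_cases a <;> fin_cases b <;> simp
  have h2 := (measurePreserving_piFinTwo (fun _ : Fin 2 => μ)).lintegral_comp
    (f := fun p : S × S => ENNReal.ofReal (W p.1 p.2)) (ENNReal.measurable_ofReal.comp hW)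
  rw [l1Norm, h1]
  simp only [edgeWeight, Finset.prod_singleton]
  refine Eq.trans h2 (lintegral_congr fun p => ?_)
  rw [Real.enorm_of_nonneg (hW0 _ _)]

lemma l1Norm_ne_top (h : IsGraphon μ W) : l1Norm μ W ≠ ∞ := h.integrable.2.ne

lemma top_connected_fin_two : (⊤ : SimpleGraph (Fin 2)).Connected := SimpleGraph.connected_top

lemma exists_adj_of_two_le {k : ℕ} (hk : 2 ≤ k) {F : SimpleGraph (Fin k)} (hF : F.Connected)
    (a : Fin k) : ∃ b, F.Adj a b := by
  have : Nontrivial (Fin k) := Fin.nontrivial_iff_two_le.2 hk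
  exact exists_adj_of_connected hF a

lemma two_mul_encard_edgeSet_coe (G : LabeledGraph) : (2 : ℝ≥0∞) * (G.coe.edgeSet.encard : ℝ≥0∞) =
    ((injSet (⊤ : SimpleGraph (Fin 2)) G.spanningCoe).encard : ℝ≥0∞) := by
  rw [← encard_injSet_coe (exists_adj_of_two_le le_rfl top_connected_fin_two), encard_injSet_top,
    ENat.toENNReal_mul]
  rfl

lemma injDensity_coe {k : ℕ} (hk : 2 ≤ k) {F : SimpleGraph (Fin k)} (hF : F.Connected)
    (G : LabeledGraph) : injDensity F G.coe = ((injSet F G.spanningCoe).encard : ℝ≥0∞) /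
      ((injSet (⊤ : SimpleGraph (Fin 2)) G.spanningCoe).encard : ℝ≥0∞) ^ ((k : ℝ) / 2) := by
  rw [injDensity, two_mul_encard_edgeSet_coe, card_inj, encard_injSet_coe (exists_adj_of_two_le hk hF)]

lemma homDensity_coe {k : ℕ} (hk : 2 ≤ k) {F : SimpleGraph (Fin k)} (hF : F.Connected)
    (G : LabeledGraph) : homDensity F G.coe = ((homSet F G.spanningCoe).encard : ℝ≥0∞) /
      ((injSet (⊤ : SimpleGraph (Fin 2)) G.spanningCoe).encard : ℝ≥0∞) ^ ((k : ℝ) / 2) := by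
  rw [homDensity, two_mul_encard_edgeSet_coe, card_hom, encard_homSet_coe (exists_adj_of_two_le hk hF)]

lemma div_div_div_cancel_ennreal (a b : ℝ≥0∞) {c : ℝ≥0∞} (h0 : c ≠ 0) (hT : c ≠ ∞) :
    a / c / (b / c) = a / b := by
  rw [div_eq_mul_inv a c, div_eq_mul_inv b c, ENNReal.mul_div_mul_right _ _
    (ENNReal.inv_ne_zero.2 hT) (ENNReal.inv_ne_top.2 h0)]

/-- If `n / t ^ k` and `e / t ^ 2` converge, then so does `n / e ^ (k / 2)`. -/
lemma tendsto_div_rpow {n e : ℝ≥0 → ℝ≥0∞} {k : ℕ} {I L : ℝ≥0∞} (hL0 : L ≠ 0) (hLT : L ≠ ∞)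
    (hn : Tendsto (fun t : ℝ≥0 => n t / (t : ℝ≥0∞) ^ k) atTop (𝓝 I))
    (he : Tendsto (fun t : ℝ≥0 => e t / (t : ℝ≥0∞) ^ 2) atTop (𝓝 L)) :
    Tendsto (fun t => n t / e t ^ ((k : ℝ) / 2)) atTop (𝓝 (I / L ^ ((k : ℝ) / 2))) := by
  have hk : (0 : ℝ) ≤ (k : ℝ) / 2 := by positivity
  have h1 := ENNReal.Tendsto.div hn
    (Or.inr (by simp [ENNReal.rpow_eq_zero_iff, hL0, hLT] : L ^ ((k : ℝ) / 2) ≠ 0))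
    (he.ennrpow_const ((k : ℝ) / 2)) (Or.inl (ENNReal.rpow_ne_top_of_nonneg hk hLT))
  refine h1.congr' ?_
  filter_upwards [eventually_gt_atTop 0] with t ht
  have h2 : ((t : ℝ≥0∞) ^ 2) ^ ((k : ℝ) / 2) = (t : ℝ≥0∞) ^ k := by
    rw [← ENNReal.rpow_natCast, ← ENNReal.rpow_mul, ← ENNReal.rpow_natCast]
    congr 1
    push_cast
    ring
  rw [ENNReal.div_rpow_of_nonneg _ _ hk, h2, div_div_div_cancel_ennreal]
  · exact pow_ne_zero _ (by exact_mod_cast ht.ne')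
  · exact ENNReal.pow_ne_top ENNReal.coe_ne_top

section

variable [SigmaFinite μ] {ν : ℝ≥0∞} {G : ℝ≥0 → LabeledGraph}

lemma CountLimits.edges (h : CountLimits μ W ν G) (hW : Measurable (Function.uncurry W))
    (hW0 : ∀ x y, 0 ≤ W x y) :
    Tendsto (fun t : ℝ≥0 => ((injSet (⊤ : SimpleGraph (Fin 2)) (G t).spanningCoe).encard : ℝ≥0∞) /
      (t : ℝ≥0∞) ^ 2) atTop (𝓝 (l1Norm μ W)) := by
  rw [← lintegral_edgeWeight_two hW hW0]
  exact h.inj 2 le_rfl ⊤ top_connected_fin_two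

lemma CountLimits.injDensity (h : CountLimits μ W ν G) (hg : IsGraphon μ W)
    (hW0 : ∀ x y, 0 ≤ W x y) (hL : l1Norm μ W ≠ 0) {k : ℕ} (hk : 2 ≤ k) (F : SimpleGraph (Fin k))
    (hF : F.Connected) :
    Tendsto (fun t => injDensity F (G t).coe) atTop (𝓝 (graphonDensity F μ W)) := by
  simp_rw [injDensity_coe hk hF, graphonDensity_eq]
  exact tendsto_div_rpow hL (l1Norm_ne_top hg) (h.inj k hk F hF) (h.edges hg.measurable hW0)

lemma CountLimits.homDensity (h : CountLimits μ W ν G) (hg : IsGraphon μ W)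
    (hW0 : ∀ x y, 0 ≤ W x y) (hL : l1Norm μ W ≠ 0)
    (hI : ∀ k : ℕ, 2 ≤ k → ∀ F : SimpleGraph (Fin k), F.Connected →
      ∫⁻ x, edgeWeight W (edgePairs F) x ∂(Measure.pi fun _ => μ) ≠ ∞)
    {k : ℕ} (hk : 2 ≤ k) (F : SimpleGraph (Fin k)) (hF : F.Connected) :
    Tendsto (fun t => homDensity F (G t).coe) atTop (𝓝 (graphonDensity F μ W)) := by
  simp_rw [homDensity_coe hk hF, graphonDensity_eq]
  exact tendsto_div_rpow hL (l1Norm_ne_top hg) (tendsto_homSet hI h.inj hk F hF)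
    (h.edges hg.measurable hW0)

lemma graphonDensity_ne_top (hL : l1Norm μ W ≠ 0) {k : ℕ} (F : SimpleGraph (Fin k))
    (hI : ∫⁻ x, edgeWeight W (edgePairs F) x ∂(Measure.pi fun _ => μ) ≠ ∞) (hT : l1Norm μ W ≠ ∞) :
    graphonDensity F μ W ≠ ∞ := by
  rw [graphonDensity_eq]
  exact ENNReal.div_ne_top hI (by simp [ENNReal.rpow_eq_zero_iff, hL, hT])

/-- The edge density tends to `‖W‖₁ / ν ^ 2`, which is finite as `ν ≠ 0`; the case `ν = ∞` is
allowed and gives density zero. -/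
lemma CountLimits.leftConvergent (h : CountLimits μ W ν G) (hg : IsGraphon μ W)
    (hW0 : ∀ x y, 0 ≤ W x y) (hL : l1Norm μ W ≠ 0) (hν : ν ≠ 0)
    (hI : ∀ k : ℕ, 2 ≤ k → ∀ F : SimpleGraph (Fin k), F.Connected →
      ∫⁻ x, edgeWeight W (edgePairs F) x ∂(Measure.pi fun _ => μ) ≠ ∞) :
    LeftConvergent atTop fun t => (G t).coe where
  edges_nonempty := by
    filter_upwards [(h.edges hg.measurable hW0).eventually_ne hL] with t ht
    by_contra hne
    rw [Set.not_nonempty_iff_eq_empty] at hne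
    rw [← two_mul_encard_edgeSet_coe, hne] at ht
    simp at ht
  edgeDensity_tendsto := by
    have hT := l1Norm_ne_top hg
    have h1 : Tendsto (fun t => edgeDensity (G t).coe) atTop (𝓝 (l1Norm μ W / ν ^ 2)) := by
      have h2 := ENNReal.Tendsto.div (h.edges hg.measurable hW0) (Or.inl hL)
        (ENNReal.Tendsto.pow (n := 2) h.verts) (Or.inr hT)
      refine h2.congr' ?_
      filter_upwards [eventually_gt_atTop 0] with t ht
      have ht0 : (t : ℝ≥0∞) ≠ 0 := by exact_mod_cast ht.ne'
      rw [edgeDensity, two_mul_encard_edgeSet_coe, div_eq_mul_inv _ (t : ℝ≥0∞), mul_pow,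
        ← ENNReal.inv_pow, ← div_eq_mul_inv (_ ^ 2), div_div_div_cancel_ennreal]
      · rfl
      · exact pow_ne_zero _ ht0
      · exact ENNReal.pow_ne_top ENNReal.coe_ne_top
    refine ⟨(l1Norm μ W / ν ^ 2).toNNReal, ?_⟩
    rwa [ENNReal.coe_toNNReal (ENNReal.div_ne_top hT (pow_ne_zero _ hν))]
  homDensity_tendsto := by
    intro k hk F hF
    refine ⟨(graphonDensity F μ W).toNNReal, ?_⟩
    rw [ENNReal.coe_toNNReal (graphonDensity_ne_top hL F (hI k hk F hF) (l1Norm_ne_top hg))]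
    exact h.homDensity hg hW0 hL hI hk F hF

end

end DensityLimits

/-! ### Graphon processes -/

section GraphonProcesses

variable {S : Type u} [MeasurableSpace S] {μ : Measure S} [SigmaFinite μ] {W : S → S → ℝ}
  {Ω : Type v} [MeasurableSpace Ω] {P : Measure Ω} {G : ℝ≥0 → Ω → LabeledGraph}

/-- Here `H` stands for the snapshots with or without their isolated vertices. Both have the same
edges, hence the same counts of connected graphs; only the growth `ν` of the vertex number differs.
-/
lemma ae_countLimits {Ω' : Type*} [MeasurableSpace Ω'] {P' : Measure Ω'} [IsProbabilityMeasure P']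
    {G' H : ℝ≥0 → Ω' → LabeledGraph} {T : ℕ → Ω' → ℝ≥0} {X : ℕ → Ω' → S} {E : Ω' → SimpleGraph ℕ}
    (hg : IsGraphon μ W) (hW1 : ∀ x y, W x y ≤ 1)
    (hG : IsGraphProcess P G) (hs : IsGraphonSampling μ W P' T X E)
    (hid : IdentDistrib (fun ω t => G t ω) (fun ω t => G' t ω) P P')
    (hGH : ∀ᵐ ω ∂P', EqualUpToRelabeling (fun t => G' t ω) fun t => H t ω)
    (hH : ∀ ω, Monotone fun t => H t ω)
    (hHs : ∀ ω t, (H t ω).spanningCoe = (snapshot (fun i => T i ω) (E ω) t).spanningCoe) {ν : ℝ≥0∞}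
    (hν : ∀ᵐ ω ∂P', Tendsto (fun t : ℝ≥0 => ((H t ω).verts.encard : ℝ≥0∞) / t) atTop (𝓝 ν)) :
    ∀ᵐ ω ∂P, CountLimits μ W ν fun t => G t ω := by
  have hmono : ∀ᵐ ω ∂P', Monotone fun t => G' t ω := by
    filter_upwards [hGH] with ω hω using hω.monotone (hH ω)
  have h1 : ∀ᵐ ω ∂P, Tendsto (fun t : ℝ≥0 => ((G t ω).verts.encard : ℝ≥0∞) / (t : ℝ≥0∞) ^ 1)
      atTop (𝓝 ν) := by
    refine ae_tendsto_of_identDistrib hG hid hmono measurable_encard_verts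
      (fun A B h => ENat.toENNReal_le.2 (Set.encard_le_encard h.1)) ?_
    filter_upwards [hν, hGH] with ω hω hGHω
    refine hω.congr fun t => ?_
    obtain ⟨e⟩ := hGHω.nonempty_iso t
    rw [pow_one, Set.encard, Set.encard, ENat.card_congr e.toEquiv]
  have h2 : ∀ᵐ ω ∂P, ∀ (k : ℕ) (F : SimpleGraph (Fin k)), 2 ≤ k → F.Connected →
      Tendsto (fun t : ℝ≥0 => ((injSet F (G t ω).spanningCoe).encard : ℝ≥0∞) / (t : ℝ≥0∞) ^ k) atTop
      (𝓝 (∫⁻ x, edgeWeight W (edgePairs F) x ∂(Measure.pi fun _ => μ))) := by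
    refine ae_all_iff.2 fun k => ae_all_iff.2 fun F => ?_
    by_cases hk : 2 ≤ k
    swap
    · exact Eventually.of_forall fun ω h => absurd h hk
    by_cases hF : F.Connected
    swap
    · exact Eventually.of_forall fun ω _ h => absurd h hF
    have hadj := exists_adj_of_two_le hk hF
    have h3 := ae_tendsto_of_identDistrib hG hid hmono (measurable_encard_injSet F)
      (fun A B h => ENat.toENNReal_le.2 (Set.encard_le_encard (injSet_mono F (spanningCoe_mono h))))
      (k := k) (I := ∫⁻ x, edgeWeight W (edgePairs F) x ∂(Measure.pi fun _ => μ)) (by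
        filter_upwards [ae_tendsto_copyCount hs hg.symm hg.measurable hW1 (oriented_edgePairs F)
          (edgePairs_cover hadj), hGH] with ω hω hGHω
        rw [Fintype.card_fin] at hω
        refine hω.congr fun t => ?_
        obtain ⟨e⟩ := hGHω.nonempty_iso t
        rw [copyCount_edgePairs hadj, ← hHs, ← encard_injSet_coe hadj,
          ← encard_injSet_congr F e, encard_injSet_coe hadj])
    filter_upwards [h3] with ω hω _ _ using hω
  filter_upwards [h1, h2] with ω hω1 hω2
  exact ⟨fun k hk F hF => hω2 k F hk hF, by simpa using hω1⟩

lemma ae_lDegree_ne_top (hg : IsGraphon μ W) (hW0 : ∀ x y, 0 ≤ W x y) :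
    ∀ᵐ x ∂μ, lDegree μ W x ≠ ∞ := by
  filter_upwards [lDegree_ae_eq hg hW0] with x hx
  rw [hx]
  exact enorm_ne_top

lemma ae_countLimits_withoutIsolated (hg : IsGraphon μ W) (hW : ∀ x y, W x y ∈ Icc (0 : ℝ) 1)
    (h : IsGraphonProcessWithoutIsolated μ W P G) :
    ∀ᵐ ω ∂P, CountLimits μ W (μ {x | lDegree μ W x ≠ 0}) fun t => G t ω := by
  obtain ⟨hG, Ω', _, P', G', T, X, E, _, hs, hid, hGH⟩ := h
  refine ae_countLimits hg (fun x y => (hW x y).2) hG hs hid hGH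
    (fun ω s t hst => removeIsolated_mono (snapshot_mono _ _ hst)) (fun ω t => rfl) ?_
  filter_upwards [ae_tendsto_nonIsolated hs hg.symm hg.measurable
    (ae_lDegree_ne_top hg fun x y => (hW x y).1)] with ω hω
  refine hω.congr fun t => ?_
  have : (snapshot (fun i => T i ω) (E ω) t).removeIsolated.verts = nonIsolated T E t ω := by
    ext i
    constructor
    · rintro ⟨j, hj⟩
      exact ⟨hj.2.1, j, hj.2.2, hj.1⟩
    · rintro ⟨hi, j, hj⟩
      exact ⟨j, hj.2, hi, hj.1⟩
  rw [this]

lemma ae_countLimits_withIsolated (hg : IsGraphon μ W) (hW : ∀ x y, W x y ∈ Icc (0 : ℝ) 1)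
    (hμ : μ univ ≠ ∞) (h : IsGraphonProcessWithIsolated μ W P G) :
    ∀ᵐ ω ∂P, CountLimits μ W (μ univ) fun t => G t ω := by
  obtain ⟨hG, Ω', _, P', G', T, X, E, _, hs, hid, hGH⟩ := h
  refine ae_countLimits hg (fun x y => (hW x y).2) hG hs hid hGH
    (fun ω s t hst => snapshot_mono _ _ hst) (fun ω t => rfl) ?_
  filter_upwards [ae_tendsto_pointCount hs.poisson MeasurableSet.univ hμ] with ω hω
  refine hω.congr fun t => ?_
  have : {i | (T i ω, X i ω) ∈ Iic t ×ˢ (univ : Set S)} =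
      (snapshot (fun i => T i ω) (E ω) t).verts := by
    ext i
    simp [snapshot]
  rw [pointCount, countIn, this]

/-- If almost all degrees vanished, Fubini would give `‖W‖₁ = 0`. This makes `ν ≠ 0` for the process
without isolated vertices. -/
lemma measure_lDegree_ne_zero (hg : IsGraphon μ W) (hW0 : ∀ x y, 0 ≤ W x y)
    (hL : l1Norm μ W ≠ 0) : μ {x | lDegree μ W x ≠ 0} ≠ 0 := by
  intro h0
  apply hL
  have hm : Measurable fun p : S × S => ‖W p.1 p.2‖ₑ := hg.measurable.enorm
  rw [l1Norm, lintegral_prod _ hm.aemeasurable]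
  refine (lintegral_eq_zero_iff hm.lintegral_prod_right').2 ?_
  have h1 : ∀ᵐ x ∂μ, lDegree μ W x = 0 := by
    rw [ae_iff]
    exact h0
  filter_upwards [h1] with x hx
  rw [Pi.zero_apply, ← hx]
  exact lintegral_congr fun y => Real.enorm_of_nonneg (hW0 x y)

theorem graphonProcess_densities (hg : IsGraphon μ W) (hW : ∀ x y, W x y ∈ Icc (0 : ℝ) 1)
    (hL : l1Norm μ W ≠ 0) (h : IsGraphonProcess μ W P G) :
    (∀ k : ℕ, 2 ≤ k → ∀ F : SimpleGraph (Fin k), F.Connected →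
      ∀ᵐ ω ∂P, Tendsto (fun t => injDensity F (G t ω).coe) atTop (𝓝 (graphonDensity F μ W))) ∧
    ((∀ p : ℝ≥0∞, 1 ≤ p → p ≠ ∞ → MemLp (degreeFun μ W) p μ) →
      (∀ k : ℕ, 2 ≤ k → ∀ F : SimpleGraph (Fin k), F.Connected →
        graphonDensity F μ W < ∞ ∧
        ∀ᵐ ω ∂P,
          Tendsto (fun t => homDensity F (G t ω).coe) atTop (𝓝 (graphonDensity F μ W)) ∧
          Tendsto (fun t => injDensity F (G t ω).coe) atTop (𝓝 (graphonDensity F μ W))) ∧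
      (∀ᵐ ω ∂P, LeftConvergent atTop fun t => (G t ω).removeIsolated.coe) ∧
      (μ univ < ∞ → IsGraphonProcessWithIsolated μ W P G →
        ∀ᵐ ω ∂P, LeftConvergent atTop fun t => (G t ω).coe)) := by
  have hW0 : ∀ x y, 0 ≤ W x y := fun x y => (hW x y).1
  have hW1 : ∀ x y, W x y ≤ 1 := fun x y => (hW x y).2
  have hlim := ae_countLimits_withoutIsolated hg hW h
  have hinj : ∀ k : ℕ, 2 ≤ k → ∀ F : SimpleGraph (Fin k), F.Connected →
      ∀ᵐ ω ∂P, Tendsto (fun t => injDensity F (G t ω).coe) atTop (𝓝 (graphonDensity F μ W)) := by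
    intro k hk F hF
    filter_upwards [hlim] with ω hω
    refine (hω.injDensity hg hW0 hL hk F hF).congr fun t => ?_
    rw [injDensity_coe hk hF, injDensity_coe hk hF]
    rfl
  refine ⟨hinj, fun hp => ?_⟩
  have hI : ∀ k : ℕ, 2 ≤ k → ∀ F : SimpleGraph (Fin k), F.Connected →
      ∫⁻ x, edgeWeight W (edgePairs F) x ∂(Measure.pi fun _ => μ) ≠ ∞ := fun k hk F hF =>
    lintegral_edgeWeight_ne_top hg.symm hg.measurable hW1
      (lintegral_lDegree_pow_ne_top hg hW0 hp) hk F hF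
  refine ⟨fun k hk F hF => ⟨(graphonDensity_ne_top hL F (hI k hk F hF)
    (l1Norm_ne_top hg)).lt_top, ?_⟩, ?_, fun hμ hiso => ?_⟩
  · filter_upwards [hlim, hinj k hk F hF] with ω hω hω'
    refine ⟨(hω.homDensity hg hW0 hL hI hk F hF).congr fun t => ?_, hω'⟩
    rw [homDensity_coe hk hF, homDensity_coe hk hF]
    rfl
  · filter_upwards [hlim] with ω hω
    exact hω.leftConvergent hg hW0 hL (measure_lDegree_ne_zero hg hW0 hL) hI
  · filter_upwards [ae_countLimits_withIsolated hg hW hμ.ne hiso] with ω hω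
    exact hω.leftConvergent hg hW0 hL hg.pos.ne' hI

end GraphonProcesses

/-! ### Sequences of graphs with bounded degrees -/

section BoundedDegree

variable {V : Type*} [Finite V] {G : SimpleGraph V} {d : ℕ}

/-- Vertices of `F` are placed one at a time: a removable vertex adjacent to a placed one has at
most `d` possible images. Maps into the support are counted so that the single vertex starts the
induction with `G.support.ncard` choices. -/
lemma ncard_homSet_support_le (hd : ∀ x, (G.neighborSet x).ncard ≤ d) :
    ∀ (n : ℕ) (F : SimpleGraph (Fin (n + 1))), F.Connected →
      {f ∈ homSet F G | ∀ a, f a ∈ G.support}.ncard ≤ G.support.ncard * d ^ n := by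
  classical
  have := Fintype.ofFinite V
  intro n
  induction n with
  | zero =>
    intro F _
    rw [pow_zero, mul_one]
    refine Set.ncard_le_ncard_of_injOn (fun f => f 0) (fun f hf => hf.2 0) ?_ (Set.toFinite _)
    intro f _ g _ h
    ext a
    rw [show a = 0 from Subsingleton.elim (α := Fin 1) _ _]
    exact h
  | succ n ih =>
    intro F hF
    obtain ⟨u, -, hc⟩ := exists_ne_connected_comap hF 0
    obtain ⟨w, hw⟩ := exists_adj_of_connected hF u
    obtain ⟨p, rfl⟩ := Fin.exists_succAbove_eq hw.ne.symm
    set A : Set (Fin (n + 2) → V) := {f ∈ homSet F G | ∀ a, f a ∈ G.support} with hA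
    set r : (Fin (n + 2) → V) → (Fin (n + 1) → V) := fun f a => f (u.succAbove a) with hr
    have hfib : ∀ g ∈ A.toFinset.image r, (A.toFinset.filter fun f => r f = g).card ≤ d := by
      intro g _
      refine le_trans ?_ (hd (g p))
      rw [← Set.ncard_coe_finset]
      refine Set.ncard_le_ncard_of_injOn (fun f => f u) ?_ ?_ (Set.toFinite _)
      · intro f hf
        simp only [Finset.coe_filter, mem_toFinset, mem_ofPred_eq] at hf
        have := hf.1.1 _ _ hw.symm
        rw [← hf.2]
        exact this
      · intro f hf f' hf' h
        simp only [Finset.coe_filter, mem_toFinset, mem_ofPred_eq] at hf hf'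
        ext a
        rcases eq_or_ne a u with rfl | ha
        · exact h
        · obtain ⟨b, rfl⟩ := Fin.exists_succAbove_eq ha
          exact congrFun (hf.2.trans hf'.2.symm) b
    have h1 := Finset.card_le_mul_card_image A.toFinset d hfib
    rw [← Set.ncard_eq_toFinset_card'] at h1
    have h2 : (A.toFinset.image r).card ≤ G.support.ncard * d ^ n := by
      refine le_trans ?_ (ih _ hc)
      rw [← Set.ncard_coe_finset]
      refine Set.ncard_le_ncard ?_ (Set.toFinite _)
      intro g hg
      simp only [Finset.coe_image, coe_toFinset] at hg
      obtain ⟨f, hf, rfl⟩ := hg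
      exact ⟨fun a b hab => hf.1 _ _ hab, fun a => hf.2 _⟩
    calc A.ncard ≤ d * (A.toFinset.image r).card := h1
      _ ≤ d * (G.support.ncard * d ^ n) := Nat.mul_le_mul_left _ h2
      _ = _ := by ring

lemma encard_homSet_le_of_degree_le (hd : ∀ x, (G.neighborSet x).ncard ≤ d) {k : ℕ} (hk : 2 ≤ k)
    {F : SimpleGraph (Fin k)} (hF : F.Connected) :
    ((homSet F G).encard : ℝ≥0∞) ≤ (d : ℝ≥0∞) ^ (k - 1) * (G.support.ncard : ℝ≥0∞) := by
  obtain ⟨n, rfl⟩ : ∃ n, k = n + 1 := ⟨k - 1, by omega⟩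
  have h1 := ncard_homSet_support_le hd n F hF
  have h2 : {f ∈ homSet F G | ∀ a, f a ∈ G.support} = homSet F G := by
    refine Set.Subset.antisymm (fun f hf => hf.1) fun f hf => ⟨hf, fun a => ?_⟩
    obtain ⟨b, hb⟩ := exists_adj_of_two_le hk hF a
    exact ⟨f b, hf a b hb⟩
  rw [h2] at h1
  rw [← (Set.toFinite (homSet F G)).cast_ncard_eq, mul_comm]
  simp only [ENat.toENNReal_coe, Nat.add_sub_cancel]
  exact_mod_cast h1

lemma connected_fin_two_adj {F : SimpleGraph (Fin 2)} (hF : F.Connected) : F.Adj 0 1 := by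
  obtain ⟨b, hb⟩ := exists_adj_of_connected hF 0
  fin_cases b
  · exact absurd rfl hb.ne
  · exact hb

lemma two_mul_edges_le (hd : ∀ x, (G.neighborSet x).ncard ≤ d) :
    2 * (G.edgeSet.encard : ℝ≥0∞) ≤ d * (G.support.ncard : ℝ≥0∞) := by
  have := encard_homSet_le_of_degree_le hd le_rfl top_connected_fin_two
  rw [encard_homSet_two (connected_fin_two_adj top_connected_fin_two), ENat.toENNReal_mul] at this
  simpa using this

lemma support_le_two_mul_edges (G : SimpleGraph V) :
    (G.support.ncard : ℝ≥0∞) ≤ 2 * (G.edgeSet.encard : ℝ≥0∞) := by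
  have h1 : G.support.encard ≤ 2 * G.edgeSet.encard := by
    rw [two_mul_encard_edgeSet]
    refine le_trans (Set.encard_le_encard ?_) (Set.encard_image_le Prod.fst _)
    rintro x ⟨y, hy⟩
    exact ⟨(x, y), hy, rfl⟩
  rw [← (Set.toFinite G.support).cast_ncard_eq] at h1
  have := ENat.toENNReal_le.2 h1
  rwa [ENat.toENNReal_mul, ENat.toENNReal_coe] at this

end BoundedDegree

/-! ### Limits of the densities under bounded degrees. -/

section BoundedDegreeSequences

variable {V : ℕ → Type*} [∀ n, Finite (V n)] {G : ∀ n, SimpleGraph (V n)} {d : ℕ}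

lemma tendsto_natCast_ennreal {s : ℕ → ℕ} (hs : Tendsto s atTop atTop) :
    Tendsto (fun n => (s n : ℝ≥0∞)) atTop (𝓝 ∞) :=
  ENNReal.tendsto_nat_nhds_top.comp hs

lemma tendsto_homDensity_zero (hd : ∀ n x, ((G n).neighborSet x).ncard ≤ d)
    (hs : Tendsto (fun n => (G n).support.ncard) atTop atTop) {k : ℕ} (hk : 3 ≤ k)
    (F : SimpleGraph (Fin k)) (hF : F.Connected) :
    Tendsto (fun n => homDensity F (G n)) atTop (𝓝 0) := by
  have hpos : (0 : ℝ) < (k : ℝ) / 2 - 1 := by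
    have : (3 : ℝ) ≤ k := by exact_mod_cast hk
    linarith
  have h1 : Tendsto (fun n => (d : ℝ≥0∞) ^ (k - 1) *
      (((G n).support.ncard : ℝ≥0∞) ^ ((k : ℝ) / 2 - 1))⁻¹) atTop (𝓝 0) := by
    have h2 := (ENNReal.tendsto_rpow_at_top hpos).comp (tendsto_natCast_ennreal hs)
    have h3 := ENNReal.Tendsto.const_mul (a := (d : ℝ≥0∞) ^ (k - 1)) (tendsto_inv_iff.2 h2)
      (Or.inr (ENNReal.pow_ne_top (ENNReal.natCast_ne_top d)))
    simpa using h3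
  refine tendsto_of_tendsto_of_tendsto_of_le_of_le' tendsto_const_nhds h1
    (Eventually.of_forall fun n => zero_le) ?_
  filter_upwards [hs.eventually_gt_atTop 0] with n hn
  have hs0 : ((G n).support.ncard : ℝ≥0∞) ≠ 0 := by exact_mod_cast hn.ne'
  have hsT : ((G n).support.ncard : ℝ≥0∞) ≠ ∞ := ENNReal.natCast_ne_top _
  rw [homDensity, card_hom]
  calc ((homSet F (G n)).encard : ℝ≥0∞) / (2 * ((G n).edgeSet.encard : ℝ≥0∞)) ^ ((k : ℝ) / 2)
      ≤ (d : ℝ≥0∞) ^ (k - 1) * ((G n).support.ncard : ℝ≥0∞) /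
          ((G n).support.ncard : ℝ≥0∞) ^ ((k : ℝ) / 2) := by
        gcongr
        · exact encard_homSet_le_of_degree_le (hd n) (by omega) hF
        · exact support_le_two_mul_edges (G n)
    _ = _ := by
        rw [mul_div_assoc]
        congr 1
        rw [ENNReal.rpow_sub _ _ hs0 hsT, ENNReal.rpow_one, ENNReal.inv_div (Or.inl hsT) (Or.inl hs0)]

theorem leftConvergent_of_degree_le (hd : ∀ n x, ((G n).neighborSet x).ncard ≤ d)
    (hs : Tendsto (fun n => (G n).support.ncard) atTop atTop) : LeftConvergent atTop G where
  edges_nonempty := by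
    filter_upwards [hs.eventually_gt_atTop 0] with n hn
    by_contra hne
    rw [Set.not_nonempty_iff_eq_empty] at hne
    have := support_le_two_mul_edges (G n)
    rw [hne] at this
    simp at this
    omega
  edgeDensity_tendsto := by
    refine ⟨0, ?_⟩
    have h1 : Tendsto (fun n => (d : ℝ≥0∞) * ((G n).support.ncard : ℝ≥0∞)⁻¹) atTop (𝓝 0) := by
      have h3 := ENNReal.Tendsto.const_mul (a := (d : ℝ≥0∞))
        (tendsto_inv_iff.2 (tendsto_natCast_ennreal hs)) (Or.inr (ENNReal.natCast_ne_top d))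
      simpa using h3
    refine tendsto_of_tendsto_of_tendsto_of_le_of_le' tendsto_const_nhds h1
      (Eventually.of_forall fun n => zero_le) ?_
    filter_upwards [hs.eventually_gt_atTop 0] with n hn
    have hs0 : ((G n).support.ncard : ℝ≥0∞) ≠ 0 := by exact_mod_cast hn.ne'
    have hsT : ((G n).support.ncard : ℝ≥0∞) ≠ ∞ := ENNReal.natCast_ne_top _
    have hV : ((G n).support.ncard : ℝ≥0∞) ≤ ((ENat.card (V n) : ℕ∞) : ℝ≥0∞) := by
      have h2 : (G n).support.encard ≤ ENat.card (V n) := Set.encard_le_card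
      rw [← (Set.toFinite (G n).support).cast_ncard_eq] at h2
      have h3 := ENat.toENNReal_le.2 h2
      rwa [ENat.toENNReal_coe] at h3
    calc edgeDensity (G n) ≤ d * ((G n).support.ncard : ℝ≥0∞) /
          ((G n).support.ncard : ℝ≥0∞) ^ 2 := by
          exact ENNReal.div_le_div (two_mul_edges_le (hd n)) (pow_le_pow_left' hV 2)
      _ = _ := by
          rw [mul_div_assoc]
          congr 1
          rw [sq, div_eq_mul_inv, ENNReal.mul_inv (Or.inl hs0) (Or.inl hsT), ← mul_assoc,
            ENNReal.mul_inv_cancel hs0 hsT, one_mul]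
  homDensity_tendsto := by
    intro k hk F hF
    rcases hk.eq_or_lt with rfl | hk
    -- For `k = 2` the graph `F` is an edge, and its density is `1` as soon as there is an edge.
    · refine ⟨1, tendsto_const_nhds.congr' ?_⟩
      filter_upwards [hs.eventually_gt_atTop 0] with n hn
      have h0 : 2 * ((G n).edgeSet.encard : ℝ≥0∞) ≠ 0 := by
        have h1 := support_le_two_mul_edges (G n)
        intro h0
        rw [h0, le_zero_iff, Nat.cast_eq_zero] at h1
        omega
      have hT : 2 * ((G n).edgeSet.encard : ℝ≥0∞) ≠ ∞ :=
        ne_top_of_le_ne_top (by finiteness) (two_mul_edges_le (hd n))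
      rw [homDensity, card_hom, encard_homSet_two (connected_fin_two_adj hF), ENat.toENNReal_mul]
      norm_num
      rw [ENNReal.div_self h0 hT]
    · exact ⟨0, tendsto_homDensity_zero hd hs hk F hF⟩

end BoundedDegreeSequences

/-! ### The graphon of a finite graph -/

section GraphGraphon

lemma lebesgue_Ico (a b : ℝ≥0) : lebesgue (Ico a b) = (b : ℝ≥0∞) - a := by
  rw [lebesgue, measurableEmbedding_nnreal_toReal.comap_apply]
  have : ((↑) : ℝ≥0 → ℝ) '' Ico a b = Ico (a : ℝ) b := by
    ext x
    constructor
    · rintro ⟨y, hy, rfl⟩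
      exact ⟨NNReal.coe_le_coe.2 hy.1, NNReal.coe_lt_coe.2 hy.2⟩
    · intro hx
      exact ⟨⟨x, a.2.trans hx.1⟩, ⟨hx.1, hx.2⟩, rfl⟩
  rw [this, Real.volume_Ico, ENNReal.ofReal_sub _ (NNReal.coe_nonneg a), ENNReal.ofReal_coe_nnreal,
    ENNReal.ofReal_coe_nnreal]

lemma lebesgue_univ : lebesgue univ = ∞ := by
  refine ENNReal.eq_top_of_forall_nnreal_le fun r => ?_
  rw [← lebesgue_Iic r]
  exact measure_mono (subset_univ _)

/-- Rescaling Lebesgue measure by `c⁻¹` is the same as mapping it by `x ↦ x * c`. A stretched graph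
thus becomes a function on the fixed measure space `ℝ₊`, which is how different graphs are coupled
below. -/
lemma lebesgue_map_mul {c : ℝ≥0} (hc : c ≠ 0) : lebesgue.map (· * c) = c⁻¹ • lebesgue := by
  ext s hs
  rw [Measure.map_apply (measurable_mul_const c) hs, Measure.smul_apply, lebesgue,
    measurableEmbedding_nnreal_toReal.comap_apply, measurableEmbedding_nnreal_toReal.comap_apply]
  have : ((↑) : ℝ≥0 → ℝ) '' ((· * c) ⁻¹' s) = (· * (c : ℝ)) ⁻¹' (((↑) : ℝ≥0 → ℝ) '' s) := by
    ext x
    constructor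
    · rintro ⟨y, hy, rfl⟩
      exact ⟨y * c, hy, by push_cast; rfl⟩
    · rintro ⟨y, hy, hxy⟩
      have hxy' : (y : ℝ) = x * c := hxy
      have hx : 0 ≤ x := by
        have h1 : (0 : ℝ) ≤ x * c := hxy' ▸ NNReal.coe_nonneg y
        exact nonneg_of_mul_nonneg_left h1 (NNReal.coe_pos.2 (pos_iff_ne_zero.2 hc))
      lift x to ℝ≥0 using hx
      refine ⟨x, ?_, rfl⟩
      have h2 : x * c = y := NNReal.eq hxy'.symm
      change x * c ∈ s
      rwa [h2]
  rw [this, Real.volume_preimage_mul_right (NNReal.coe_ne_zero.2 hc), abs_of_nonneg (by positivity),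
    ← NNReal.coe_inv, ENNReal.ofReal_coe_nnreal]
  rfl

/-- The interval of a vertex. -/
def cell (i : ℕ) : Set ℝ≥0 := Ico (i : ℝ≥0) (i + 1)

lemma mem_cell {i : ℕ} {x : ℝ≥0} : x ∈ cell i ↔ ⌊x⌋₊ = i := by
  rw [Nat.floor_eq_iff (zero_le)]
  rfl

lemma measurableSet_cell (i : ℕ) : MeasurableSet (cell i) := measurableSet_Ico

lemma lebesgue_cell (i : ℕ) : lebesgue (cell i) = 1 := by
  rw [cell, lebesgue_Ico]
  push_cast
  exact ENNReal.add_sub_cancel_left (ENNReal.natCast_ne_top i)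

variable {n : ℕ} (G : SimpleGraph (Fin n))

/-- The ordered pairs of adjacent vertices. -/
def adjPairs : Finset (Fin n × Fin n) :=
  open Classical in
  Finset.univ.filter fun p => G.Adj p.1 p.2

lemma mem_adjPairs {p : Fin n × Fin n} : p ∈ adjPairs G ↔ G.Adj p.1 p.2 := by simp [adjPairs]

lemma card_adjPairs : ((adjPairs G).card : ℕ∞) = 2 * G.edgeSet.encard := by
  rw [two_mul_encard_edgeSet, ← Set.encard_coe_eq_coe_finsetCard]
  congr 1
  ext p
  simp [mem_adjPairs]

lemma graphGraphon_eq_one {x y : ℝ≥0} {i j : Fin n} (hx : x ∈ cell i) (hy : y ∈ cell j)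
    (h : G.Adj i j) : graphGraphon G x y = 1 := if_pos ⟨i, j, hx, hy, h⟩

lemma graphGraphon_zero_or (x y : ℝ≥0) : graphGraphon G x y = 0 ∨
    graphGraphon G x y = 1 ∧ ∃ i j : Fin n, x ∈ cell i ∧ y ∈ cell j ∧ G.Adj i j := by
  by_cases h : ∃ i j : Fin n, x ∈ cell i ∧ y ∈ cell j ∧ G.Adj i j
  · exact Or.inr ⟨if_pos h, h⟩
  · exact Or.inl (if_neg h)

lemma graphGraphon_nonneg (x y : ℝ≥0) : 0 ≤ graphGraphon G x y := by
  rcases graphGraphon_zero_or G x y with h | h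
  · exact h.ge
  · rw [h.1]; exact zero_le_one

lemma enorm_graphGraphon (x y : ℝ≥0) : ‖graphGraphon G x y‖ₑ =
    ∑ p ∈ adjPairs G, (cell p.1 ×ˢ cell p.2).indicator (fun _ => (1 : ℝ≥0∞)) (x, y) := by
  rcases graphGraphon_zero_or G x y with h | ⟨h, i, j, hi, hj, hij⟩
  · rw [h, enorm_zero]
    symm
    refine Finset.sum_eq_zero fun p hp => Set.indicator_of_notMem (fun hxy => ?_) _
    rw [graphGraphon_eq_one G hxy.1 hxy.2 ((mem_adjPairs G).1 hp)] at h
    exact one_ne_zero h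
  · rw [h, Finset.sum_eq_single (i, j)]
    · rw [Set.indicator_of_mem (show (x, y) ∈ cell i ×ˢ cell j from ⟨hi, hj⟩)]
      simp
    · intro p _ hp
      refine Set.indicator_of_notMem (fun hxy => hp ?_) _
      have h1 := (mem_cell.1 hxy.1).symm.trans (mem_cell.1 hi)
      have h2 := (mem_cell.1 hxy.2).symm.trans (mem_cell.1 hj)
      exact Prod.ext (Fin.ext h1) (Fin.ext h2)
    · intro h'
      exact absurd ((mem_adjPairs G).2 hij) h'

lemma measurable_graphGraphon : Measurable (Function.uncurry (graphGraphon G)) := by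
  have h1 : Measurable fun p : ℝ≥0 × ℝ≥0 => ‖graphGraphon G p.1 p.2‖ₑ := by
    simp_rw [enorm_graphGraphon]
    exact Finset.measurable_sum _ fun p _ => measurable_const.indicator
      ((measurableSet_cell _).prod (measurableSet_cell _))
  have h2 : Function.uncurry (graphGraphon G) =
      fun p : ℝ≥0 × ℝ≥0 => (‖graphGraphon G p.1 p.2‖ₑ).toReal := by
    ext p
    rw [toReal_enorm, Real.norm_of_nonneg (graphGraphon_nonneg G _ _)]
    rfl
  rw [h2]
  exact h1.ennreal_toReal

lemma l1Norm_graphGraphon : l1Norm lebesgue (graphGraphon G) = (adjPairs G).card := by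
  rw [l1Norm]
  simp_rw [enorm_graphGraphon]
  rw [lintegral_finsetSum _ fun p _ => measurable_const.indicator
    ((measurableSet_cell _).prod (measurableSet_cell _))]
  have : ∀ p : Fin n × Fin n, ∫⁻ q : ℝ≥0 × ℝ≥0,
      (cell p.1 ×ˢ cell p.2).indicator (fun _ => (1 : ℝ≥0∞)) (q.1, q.2) ∂(lebesgue.prod lebesgue) =
        1 := by
    intro p
    have h1 := lintegral_indicator_const (μ := lebesgue.prod lebesgue)
      ((measurableSet_cell p.1).prod (measurableSet_cell p.2)) 1
    rw [Measure.prod_prod, lebesgue_cell, lebesgue_cell, mul_one, mul_one] at h1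
    exact h1
  simp_rw [this]
  simp

/-- The square root of twice the number of edges. -/
def stretchFactor : ℝ≥0 := NNReal.sqrt (adjPairs G).card

lemma stretchFactor_sq : stretchFactor G ^ 2 = (adjPairs G).card := NNReal.sq_sqrt _

variable {G}

lemma stretchFactor_ne_zero (hG : (adjPairs G).card ≠ 0) : stretchFactor G ≠ 0 := by
  rw [stretchFactor, Ne, NNReal.sqrt_eq_zero]
  exact_mod_cast hG

lemma stretchMeasure_graphGraphon (hG : (adjPairs G).card ≠ 0) :
    stretchMeasure lebesgue (graphGraphon G) = (stretchFactor G)⁻¹ • lebesgue := by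
  have h0 : l1Norm lebesgue (graphGraphon G) ≠ 0 := by
    rw [l1Norm_graphGraphon]
    exact_mod_cast hG
  rw [stretchMeasure, if_neg h0, l1Norm_graphGraphon]
  have : ((adjPairs G).card : ℝ≥0∞) ^ (-(1 / 2 : ℝ)) = ((stretchFactor G)⁻¹ : ℝ≥0) := by
    rw [ENNReal.coe_inv (stretchFactor_ne_zero hG), stretchFactor, NNReal.sqrt_eq_rpow,
      ENNReal.rpow_neg, ENNReal.coe_rpow_of_nonneg _ (by norm_num)]
    simp
  rw [this]
  rfl

/-- Both rescaled measures have infinite total mass, so no trivial extension is needed. -/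
lemma graphStretchedCutDist_eq {m : ℕ} {H : SimpleGraph (Fin m)} (hG : (adjPairs G).card ≠ 0)
    (hH : (adjPairs H).card ≠ 0) : graphStretchedCutDist G H =
      couplingCutDist ((stretchFactor G)⁻¹ • lebesgue) (graphGraphon G)
        ((stretchFactor H)⁻¹ • lebesgue) (graphGraphon H) := by
  rw [graphStretchedCutDist, stretchedCutDist, stretchMeasure_graphGraphon hG,
    stretchMeasure_graphGraphon hH, cutDist, if_pos]
  have : ∀ c : ℝ≥0, c ≠ 0 → (c⁻¹ • lebesgue) univ = ∞ := fun c hc => by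
    rw [Measure.smul_apply, lebesgue_univ, ENNReal.smul_def, smul_eq_mul,
      ENNReal.mul_top (by simpa using hc)]
  rw [this _ (stretchFactor_ne_zero hG), this _ (stretchFactor_ne_zero hH)]

lemma lintegral_smul_prod_smul (c : ℝ≥0) {f : ℝ≥0 × ℝ≥0 → ℝ≥0∞} :
    ∫⁻ p, f p ∂((c • lebesgue).prod (c • lebesgue)) =
      (c : ℝ≥0∞) ^ 2 * ∫⁻ p, f p ∂(lebesgue.prod lebesgue) := by
  rw [Measure.prod_smul_left, Measure.prod_smul_right, smul_smul, lintegral_smul_measure,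
    ENNReal.smul_def, smul_eq_mul, ← sq]
  push_cast
  rfl

lemma lintegral_stretched {n' : ℕ} (H : SimpleGraph (Fin n')) (hG : (adjPairs G).card ≠ 0) :
    ∫⁻ p : ℝ≥0 × ℝ≥0, ‖graphGraphon H p.1 p.2‖ₑ
      ∂(((stretchFactor G)⁻¹ • lebesgue).prod ((stretchFactor G)⁻¹ • lebesgue)) =
      ((adjPairs H).card : ℝ≥0∞) / (adjPairs G).card := by
  rw [lintegral_smul_prod_smul]
  have h1 := l1Norm_graphGraphon H
  rw [l1Norm] at h1
  rw [h1, ENNReal.coe_inv (stretchFactor_ne_zero hG), ← ENNReal.inv_pow, ← ENNReal.coe_pow,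
    stretchFactor_sq, ENNReal.coe_natCast, mul_comm, div_eq_mul_inv]

end GraphGraphon

/-! ### A left convergent sequence that is not convergent in the stretched cut metric -/

section LowerBound

variable {S₁ S₂ : Type*} [MeasurableSpace S₁] [MeasurableSpace S₂] {μ₁ : Measure S₁}
  {μ₂ : Measure S₂} [SigmaFinite μ₁] {W₁ : S₁ → S₁ → ℝ} {W₂ : S₂ → S₂ → ℝ}

/-- If `W₁` has norm one and lives on a set `A`, and the degrees of `W₂` are small compared to the
inverse of the measure of `A`, then the graphons are far apart. -/
lemma half_le_couplingCutDist (hW₁ : Measurable (Function.uncurry W₁))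
    (hW₂ : Measurable (Function.uncurry W₂)) (h₁ : ∀ x y, 0 ≤ W₁ x y) (h₂ : ∀ x y, 0 ≤ W₂ x y)
    {A : Set S₁} (hA : MeasurableSet A) (hWA : ∀ x y, W₁ x y ≠ 0 → x ∈ A ∧ y ∈ A)
    (hnorm : l1Norm μ₁ W₁ = 1) {δ : ℝ≥0∞} (hδ : ∀ x, ∫⁻ y, ‖W₂ x y‖ₑ ∂μ₂ ≤ δ)
    (hAδ : δ * μ₁ A ≤ 2⁻¹) : 2⁻¹ ≤ couplingCutDist μ₁ W₁ μ₂ W₂ := by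
  refine le_iInf₂ fun γ hγ => ?_
  have hγσ : SigmaFinite γ := SigmaFinite.of_map γ measurable_fst.aemeasurable
    (by rw [hγ.1]; infer_instance)
  -- On `U ×ˢ U` the first graphon has its whole mass `1`, while the second has mass at most `δ * γ
  -- U = δ * μ₁ A`, for every coupling. So this one test set shows a difference of at least `1/2`.
  let U : Set (S₁ × S₂) := Prod.fst ⁻¹' A
  have hU : MeasurableSet U := measurable_fst hA
  let f₁ : (S₁ × S₂) × (S₁ × S₂) → ℝ := fun p => W₁ p.1.1 p.2.1
  let f₂ : (S₁ × S₂) × (S₁ × S₂) → ℝ := fun p => W₂ p.1.2 p.2.2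
  have hf₁ : Measurable f₁ := hW₁.comp (f := fun p : (S₁ × S₂) × (S₁ × S₂) => (p.1.1, p.2.1))
    (by fun_prop)
  have hf₂ : Measurable f₂ := hW₂.comp (f := fun p : (S₁ × S₂) × (S₁ × S₂) => (p.1.2, p.2.2))
    (by fun_prop)
  have hI₁ : ∫⁻ p in U ×ˢ U, ‖f₁ p‖ₑ ∂(γ.prod γ) = 1 := by
    rw [← lintegral_indicator (hU.prod hU)]
    have h3 : (U ×ˢ U).indicator (fun p => ‖f₁ p‖ₑ) = fun p => ‖f₁ p‖ₑ := by
      rw [Set.indicator_eq_self]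
      intro p hp
      have h4 : W₁ p.1.1 p.2.1 ≠ 0 := by simpa [f₁] using hp
      exact hWA _ _ h4
    have hm : Measurable fun p : S₁ × S₁ => ‖W₁ p.1 p.2‖ₑ := hW₁.enorm
    rw [h3, ← hnorm, l1Norm, ← hγ.1, Measure.map_prod_map _ _ measurable_fst measurable_fst,
      lintegral_map hm (measurable_fst.prodMap measurable_fst)]
    rfl
  have hI₂ : ∫⁻ p in U ×ˢ U, ‖f₂ p‖ₑ ∂(γ.prod γ) ≤ 2⁻¹ := by
    rw [← Measure.prod_restrict, lintegral_prod _ hf₂.enorm.aemeasurable]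
    calc ∫⁻ z in U, ∫⁻ z' in U, ‖f₂ (z, z')‖ₑ ∂γ ∂γ ≤ ∫⁻ _ in U, δ ∂γ := by
          refine lintegral_mono fun z => ?_
          refine (lintegral_mono' Measure.restrict_le_self le_rfl).trans ?_
          refine le_trans (le_of_eq ?_) (hδ z.2)
          have hm : Measurable fun y => ‖W₂ z.2 y‖ₑ := (hW₂.comp measurable_prodMk_left).enorm
          rw [← hγ.2, lintegral_map hm measurable_snd]
      _ = δ * μ₁ A := by
          rw [setLIntegral_const, ← hγ.1, Measure.map_apply measurable_fst hA]
      _ ≤ _ := hAδ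
  have hi₁ : Integrable f₁ ((γ.prod γ).restrict (U ×ˢ U)) :=
    ⟨hf₁.aestronglyMeasurable, by rw [HasFiniteIntegral, hI₁]; exact ENNReal.one_lt_top⟩
  have hi₂ : Integrable f₂ ((γ.prod γ).restrict (U ×ˢ U)) :=
    ⟨hf₂.aestronglyMeasurable, lt_of_le_of_lt hI₂ (by simp)⟩
  have e₁ : ∫ p in U ×ˢ U, f₁ p ∂(γ.prod γ) = 1 := by
    have := integral_norm_eq_lintegral_enorm hi₁.1
    rw [hI₁, ENNReal.toReal_one] at this
    rw [← this]
    exact integral_congr_ae (Eventually.of_forall fun p => (Real.norm_of_nonneg (h₁ _ _)).symm)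
  have e₂ : ∫ p in U ×ˢ U, f₂ p ∂(γ.prod γ) ≤ 1 / 2 := by
    have := integral_norm_eq_lintegral_enorm hi₂.1
    have h3 : ∫ p in U ×ˢ U, f₂ p ∂(γ.prod γ) = ∫ p in U ×ˢ U, ‖f₂ p‖ ∂(γ.prod γ) :=
      integral_congr_ae (Eventually.of_forall fun p => (Real.norm_of_nonneg (h₂ _ _)).symm)
    rw [h3, this]
    have h4 := ENNReal.toReal_mono (by simp) hI₂
    simpa using h4
  have e₃ : ∫ p in U ×ˢ U, (W₁ p.1.1 p.2.1 - W₂ p.1.2 p.2.2) ∂(γ.prod γ) =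
      ∫ p in U ×ˢ U, f₁ p ∂(γ.prod γ) - ∫ p in U ×ˢ U, f₂ p ∂(γ.prod γ) := integral_sub hi₁ hi₂
  rw [cutNorm]
  refine le_iSup_of_le U (le_iSup_of_le U (le_iSup_of_le hU (le_iSup_of_le hU ?_)))
  rw [e₃, e₁]
  have h5 : (2⁻¹ : ℝ≥0∞) = ENNReal.ofReal (1 / 2) := by
    rw [ENNReal.ofReal_div_of_pos two_pos]
    simp
  rw [h5]
  refine ENNReal.ofReal_le_ofReal (le_trans ?_ (le_abs_self _))
  linarith

end LowerBound

/-! ### Perfect matchings. -/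

section Matchings

/-- The perfect matching of the vertices `2 i` and `2 i + 1`. -/
def matching (n : ℕ) : SimpleGraph (Fin (2 * n)) where
  Adj i j := i ≠ j ∧ (i : ℕ) / 2 = (j : ℕ) / 2
  symm := ⟨fun _ _ h => ⟨h.1.symm, h.2.symm⟩⟩
  loopless := ⟨fun _ h => h.1 rfl⟩

lemma support_matching (n : ℕ) : (matching n).support = univ := by
  refine eq_univ_of_forall fun i => ?_
  rcases Nat.even_or_odd' (i : ℕ) with ⟨c, hc | hc⟩
  · have hi := i.2
    refine ⟨⟨i + 1, by omega⟩, ?_, ?_⟩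
    · intro h
      have := congrArg Fin.val h
      simp at this
    · simp only
      omega
  · refine ⟨⟨i - 1, by omega⟩, ?_, ?_⟩
    · intro h
      have := congrArg Fin.val h
      simp only at this
      omega
    · simp only
      omega

lemma ncard_support_matching (n : ℕ) : (matching n).support.ncard = 2 * n := by
  rw [support_matching, Set.ncard_univ, Nat.card_fin]

lemma ncard_neighborSet_matching (n : ℕ) (i : Fin (2 * n)) :
    ((matching n).neighborSet i).ncard ≤ 2 := by
  calc ((matching n).neighborSet i).ncard
      ≤ (((Finset.Ico (2 * ((i : ℕ) / 2)) (2 * ((i : ℕ) / 2) + 2) : Finset ℕ) : Set ℕ)).ncard := by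
        refine Set.ncard_le_ncard_of_injOn Fin.val ?_ Fin.val_injective.injOn (Finset.finite_toSet _)
        intro j hj
        have h := hj.2
        rw [Finset.coe_Ico, mem_Ico]
        omega
    _ = 2 := by simp

lemma le_card_adjPairs_matching (n : ℕ) : 2 * n ≤ (adjPairs (matching n)).card := by
  have h := support_le_two_mul_edges (matching n)
  have h1 := congrArg ENat.toENNReal (card_adjPairs (matching n))
  rw [ENat.toENNReal_mul, ENat.toENNReal_coe] at h1
  rw [ncard_support_matching] at h
  have h2 : ((2 * n : ℕ) : ℝ≥0∞) ≤ ((adjPairs (matching n)).card : ℝ≥0∞) := by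
    rw [h1]
    simpa using h
  exact_mod_cast h2

lemma lintegral_matching_le (n : ℕ) (x : ℝ≥0) :
    ∫⁻ y, ‖graphGraphon (matching n) x y‖ₑ ∂lebesgue ≤ 2 := by
  let q : ℕ := 2 * (⌊x⌋₊ / 2)
  calc ∫⁻ y, ‖graphGraphon (matching n) x y‖ₑ ∂lebesgue
      ≤ ∫⁻ y, (Ico (q : ℝ≥0) (q + 2)).indicator (fun _ => (1 : ℝ≥0∞)) y ∂lebesgue := by
        refine lintegral_mono fun y => ?_
        rcases graphGraphon_zero_or (matching n) x y with h | ⟨h, i, j, hi, hj, hij⟩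
        · rw [h, enorm_zero]
          exact zero_le
        · rw [h, Set.indicator_of_mem]
          · simp
          · rw [mem_cell] at hi
            have h1 := hij.2
            rw [← hi] at h1
            have h2 : q ≤ j := by omega
            have h3 : (j : ℕ) + 1 ≤ q + 2 := by omega
            refine ⟨le_trans (by exact_mod_cast h2) hj.1, lt_of_lt_of_le hj.2 ?_⟩
            exact_mod_cast h3
    _ = 2 := by
        rw [lintegral_indicator_const measurableSet_Ico, lebesgue_Ico]
        push_cast
        rw [ENNReal.add_sub_cancel_left (ENNReal.natCast_ne_top q), one_mul]

/-- With stretch factors `a` and `b`, the smaller matching lives on a set of measure `2 * m / a`,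
and the degrees of the larger are at most `2 / b`. The factor `16` makes `a * b ≥ √(2 * m * (32 *
m)) = 8 * m`, so that the product `4 * m / (a * b)` is at most `1/2`. -/
lemma half_le_dist_matching {m : ℕ} (hm : m ≠ 0) :
    2⁻¹ ≤ graphStretchedCutDist (matching m) (matching (16 * m)) := by
  have h1 : (adjPairs (matching m)).card ≠ 0 := by
    have := le_card_adjPairs_matching m
    omega
  have h2 : (adjPairs (matching (16 * m))).card ≠ 0 := by
    have := le_card_adjPairs_matching (16 * m)
    omega
  rw [graphStretchedCutDist_eq h1 h2]
  have hA : ∀ x y, graphGraphon (matching m) x y ≠ 0 →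
      x ∈ Ico (0 : ℝ≥0) ((2 * m : ℕ) : ℝ≥0) ∧ y ∈ Ico (0 : ℝ≥0) ((2 * m : ℕ) : ℝ≥0) := by
    intro x y hxy
    have hcell : ∀ (z : ℝ≥0) (i : Fin (2 * m)), z ∈ cell i → z ∈ Ico (0 : ℝ≥0) ((2 * m : ℕ) : ℝ≥0) :=
      fun z i hz => ⟨zero_le, lt_of_lt_of_le hz.2 (by exact_mod_cast i.2)⟩
    rcases graphGraphon_zero_or (matching m) x y with h | ⟨h, i, j, hi, hj, hij⟩
    · exact absurd h hxy
    · exact ⟨hcell x i hi, hcell y j hj⟩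
  refine half_le_couplingCutDist (measurable_graphGraphon _) (measurable_graphGraphon _)
    (graphGraphon_nonneg _) (graphGraphon_nonneg _) measurableSet_Ico hA ?_
    (δ := (((stretchFactor (matching (16 * m)))⁻¹ : ℝ≥0) : ℝ≥0∞) * 2) (fun x => ?_) ?_
  · rw [l1Norm, lintegral_stretched _ h1, ENNReal.div_self (by exact_mod_cast h1)
      (ENNReal.natCast_ne_top _)]
  · rw [lintegral_smul_measure, ENNReal.smul_def, smul_eq_mul]
    gcongr
    exact lintegral_matching_le _ x
  · rw [Measure.smul_apply, lebesgue_Ico, ENNReal.smul_def, smul_eq_mul]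
    set a := stretchFactor (matching m) with ha
    set b := stretchFactor (matching (16 * m)) with hb
    have ha0 : a ≠ 0 := stretchFactor_ne_zero h1
    have hb0 : b ≠ 0 := stretchFactor_ne_zero h2
    have hab : (8 * m : ℝ≥0) ≤ a * b := by
      have h3 : ((8 * m : ℝ≥0)) ^ 2 ≤ (a * b) ^ 2 := by
        rw [mul_pow a b, ha, hb, stretchFactor_sq, stretchFactor_sq]
        have h4 := Nat.mul_le_mul (le_card_adjPairs_matching m) (le_card_adjPairs_matching (16 * m))
        have h5 : (8 * m) ^ 2 ≤ 2 * m * (2 * (16 * m)) := by nlinarith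
        exact_mod_cast h5.trans h4
      exact (pow_le_pow_iff_left₀ zero_le zero_le two_ne_zero).1 h3
    have key : b⁻¹ * 2 * (a⁻¹ * (2 * m : ℕ)) ≤ 2⁻¹ := by
      have h6 : b⁻¹ * 2 * (a⁻¹ * (2 * m : ℕ)) = (4 * m) / (a * b) := by
        push_cast
        field_simp
        ring
      rw [h6, div_le_iff₀ (by positivity)]
      calc (4 * m : ℝ≥0) = 2⁻¹ * (8 * m) := by
            rw [← mul_assoc]; norm_num
        _ ≤ 2⁻¹ * (a * b) := by gcongr
    have h7 : ((b⁻¹ * 2 * (a⁻¹ * (2 * m : ℕ)) : ℝ≥0) : ℝ≥0∞) ≤ ((2⁻¹ : ℝ≥0) : ℝ≥0∞) := by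
      exact_mod_cast key
    rw [ENNReal.coe_zero, tsub_zero]
    simpa using h7

/-- Bounded degrees give left convergence, and beyond any index there are matchings of sizes `m` and
`16 * m` at distance at least `1/2`, so the Cauchy condition fails. -/
theorem exists_leftConvergent_not_stretchedCutConvergent :
    ∃ (N : ℕ → ℕ) (G : ∀ n, SimpleGraph (Fin (N n))),
      Tendsto (fun n => (G n).edgeSet.ncard) atTop atTop ∧
      LeftConvergent atTop G ∧ ¬ StretchedCutConvergent G := by
  refine ⟨fun n => 2 * n, matching, ?_, ?_, ?_⟩
  · refine tendsto_atTop_mono (fun n => ?_) tendsto_id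
    have h1 := card_adjPairs (matching n)
    rw [← (Set.toFinite (matching n).edgeSet).cast_ncard_eq] at h1
    have h2 : (adjPairs (matching n)).card = 2 * (matching n).edgeSet.ncard := by exact_mod_cast h1
    have h3 := le_card_adjPairs_matching n
    simp only [id]
    omega
  · refine leftConvergent_of_degree_le ncard_neighborSet_matching ?_
    simp_rw [ncard_support_matching]
    exact tendsto_id.const_mul_atTop' (by norm_num)
  · intro h
    obtain ⟨n₀, hn₀⟩ := h 2⁻¹ (by simp)
    have h1 := hn₀ (n₀ + 1) (16 * (n₀ + 1)) (by omega) (by omega)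
    exact absurd (half_le_dist_matching (Nat.succ_ne_zero n₀)) (not_le.2 h1)

end Matchings

/-! ### A sequence convergent in the stretched cut metric that is not left convergent -/

section UpperBound

lemma cutNorm_le_lintegral {S : Type*} [MeasurableSpace S] (μ : Measure S) (W : S → S → ℝ) :
    cutNorm μ W ≤ ∫⁻ p, ‖W p.1 p.2‖ₑ ∂(μ.prod μ) := by
  refine iSup_le fun U => iSup_le fun V => iSup_le fun _ => iSup_le fun _ => ?_
  rw [← Real.enorm_eq_ofReal_abs]
  exact (enorm_integral_le_lintegral_enorm _).trans (setLIntegral_le_lintegral _ _)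

/-- The indicator of the unit square. -/
def unitSquare (p : ℝ≥0 × ℝ≥0) : ℝ := (Iio (1 : ℝ≥0) ×ˢ Iio (1 : ℝ≥0)).indicator (fun _ => 1) p

lemma measurable_unitSquare : Measurable unitSquare :=
  measurable_const.indicator (measurableSet_Iio.prod measurableSet_Iio)

lemma lintegral_unitSquare : ∫⁻ p, ‖unitSquare p‖ₑ ∂(lebesgue.prod lebesgue) = 1 := by
  have h1 : ∀ p, ‖unitSquare p‖ₑ =
      (Iio (1 : ℝ≥0) ×ˢ Iio (1 : ℝ≥0)).indicator (fun _ => (1 : ℝ≥0∞)) p := by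
    intro p
    by_cases hp : p ∈ Iio (1 : ℝ≥0) ×ˢ Iio (1 : ℝ≥0)
    · rw [unitSquare, Set.indicator_of_mem hp, Set.indicator_of_mem hp]
      simp
    · rw [unitSquare, Set.indicator_of_notMem hp, Set.indicator_of_notMem hp, enorm_zero]
  have h2 : lebesgue (Iio 1) = 1 := by
    rw [show Iio (1 : ℝ≥0) = Ico 0 1 by ext x; simp, lebesgue_Ico]
    simp
  simp_rw [h1]
  rw [lintegral_indicator_const (measurableSet_Iio.prod measurableSet_Iio), Measure.prod_prod, h2]
  simp

variable {n : ℕ} {G : SimpleGraph (Fin n)}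

lemma lintegral_comp_stretch (H : SimpleGraph (Fin n)) (hG : (adjPairs G).card ≠ 0) :
    ∫⁻ p : ℝ≥0 × ℝ≥0, ‖graphGraphon H (p.1 * stretchFactor G) (p.2 * stretchFactor G)‖ₑ
      ∂(lebesgue.prod lebesgue) = ((adjPairs H).card : ℝ≥0∞) / (adjPairs G).card := by
  have hm : Measurable fun p : ℝ≥0 × ℝ≥0 => ‖graphGraphon H p.1 p.2‖ₑ :=
    (measurable_graphGraphon H).enorm
  rw [← lintegral_stretched H hG, ← lebesgue_map_mul (stretchFactor_ne_zero hG),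
    Measure.map_prod_map _ _ (measurable_mul_const _) (measurable_mul_const _),
    lintegral_map hm ((measurable_mul_const _).prodMap (measurable_mul_const _))]
  rfl

lemma measurable_comp_stretch (H : SimpleGraph (Fin n)) (c : ℝ≥0) :
    Measurable fun p : ℝ≥0 × ℝ≥0 => graphGraphon H (p.1 * c) (p.2 * c) :=
  (measurable_graphGraphon H).comp (f := fun p : ℝ≥0 × ℝ≥0 => (p.1 * c, p.2 * c)) (by fun_prop)

/-- A graph which consists of a subgraph on few vertices and few other edges is close to the
indicator of the unit square. -/
lemma lintegral_sub_unitSquare_le {H : SimpleGraph (Fin n)} (hHG : H ≤ G) {r s : ℕ}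
    (hH : ∀ i j, H.Adj i j → (i : ℕ) < s) (hs : s ^ 2 ≤ (adjPairs G).card)
    (hG : (adjPairs G).card ≠ 0) (hr : (adjPairs G).card ≤ (adjPairs H).card + r) :
    ∫⁻ p : ℝ≥0 × ℝ≥0, ‖graphGraphon G (p.1 * stretchFactor G) (p.2 * stretchFactor G) -
      unitSquare p‖ₑ ∂(lebesgue.prod lebesgue) ≤ 2 * ((r : ℝ≥0∞) / (adjPairs G).card) := by
  have hc0 := stretchFactor_ne_zero hG
  -- The squared stretch factor is the number of ordered adjacent pairs of `G`, so after rescaling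
  -- the first `s` cells lie in the unit interval.
  have hsc : (s : ℝ≥0) ≤ stretchFactor G := by
    refine (pow_le_pow_iff_left₀ zero_le zero_le two_ne_zero).1 ?_
    rw [stretchFactor_sq]
    exact_mod_cast hs
  have hlt : ∀ (x : ℝ≥0) (i : Fin n), x * stretchFactor G ∈ cell i → (i : ℕ) < s → x < 1 := by
    intro x i hx hi
    have h1 : x * stretchFactor G < 1 * stretchFactor G := by
      rw [one_mul]
      refine lt_of_lt_of_le hx.2 (le_trans ?_ hsc)
      exact_mod_cast hi
    exact lt_of_mul_lt_mul_right h1 zero_le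
  -- The rescaled `H` lies below both `G` and the unit square, and `|a - b| = a + b - 2 min(a, b)`.
  -- After integration `G` and the square have mass `1` each and `H` at least `1 - r / |adjPairs
  -- G|`.
  have hpt : ∀ p : ℝ≥0 × ℝ≥0, ‖graphGraphon G (p.1 * stretchFactor G) (p.2 * stretchFactor G) -
      unitSquare p‖ₑ + 2 * ‖graphGraphon H (p.1 * stretchFactor G) (p.2 * stretchFactor G)‖ₑ ≤
      ‖graphGraphon G (p.1 * stretchFactor G) (p.2 * stretchFactor G)‖ₑ + ‖unitSquare p‖ₑ := by
    intro p
    rcases graphGraphon_zero_or H (p.1 * stretchFactor G) (p.2 * stretchFactor G) with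
      h | ⟨h, i, j, hi, hj, hij⟩
    · rw [h, enorm_zero, mul_zero, add_zero]
      exact enorm_sub_le
    · rw [h, graphGraphon_eq_one G hi hj (hHG hij), unitSquare, Set.indicator_of_mem
        (show p ∈ Iio (1 : ℝ≥0) ×ˢ Iio (1 : ℝ≥0) from
          ⟨hlt _ i hi (hH _ _ hij), hlt _ j hj (hH _ _ hij.symm)⟩)]
      simp
      norm_num
  have hmH : Measurable fun p : ℝ≥0 × ℝ≥0 =>
      ‖graphGraphon H (p.1 * stretchFactor G) (p.2 * stretchFactor G)‖ₑ :=
    (measurable_comp_stretch H _).enorm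
  have hmG : Measurable fun p : ℝ≥0 × ℝ≥0 =>
      ‖graphGraphon G (p.1 * stretchFactor G) (p.2 * stretchFactor G)‖ₑ :=
    (measurable_comp_stretch G _).enorm
  have hint := lintegral_mono (μ := lebesgue.prod lebesgue) hpt
  rw [lintegral_add_right _ (hmH.const_mul 2), lintegral_const_mul _ hmH, lintegral_add_left hmG,
    lintegral_comp_stretch H hG, lintegral_comp_stretch G hG, lintegral_unitSquare] at hint
  have hP0 : ((adjPairs G).card : ℝ≥0∞) ≠ 0 := by exact_mod_cast hG
  have hPT : ((adjPairs G).card : ℝ≥0∞) ≠ ∞ := ENNReal.natCast_ne_top _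
  have hrP : ((adjPairs G).card : ℝ≥0∞) / (adjPairs G).card ≤
      (r : ℝ≥0∞) / (adjPairs G).card + ((adjPairs H).card : ℝ≥0∞) / (adjPairs G).card := by
    rw [← ENNReal.add_div]
    gcongr
    rw [add_comm]
    exact_mod_cast hr
  rw [ENNReal.div_self hP0 hPT] at hint hrP
  have hfin : 2 * (((adjPairs H).card : ℝ≥0∞) / (adjPairs G).card) ≠ ∞ :=
    ENNReal.mul_ne_top (by simp) (ENNReal.div_ne_top (ENNReal.natCast_ne_top _) hP0)
  refine (ENNReal.add_le_add_iff_right hfin).1 (hint.trans ?_)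
  calc (1 : ℝ≥0∞) + 1 = 2 * 1 := by norm_num
    _ ≤ 2 * ((r : ℝ≥0∞) / (adjPairs G).card +
        ((adjPairs H).card : ℝ≥0∞) / (adjPairs G).card) := by gcongr
    _ = _ := mul_add _ _ _

/-- Two graphs that are close to the indicator of the unit square are close to each other. -/
lemma graphStretchedCutDist_le {n' : ℕ} {G' : SimpleGraph (Fin n')} (hG : (adjPairs G).card ≠ 0)
    (hG' : (adjPairs G').card ≠ 0) : graphStretchedCutDist G G' ≤
      ∫⁻ p : ℝ≥0 × ℝ≥0, ‖graphGraphon G (p.1 * stretchFactor G) (p.2 * stretchFactor G) -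
        unitSquare p‖ₑ ∂(lebesgue.prod lebesgue) +
      ∫⁻ p : ℝ≥0 × ℝ≥0, ‖graphGraphon G' (p.1 * stretchFactor G') (p.2 * stretchFactor G') -
        unitSquare p‖ₑ ∂(lebesgue.prod lebesgue) := by
  rw [graphStretchedCutDist_eq hG hG']
  -- The coupling matches points with the same rescaled coordinate `x`; then the triangle inequality
  -- through the unit square applies pointwise.
  let g : ℝ≥0 → ℝ≥0 × ℝ≥0 := fun x => (x * stretchFactor G, x * stretchFactor G')
  have hg : Measurable g := (measurable_mul_const _).prodMk (measurable_mul_const _)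
  have hcoup : IsCoupling (lebesgue.map g) ((stretchFactor G)⁻¹ • lebesgue)
      ((stretchFactor G')⁻¹ • lebesgue) := by
    constructor
    · rw [Measure.map_map measurable_fst hg, ← lebesgue_map_mul (stretchFactor_ne_zero hG)]
      rfl
    · rw [Measure.map_map measurable_snd hg, ← lebesgue_map_mul (stretchFactor_ne_zero hG')]
      rfl
  rw [couplingCutDist]
  refine (iInf₂_le (lebesgue.map g) hcoup).trans ((cutNorm_le_lintegral _ _).trans ?_)
  have hm : Measurable fun p : (ℝ≥0 × ℝ≥0) × (ℝ≥0 × ℝ≥0) =>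
      ‖graphGraphon G p.1.1 p.2.1 - graphGraphon G' p.1.2 p.2.2‖ₑ := by
    refine (Measurable.sub ?_ ?_).enorm
    · exact (measurable_graphGraphon G).comp
        (f := fun p : (ℝ≥0 × ℝ≥0) × (ℝ≥0 × ℝ≥0) => (p.1.1, p.2.1)) (by fun_prop)
    · exact (measurable_graphGraphon G').comp
        (f := fun p : (ℝ≥0 × ℝ≥0) × (ℝ≥0 × ℝ≥0) => (p.1.2, p.2.2)) (by fun_prop)
  have hmG : Measurable fun p : ℝ≥0 × ℝ≥0 =>
      ‖graphGraphon G (p.1 * stretchFactor G) (p.2 * stretchFactor G) - unitSquare p‖ₑ :=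
    ((measurable_comp_stretch G _).sub measurable_unitSquare).enorm
  rw [Measure.map_prod_map _ _ hg hg, lintegral_map hm (hg.prodMap hg), ← lintegral_add_left hmG]
  refine lintegral_mono fun p => ?_
  have h1 : graphGraphon G (p.1 * stretchFactor G) (p.2 * stretchFactor G) -
      graphGraphon G' (p.1 * stretchFactor G') (p.2 * stretchFactor G') =
      (graphGraphon G (p.1 * stretchFactor G) (p.2 * stretchFactor G) - unitSquare p) -
      (graphGraphon G' (p.1 * stretchFactor G') (p.2 * stretchFactor G') - unitSquare p) := by
    ring
  exact (congrArg _ h1).le.trans enorm_sub_le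

end UpperBound

/-! ### Cliques with an attached star. -/

section CliqueStar

/-- The complete graph on the first `s` vertices. -/
def firstClique (s m : ℕ) : SimpleGraph (Fin (s + m)) where
  Adj i j := i ≠ j ∧ (i : ℕ) < s ∧ (j : ℕ) < s
  symm := ⟨fun _ _ h => ⟨h.1.symm, h.2.2, h.2.1⟩⟩
  loopless := ⟨fun _ h => h.1 rfl⟩

/-- The complete graph on the first `s` vertices, with the vertex `0` joined to all others. -/
def cliqueStar (s m : ℕ) : SimpleGraph (Fin (s + m)) where
  Adj i j := i ≠ j ∧ ((i : ℕ) < s ∧ (j : ℕ) < s ∨ (i : ℕ) = 0 ∨ (j : ℕ) = 0)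
  symm := ⟨fun _ _ h => ⟨h.1.symm, h.2.imp And.symm Or.symm⟩⟩
  loopless := ⟨fun _ h => h.1 rfl⟩

lemma firstClique_le (s m : ℕ) : firstClique s m ≤ cliqueStar s m :=
  fun _ _ h => ⟨h.1, Or.inl h.2⟩

/-- The clique has `s * (s - 1)` ordered pairs. The `s` diagonal pairs are replaced by edges from
`0` to leaves, which is why `s ≤ m` is needed. -/
lemma sq_le_card_cliqueStar {s m : ℕ} (hs : s ≠ 0) (hsm : s ≤ m) :
    s ^ 2 ≤ (adjPairs (cliqueStar s m)).card := by
  classical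
  let f : Fin s × Fin s → Fin (s + m) × Fin (s + m) := fun p =>
    if p.1 = p.2 then (⟨0, by omega⟩, ⟨s + p.1, by omega⟩)
    else (Fin.castAdd m p.1, Fin.castAdd m p.2)
  have hf : ∀ p, f p ∈ adjPairs (cliqueStar s m) := by
    intro p
    rw [mem_adjPairs]
    by_cases hp : p.1 = p.2
    · simp only [f, if_pos hp]
      exact ⟨fun h => by have := congrArg Fin.val h; simp only at this; omega, Or.inr (Or.inl rfl)⟩
    · simp only [f, if_neg hp]
      exact ⟨fun h => hp (Fin.castAdd_injective _ _ h), Or.inl ⟨p.1.2, p.2.2⟩⟩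
  have hinj : Function.Injective f := by
    rintro ⟨a, b⟩ ⟨c, d⟩ h
    have ha := a.2
    have hb := b.2
    have hc := c.2
    have hd := d.2
    simp only [f] at h
    split_ifs at h with h1 h2 h2
    · have h3 := congrArg (fun q => (q.2 : ℕ)) h
      simp only at h3
      simp only [Prod.mk.injEq, Fin.ext_iff] at h1 h2 ⊢
      omega
    · have h3 := congrArg (fun q => (q.2 : ℕ)) h
      simp only [Fin.val_castAdd] at h3
      omega
    · have h3 := congrArg (fun q => (q.2 : ℕ)) h
      simp only [Fin.val_castAdd] at h3
      omega
    · have h3 := congrArg (fun q => (q.1 : ℕ)) h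
      have h4 := congrArg (fun q => (q.2 : ℕ)) h
      simp only [Fin.val_castAdd] at h3 h4
      exact Prod.ext (Fin.ext h3) (Fin.ext h4)
  have h5 := Finset.card_le_card_of_injOn (s := Finset.univ) f (fun p _ => hf p) hinj.injOn
  simpa [sq] using h5

lemma card_cliqueStar_le {s m : ℕ} (hs : s ≠ 0) :
    (adjPairs (cliqueStar s m)).card ≤ (adjPairs (firstClique s m)).card + 2 * (s + m) := by
  classical
  let z : Fin (s + m) := ⟨0, by omega⟩
  have hsub : adjPairs (cliqueStar s m) ⊆ adjPairs (firstClique s m) ∪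
      (Finset.univ.image (fun i => (z, i)) ∪ Finset.univ.image fun i => (i, z)) := by
    rintro ⟨i, j⟩ h
    rw [mem_adjPairs] at h
    simp only [Finset.mem_union, mem_adjPairs, Finset.mem_image, Finset.mem_univ, true_and]
    rcases h.2 with h' | h' | h'
    · exact Or.inl ⟨h.1, h'⟩
    · exact Or.inr (Or.inl ⟨j, Prod.ext (Fin.ext h'.symm) rfl⟩)
    · exact Or.inr (Or.inr ⟨i, Prod.ext rfl (Fin.ext h'.symm)⟩)
  refine (Finset.card_le_card hsub).trans ((Finset.card_union_le _ _).trans ?_)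
  gcongr
  refine (Finset.card_union_le _ _).trans ?_
  have h1 : ∀ f : Fin (s + m) → Fin (s + m) × Fin (s + m),
      (Finset.univ.image f).card ≤ s + m := fun f => Finset.card_image_le.trans (by simp)
  have := h1 fun i => (z, i)
  have := h1 fun i => (i, z)
  omega

lemma card_firstClique_le (s m : ℕ) : (adjPairs (firstClique s m)).card ≤ s ^ 2 := by
  classical
  have h1 := Finset.card_le_card_of_injOn (s := adjPairs (firstClique s m))
    (t := Finset.range s ×ˢ Finset.range s) (fun p => ((p.1 : ℕ), (p.2 : ℕ)))
    (fun p hp => by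
      have := (mem_adjPairs _).1 (Finset.mem_coe.1 hp)
      simpa using this.2)
    (fun p _ q _ h => by
      simp only [Prod.mk.injEq] at h
      exact Prod.ext (Fin.ext h.1) (Fin.ext h.2))
  simpa [sq] using h1

/-- The star with two leaves. -/
def cherry : SimpleGraph (Fin 3) where
  Adj i j := i ≠ j ∧ (i = 0 ∨ j = 0)
  symm := ⟨fun _ _ h => ⟨h.1.symm, h.2.symm⟩⟩
  loopless := ⟨fun _ h => h.1 rfl⟩

lemma cherry_connected : cherry.Connected := by
  rw [SimpleGraph.connected_iff_exists_forall_reachable]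
  refine ⟨0, fun i => ?_⟩
  by_cases hi : i = 0
  · rw [hi]
  · exact SimpleGraph.Adj.reachable ⟨Ne.symm hi, Or.inl rfl⟩

/-- The centre goes to `0` and the two ends to arbitrary leaves, possibly equal, since homomorphisms
need not be injective. -/
lemma sq_le_homs_cherry {s m : ℕ} (hs : s ≠ 0) :
    ((m ^ 2 : ℕ) : ℕ∞) ≤ (homSet cherry (cliqueStar s m)).encard := by
  let z : Fin (s + m) := ⟨0, by omega⟩
  let f : Fin m × Fin m → (Fin 3 → Fin (s + m)) := fun p =>
    ![z, Fin.natAdd s p.1, Fin.natAdd s p.2]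
  have hz : ∀ i : Fin m, (cliqueStar s m).Adj z (Fin.natAdd s i) := fun i =>
    ⟨fun h => by have := congrArg Fin.val h; simp [z] at this; omega, Or.inr (Or.inl rfl)⟩
  have hinj : Function.Injective f := by
    intro p q h
    have h1 := congrFun h 1
    have h2 := congrFun h 2
    exact Prod.ext (Fin.natAdd_injective _ _ h1) (Fin.natAdd_injective _ _ h2)
  have hsub : range f ⊆ homSet cherry (cliqueStar s m) := by
    rintro _ ⟨p, rfl⟩ a b hab
    have h1 := hz p.1
    have h2 := hz p.2
    obtain ⟨hne, h0⟩ := hab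
    fin_cases a <;> fin_cases b <;> simp_all [f, h1.symm, h2.symm]
  refine le_trans (le_of_eq ?_) (Set.encard_le_encard hsub)
  rw [← image_univ, hinj.injOn.encard_image, Set.encard_univ, ENat.card_eq_coe_fintype_card]
  simp [sq]

/-- The number of vertices of the clique. -/
def cliqueSize (n : ℕ) : ℕ := (n + 1) ^ 4

/-- The number of additional leaves. -/
def leafCount (n : ℕ) : ℕ := (n + 1) ^ 7

lemma cliqueSize_ne_zero (n : ℕ) : cliqueSize n ≠ 0 := by simp [cliqueSize]

lemma cliqueSize_le_leafCount (n : ℕ) : cliqueSize n ≤ leafCount n :=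
  Nat.pow_le_pow_right (by omega) (by norm_num)

/-- A sequence of cliques with a large star attached. -/
def cliqueStars (n : ℕ) : SimpleGraph (Fin (cliqueSize n + leafCount n)) :=
  cliqueStar (cliqueSize n) (leafCount n)

lemma pow_le_card_cliqueStars (n : ℕ) : (n + 1) ^ 8 ≤ (adjPairs (cliqueStars n)).card := by
  refine le_trans (le_of_eq ?_)
    (sq_le_card_cliqueStar (cliqueSize_ne_zero n) (cliqueSize_le_leafCount n))
  rw [cliqueSize, ← pow_mul]

lemma card_cliqueStars_ne_zero (n : ℕ) : (adjPairs (cliqueStars n)).card ≠ 0 :=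
  (lt_of_lt_of_le (by positivity) (pow_le_card_cliqueStars n)).ne'

/-- The count is at most `s ^ 2 + 2 * (s + m) ≤ 5 * s ^ 2` with `s ≤ m ≤ s ^ 2`. The bound is
weakened to a perfect square so that its power `3/2` is the integer `125 * (n + 1) ^ 12`. -/
lemma card_cliqueStars_le (n : ℕ) : (adjPairs (cliqueStars n)).card ≤ (5 * (n + 1) ^ 4) ^ 2 := by
  have h1 := card_cliqueStar_le (m := leafCount n) (cliqueSize_ne_zero n)
  have h2 := card_firstClique_le (cliqueSize n) (leafCount n)
  have h3 := cliqueSize_le_leafCount n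
  have h4 : leafCount n ≤ cliqueSize n ^ 2 := by
    rw [leafCount, cliqueSize, ← pow_mul]
    exact Nat.pow_le_pow_right (by omega) (by norm_num)
  have h5 : (5 * (n + 1) ^ 4) ^ 2 = 25 * cliqueSize n ^ 2 := by
    rw [cliqueSize]
    ring
  rw [h5, cliqueStars]
  omega

/-- At most `2 * (s + m) ≤ 4 * (n + 1) ^ 7` ordered pairs lie outside the clique, against at least
`(n + 1) ^ 8` in all: the star is a vanishing fraction of the edges. -/
lemma lintegral_cliqueStars_le (n : ℕ) :
    ∫⁻ p : ℝ≥0 × ℝ≥0, ‖graphGraphon (cliqueStars n) (p.1 * stretchFactor (cliqueStars n))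
      (p.2 * stretchFactor (cliqueStars n)) - unitSquare p‖ₑ ∂(lebesgue.prod lebesgue) ≤
      8 * ((n + 1 : ℕ) : ℝ≥0∞)⁻¹ := by
  refine (lintegral_sub_unitSquare_le (firstClique_le _ _) (fun i j h => h.2.1)
    (sq_le_card_cliqueStar (cliqueSize_ne_zero n) (cliqueSize_le_leafCount n))
    (card_cliqueStars_ne_zero n) (card_cliqueStar_le (cliqueSize_ne_zero n))).trans ?_
  have h1 : 2 * (cliqueSize n + leafCount n) ≤ 4 * (n + 1) ^ 7 := by
    have := cliqueSize_le_leafCount n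
    rw [leafCount] at this ⊢
    omega
  have h0 : ((n + 1 : ℕ) : ℝ≥0∞) ^ 7 ≠ 0 := pow_ne_zero _ (by exact_mod_cast n.succ_ne_zero)
  calc 2 * (((2 * (cliqueSize n + leafCount n) : ℕ) : ℝ≥0∞) / (adjPairs (cliqueStars n)).card)
      ≤ 2 * (((4 * (n + 1) ^ 7 : ℕ) : ℝ≥0∞) / (((n + 1) ^ 8 : ℕ) : ℝ≥0∞)) := by
        gcongr
        exact pow_le_card_cliqueStars n
    _ = 2 * ((4 * ((n + 1 : ℕ) : ℝ≥0∞) ^ 7) / (((n + 1 : ℕ) : ℝ≥0∞) * ((n + 1 : ℕ) : ℝ≥0∞) ^ 7)) := by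
        rw [← pow_succ']
        push_cast
        rfl
    _ = 2 * (4 / ((n + 1 : ℕ) : ℝ≥0∞)) := by
        rw [ENNReal.mul_div_mul_right _ _ h0
          (ENNReal.pow_ne_top (ENNReal.natCast_ne_top _))]
    _ = _ := by
        rw [div_eq_mul_inv, ← mul_assoc]
        norm_num

/-- All the graphs approach the same limit, the indicator of the unit square, so they are close to
one another. -/
lemma stretchedCutConvergent_cliqueStars : StretchedCutConvergent cliqueStars := by
  intro ε hε
  have hlim : Tendsto (fun n : ℕ => 8 * ((n + 1 : ℕ) : ℝ≥0∞)⁻¹ + 8 * ((n + 1 : ℕ) : ℝ≥0∞)⁻¹) atTop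
      (𝓝 0) := by
    have h1 := ENNReal.Tendsto.const_mul (a := 8)
      ((tendsto_add_atTop_iff_nat 1).2 ENNReal.tendsto_inv_nat_nhds_zero) (Or.inr (by simp))
    simpa using h1.add h1
  obtain ⟨n₀, hn₀⟩ := (hlim.eventually (gt_mem_nhds hε)).exists
  refine ⟨n₀, fun m n hm hn => lt_of_le_of_lt ?_ hn₀⟩
  refine (graphStretchedCutDist_le (card_cliqueStars_ne_zero m) (card_cliqueStars_ne_zero n)).trans ?_
  refine add_le_add ((lintegral_cliqueStars_le m).trans ?_) ((lintegral_cliqueStars_le n).trans ?_)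
  · gcongr
  · gcongr

/-- The star alone gives `(n + 1) ^ 14` homomorphisms, against a normalization of order `(n + 1) ^
12`. The exponents `4` and `7` serve both purposes: `7 < 2 * 4` keeps the star negligible in edges,
and `2 * 7 > 3 * 4` makes it dominate here. -/
lemma tendsto_homDensity_cherry :
    Tendsto (fun n => homDensity cherry (cliqueStars n)) atTop (𝓝 ∞) := by
  have hlim : Tendsto (fun n : ℕ => ((n + 1 : ℕ) : ℝ≥0∞) / 125) atTop (𝓝 ∞) := by
    have h1 := ENNReal.Tendsto.div_const (b := 125)
      ((tendsto_add_atTop_iff_nat 1).2 ENNReal.tendsto_nat_nhds_top) (Or.inr (by simp))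
    simpa [ENNReal.top_div] using h1
  refine tendsto_nhds_top_mono hlim (Eventually.of_forall fun n => ?_)
  have h1 : 2 * ((cliqueStars n).edgeSet.encard : ℝ≥0∞) = (adjPairs (cliqueStars n)).card := by
    have := congrArg ENat.toENNReal (card_adjPairs (cliqueStars n))
    rw [ENat.toENNReal_mul, ENat.toENNReal_coe] at this
    exact this.symm
  have h2 : (((n + 1) ^ 14 : ℕ) : ℝ≥0∞) ≤ ((homSet cherry (cliqueStars n)).encard : ℝ≥0∞) := by
    have := ENat.toENNReal_le.2 (sq_le_homs_cherry (m := leafCount n) (cliqueSize_ne_zero n))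
    rw [ENat.toENNReal_coe, leafCount, ← pow_mul] at this
    exact this
  have h3 : ((adjPairs (cliqueStars n)).card : ℝ≥0∞) ^ (((3 : ℕ) : ℝ) / 2) ≤
      ((125 * (n + 1) ^ 12 : ℕ) : ℝ≥0∞) := by
    have h4 : ((adjPairs (cliqueStars n)).card : ℝ≥0∞) ≤
        (((5 * (n + 1) ^ 4 : ℕ) : ℝ≥0∞)) ^ (2 : ℝ) := by
      have := card_cliqueStars_le n
      rw [ENNReal.rpow_ofNat]
      exact_mod_cast this
    refine (ENNReal.rpow_le_rpow h4 (by positivity)).trans (le_of_eq ?_)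
    rw [← ENNReal.rpow_mul, show (2 : ℝ) * (((3 : ℕ) : ℝ) / 2) = ((3 : ℕ) : ℝ) by push_cast; ring,
      ENNReal.rpow_natCast, ← Nat.cast_pow]
    congr 1
    ring
  change _ ≤ homDensity cherry (cliqueStars n)
  rw [homDensity, card_hom, h1]
  refine le_trans ?_ (ENNReal.div_le_div h2 h3)
  have h0 : ((n + 1 : ℕ) : ℝ≥0∞) ^ 12 ≠ 0 := pow_ne_zero _ (by exact_mod_cast n.succ_ne_zero)
  rw [Nat.cast_mul, Nat.cast_pow, Nat.cast_pow,
    show ((n + 1 : ℕ) : ℝ≥0∞) ^ 14 = ((n + 1 : ℕ) : ℝ≥0∞) ^ 2 * ((n + 1 : ℕ) : ℝ≥0∞) ^ 12 by ring,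
    ENNReal.mul_div_mul_right _ _ h0 (ENNReal.pow_ne_top (ENNReal.natCast_ne_top _))]
  push_cast
  gcongr
  have : n + 1 ≤ (n + 1) ^ 2 := by nlinarith
  exact_mod_cast this

theorem exists_stretchedCutConvergent_not_leftConvergent :
    ∃ (N : ℕ → ℕ) (G : ∀ n, SimpleGraph (Fin (N n))),
      Tendsto (fun n => (G n).edgeSet.ncard) atTop atTop ∧
      StretchedCutConvergent G ∧ ¬ LeftConvergent atTop G ∧
      ∃ (k : ℕ) (F : SimpleGraph (Fin k)), 2 ≤ k ∧ F.Connected ∧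
        ¬ ∃ c : ℝ≥0, Tendsto (fun n => homDensity F (G n)) atTop (𝓝 (c : ℝ≥0∞)) := by
  have hno : ¬ ∃ c : ℝ≥0, Tendsto (fun n => homDensity cherry (cliqueStars n)) atTop
      (𝓝 (c : ℝ≥0∞)) := by
    rintro ⟨c, hc⟩
    exact ENNReal.coe_ne_top (tendsto_nhds_unique hc tendsto_homDensity_cherry)
  refine ⟨fun n => cliqueSize n + leafCount n, cliqueStars, ?_, stretchedCutConvergent_cliqueStars,
    fun h => hno (h.homDensity_tendsto 3 (by norm_num) cherry cherry_connected),
    3, cherry, by norm_num, cherry_connected, hno⟩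
  refine tendsto_atTop_mono (f := fun n => n / 2) (fun n => ?_)
    (Nat.tendsto_div_const_atTop (by norm_num))
  have h1 := card_adjPairs (cliqueStars n)
  rw [← (Set.toFinite (cliqueStars n).edgeSet).cast_ncard_eq] at h1
  have h2 : (adjPairs (cliqueStars n)).card = 2 * (cliqueStars n).edgeSet.ncard := by
    exact_mod_cast h1
  have h3 := pow_le_card_cliqueStars n
  have h4 : n + 1 ≤ (n + 1) ^ 8 := Nat.le_self_pow (by norm_num) _
  simp only
  omega

end CliqueStar

end GraphonLeft

end

/-! ### The proposition. -/

open GraphonLeft in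
theorem mainTheorem6 :
    -- (i) and (ii)
    (∀ (S : Type u) [MeasurableSpace S] (μ : Measure S) (W : S → S → ℝ), IsGraphon μ W →
      (∀ x y, W x y ∈ Icc (0 : ℝ) 1) → l1Norm μ W ≠ 0 →
      ∀ (Ω : Type v) [MeasurableSpace Ω] (P : Measure Ω) [IsProbabilityMeasure P]
        (G : ℝ≥0 → Ω → LabeledGraph), IsGraphonProcess μ W P G →
        (∀ k : ℕ, 2 ≤ k → ∀ F : SimpleGraph (Fin k), F.Connected →
          ∀ᵐ ω ∂P, Tendsto (fun t => injDensity F (G t ω).coe) atTop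
            (𝓝 (graphonDensity F μ W))) ∧
        ((∀ p : ℝ≥0∞, 1 ≤ p → p ≠ ∞ → MemLp (degreeFun μ W) p μ) →
          (∀ k : ℕ, 2 ≤ k → ∀ F : SimpleGraph (Fin k), F.Connected →
            graphonDensity F μ W < ∞ ∧
            ∀ᵐ ω ∂P,
              Tendsto (fun t => homDensity F (G t ω).coe) atTop (𝓝 (graphonDensity F μ W)) ∧
              Tendsto (fun t => injDensity F (G t ω).coe) atTop (𝓝 (graphonDensity F μ W))) ∧
          (∀ᵐ ω ∂P, LeftConvergent atTop fun t => (G t ω).removeIsolated.coe) ∧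
          (μ univ < ∞ → IsGraphonProcessWithIsolated μ W P G →
            ∀ᵐ ω ∂P, LeftConvergent atTop fun t => (G t ω).coe))) ∧
    -- (iii)
    (∀ (V : ℕ → Type w) [∀ n, Finite (V n)] (G : ∀ n, SimpleGraph (V n)) (d : ℕ),
      (∀ n (x : V n), ((G n).neighborSet x).ncard ≤ d) →
      Tendsto (fun n => (G n).support.ncard) atTop atTop →
      LeftConvergent atTop G ∧
      ∀ k : ℕ, 3 ≤ k → ∀ F : SimpleGraph (Fin k), F.Connected →
        Tendsto (fun n => homDensity F (G n)) atTop (𝓝 0)) ∧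
    -- (iv), left convergence does not imply convergence in the stretched cut metric
    (∃ (N : ℕ → ℕ) (G : ∀ n, SimpleGraph (Fin (N n))),
      Tendsto (fun n => (G n).edgeSet.ncard) atTop atTop ∧
      LeftConvergent atTop G ∧ ¬ StretchedCutConvergent G) ∧
    -- (iv), convergence in the stretched cut metric does not imply left convergence
    (∃ (N : ℕ → ℕ) (G : ∀ n, SimpleGraph (Fin (N n))),
      Tendsto (fun n => (G n).edgeSet.ncard) atTop atTop ∧
      StretchedCutConvergent G ∧ ¬ LeftConvergent atTop G ∧
      ∃ (k : ℕ) (F : SimpleGraph (Fin k)), 2 ≤ k ∧ F.Connected ∧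
        ¬ ∃ c : ℝ≥0, Tendsto (fun n => homDensity F (G n)) atTop (𝓝 (c : ℝ≥0∞))) := by
  refine ⟨?_, ?_, exists_leftConvergent_not_stretchedCutConvergent,
    exists_stretchedCutConvergent_not_leftConvergent⟩
  · intro S _ μ W hg hW hL Ω _ P _ G hG
    have := hg.sigmaFinite
    exact graphonProcess_densities hg hW hL hG
  · intro V _ G d hd hs
    exact ⟨leftConvergent_of_degree_le hd hs, fun k hk F hF => tendsto_homDensity_zero hd hs hk F hF⟩
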